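/- **Setting.** Let $\Lambda\subset\mathbb R^d$ be a full-rank lattice and let $\mathbb L=\bigcup_{j=1}^N(\beta_j+\Lambda)$ ($N\ge 1$, the $\beta_j$ pairwise inequivalent modulo $\Lambda$) be a multi-lattice. Let $w:\mathbb L\times\mathbb L\to\mathbb R$ be symmetric, $\Lambda$-periodic ($w_{x+v,\,y+v}=w_{xy}$ for $v\in\Lambda$), with finitely many nonzero entries $w_{xy}$ for each $x$, and put $$\Delta_{\mathbb L}\varphi(x)=\sum_{y}w_{xy}\,(\varphi(y)-\varphi(x)),$$ a bounded self-adjoint operator on $l^2(\mathbb L)=l^2(\mathbb L;\mathbb C)$. Let $E_1(k)\le\dots\le E_N(k)$, $k\in\mathbb R^d$, be its Floquet–Bloch bands, i.e. the eigenvalues (with multiplicity) of $-\Delta_{\mathbb L}$ on the functions satisfying $\varphi(x+v)=e^{ik\cdot v}\varphi(x)$ for all $v\in\Lambda$. Assume that $-\Delta_{\mathbb L}$ has a flat band at the maximum of its spectrum: there are a number $E_F$ and an index $j_0$ such that $E_{j_0}(k)=E_F$ for all $k$, and $E_F=\max\operatorname{spec}(-\Delta_{\mathbb L})$. Let $P_{E_F}$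 be the orthogonal projection of $l^2(\mathbb L)$ onto $\ker(-\Delta_{\mathbb L}-E_F)$. Let $\mathfrak S:\mathbb L\to\mathbb L$ be a bijection of finite even order $s$ with $w_{\mathfrak Sx,\mathfrak Sy}=w_{xy}$, and let $x_0\in\mathbb L$ be such that $x_0,\mathfrak Sx_0,\dots,\mathfrak S^{s-1}x_0$ are distinct and $\phi=\sum_{j=0}^{s-1}(-1)^j\delta_{\mathfrak S^jx_0}$ satisfies $-\Delta_{\mathbb L}\phi=E_F\phi$. Assume minimality: every $e\in l^2(\mathbb L)$ with $-\Delta_{\mathbb L}e=E_Fe$ and $\operatorname{supp}e\subset\operatorname{supp}\phi$ is a multiple of $\phi$. For $n=0,\dots,s-1$ set $e_n=s^{-1/2}\sum_{j=0}^{s-1}e^{-2\pi i nj/s}\,\delta_{\mathfrak S^jx_0}$. For $\sigma>0$ consider the defocusing discrete nonlinear Schrödinger equation $$i\partial_t\Psi=-\Delta_{\mathbb L}\Psi+|\Psi|^{2\sigma}\Psi,\qquad \Psi(t)\in l^2(\mathbb L),\ t\in\mathbb R,$$ and the family of minimal compact solitons $\psi^\nu=a_\nu\phi$ ($a_\nu\in\mathbb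 C$), $\nu>0$, parametrized by the power $\mathcal N[\psi^\nu]=\sum_x|\psi^\nu(x)|^2=\nu$. The state $\psi$ is called (orbitally) *stable* if for every $\varepsilon>0$ there is $\delta>0$ such that every initial datum at $l^2$-distance less than $\delta$ from the orbit $\mathcal O_\psi=\{e^{i\theta}\psi:\theta\in[0,2\pi)\}$ launches a global solution, and every such solution stays at distance less than $\varepsilon$ from $\mathcal O_\psi$ for all $t\in\mathbb R$. It is called *unstable* if for some $\varepsilon>0$ there are global solutions, starting arbitrarily close to $\mathcal O_\psi$, that at some time are at distance at least $\varepsilon$ from $\mathcal O_\psi$. **Theorem.** There is a critical value $0<\sigma^{\rm cr}\le\infty$ such that: 1. for every $\sigma\in(0,\sigma^{\rm cr})$ there is a threshold power $0<\mathcal N_{\rm thr}(\sigma)<\infty$ such that $\psi^\nu$ is stable if $0<\nu<\mathcal N_{\rm thr}(\sigma)$ and unstable if $\nu>\mathcal N_{\rm thr}(\sigma)$; 2. for every real $\sigma>\sigma^{\rm cr}$, $\psi^\nu$ is unstable for every $\nu>0$. Moreover, for each $\sigma>0$, the states $\psi^\nu$ are stable for all sufficiently small $\nu>0$ if and only if $$\max_{0\le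 n\le s-1,\ n\ne s/2}\ \|P_{E_F}e_n\|^2<\frac1{2\sigma+1},$$ and if this condition fails, $\psi^\nu$ is unstable for every $\nu>0$. -/

import Mathlib

open scoped ENNReal Matrix

noncomputable section

/-- A multi-lattice in `ℝ^d`: a Bravais lattice `Λ` (a full-rank discrete additive subgroup)
together with `N ≥ 1` base points, pairwise inequivalent modulo `Λ`. -/
structure MultiLattice (d : ℕ) where
  /-- the Bravais lattice -/
  Λ : Submodule ℤ (EuclideanSpace ℝ (Fin d))
  discrete : DiscreteTopology Λ
  isZLattice : IsZLattice ℝ Λ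
  /-- the number of sites in a cell -/
  N : ℕ
  N_pos : 0 < N
  /-- the sites of the fundamental cell -/
  base : Fin N → EuclideanSpace ℝ (Fin d)
  base_distinct : ∀ i j, base i - base j ∈ Λ → i = j

namespace MultiLattice

variable {d : ℕ}

/-- The sites of the multi-lattice, i.e. the union of the `N` translates `base j + Λ`. -/
def Sites (L : MultiLattice d) : Type :=
  {x : EuclideanSpace ℝ (Fin d) // ∃ j, ∃ v ∈ L.Λ, x = L.base j + v}

/-- Translation of a site by a vector of the Bravais lattice. -/
def translate (L : MultiLattice d) (v : L.Λ) (x : L.Sites) : L.Sites :=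
  ⟨x.1 + v.1, by
    obtain ⟨j, u, hu, hx⟩ := x.2
    exact ⟨j, u + v.1, L.Λ.add_mem hu v.2, by rw [hx, add_assoc]⟩⟩

/-- The base point `base j`, as a site. -/
def baseSite (L : MultiLattice d) (j : Fin L.N) : L.Sites :=
  ⟨L.base j, j, 0, L.Λ.zero_mem, by simp⟩

theorem translate_translate (L : MultiLattice d) (u v : L.Λ) (x : L.Sites) :
    L.translate u (L.translate v x) = L.translate (v + u) x := by
  apply Subtype.ext
  simp [translate, add_assoc]

theorem translate_zero (L : MultiLattice d) (x : L.Sites) : L.translate 0 x = x := by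
  apply Subtype.ext
  simp [translate]

theorem exists_eq_translate (L : MultiLattice d) (x : L.Sites) :
    ∃ j v, x = L.translate v (L.baseSite j) := by
  obtain ⟨j, u, hu, hx⟩ := x.2
  exact ⟨j, ⟨u, hu⟩, Subtype.ext hx⟩

end MultiLattice

/-- A multi-lattice with a connectivity matrix `w`: real, symmetric, invariant under translation
by the Bravais lattice. Two sites `x`, `y` are neighbours when `w x y ≠ 0`; every site has finitely
many neighbours. -/
structure WeightedMultiLattice (d : ℕ) extends MultiLattice d where
  w : toMultiLattice.Sites → toMultiLattice.Sites → ℝ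
  w_symm : ∀ x y, w x y = w y x
  w_periodic : ∀ (v : toMultiLattice.Λ) (x y : toMultiLattice.Sites),
    w (toMultiLattice.translate v x) (toMultiLattice.translate v y) = w x y
  w_finite : ∀ x, {y | w x y ≠ 0}.Finite

namespace WeightedMultiLattice

variable {d : ℕ}

/-- The Hilbert space `ℓ²(𝕃; ℂ)` of wave functions. -/
abbrev Wave (L : WeightedMultiLattice d) : Type :=
  lp (fun _ : L.Sites => ℂ) 2

/-- The Laplacian, `Δφ(x) = ∑_{y ∼ x} w x y (φ(y) - φ(x))`, on arbitrary functions. -/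
def lap (L : WeightedMultiLattice d) (φ : L.Sites → ℂ) (x : L.Sites) : ℂ :=
  ∑ᶠ y, (L.w x y : ℂ) * (φ y - φ x)

/-- The neighbours of a site. -/
def nbrs (L : WeightedMultiLattice d) (x : L.Sites) : Finset L.Sites :=
  (L.w_finite x).toFinset

theorem mem_nbrs (L : WeightedMultiLattice d) (x y : L.Sites) :
    y ∈ L.nbrs x ↔ L.w x y ≠ 0 := by
  simp [nbrs]

theorem lap_eq_sum (L : WeightedMultiLattice d) (φ : L.Sites → ℂ) (x : L.Sites) :
    L.lap φ x = ∑ y ∈ L.nbrs x, (L.w x y : ℂ) * (φ y - φ x) := by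
  apply finsum_eq_sum_of_support_subset
  intro y hy
  have h : L.w x y ≠ 0 := by
    intro h0
    simp [h0] at hy
  simpa [mem_nbrs] using h

theorem exists_row_bound (L : WeightedMultiLattice d) :
    ∃ C : ℝ, 0 ≤ C ∧ ∀ (x : L.Sites) (t : Finset L.Sites), ∑ y ∈ t, |L.w x y| ≤ C := by
  classical
  refine ⟨∑ j, ∑ y ∈ L.nbrs (L.baseSite j), |L.w (L.baseSite j) y|,
    Finset.sum_nonneg fun j _ => Finset.sum_nonneg fun y _ => abs_nonneg _, ?_⟩
  intro x t
  obtain ⟨j, v, rfl⟩ := L.exists_eq_translate x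
  have hinj : Function.Injective (L.translate (-v)) := by
    intro a b hab
    have := congrArg (L.translate v) hab
    simpa [MultiLattice.translate_translate, MultiLattice.translate_zero] using this
  have h1 : ∀ y, L.w (L.translate v (L.baseSite j)) y
      = L.w (L.baseSite j) (L.translate (-v) y) := by
    intro y
    have := L.w_periodic v (L.baseSite j) (L.translate (-v) y)
    rw [MultiLattice.translate_translate] at this
    simpa [MultiLattice.translate_zero] using this
  calc ∑ y ∈ t, |L.w (L.translate v (L.baseSite j)) y|
      = ∑ y ∈ t.image (L.translate (-v)), |L.w (L.baseSite j) y| := by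
        rw [Finset.sum_image (fun a _ b _ h => hinj h)]
        simp [h1]
    _ ≤ ∑ y ∈ t.image (L.translate (-v)) ∪ L.nbrs (L.baseSite j), |L.w (L.baseSite j) y| :=
        Finset.sum_le_sum_of_subset_of_nonneg Finset.subset_union_left
          (fun _ _ _ => abs_nonneg _)
    _ = ∑ y ∈ L.nbrs (L.baseSite j), |L.w (L.baseSite j) y| := by
        symm
        apply Finset.sum_subset Finset.subset_union_right
        intro y _ hy
        rw [mem_nbrs, not_not] at hy
        simp [hy]
    _ ≤ _ := Finset.single_le_sum
        (f := fun j => ∑ y ∈ L.nbrs (L.baseSite j), |L.w (L.baseSite j) y|)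
        (fun j _ => Finset.sum_nonneg fun y _ => abs_nonneg _) (Finset.mem_univ j)

theorem lap_sum_bound (L : WeightedMultiLattice d) :
    ∃ K : ℝ, 0 ≤ K ∧ ∀ (φ : L.Wave) (t : Finset L.Sites),
      ∑ x ∈ t, ‖L.lap φ x‖ ^ 2 ≤ (K * ‖φ‖) ^ 2 := by
  classical
  obtain ⟨C, hC0, hC⟩ := L.exists_row_bound
  refine ⟨2 * C, by positivity, fun φ t => ?_⟩
  have hφ : ∀ u : Finset L.Sites, ∑ x ∈ u, ‖φ x‖ ^ 2 ≤ ‖φ‖ ^ 2 := by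
    intro u
    have := lp.sum_rpow_le_norm_rpow (p := 2) (by norm_num) φ u
    simpa using this
  have hpt : ∀ x, ‖L.lap φ x‖ ^ 2 ≤
      2 * C ^ 2 * ‖φ x‖ ^ 2 + 2 * C * ∑ y ∈ L.nbrs x, |L.w x y| * ‖φ y‖ ^ 2 := by
    intro x
    have e1 : ‖L.lap φ x‖ ≤ ∑ y ∈ L.nbrs x, |L.w x y| * ‖φ y - φ x‖ := by
      rw [lap_eq_sum]
      refine (norm_sum_le _ _).trans (le_of_eq ?_)
      simp
    have e2 : (∑ y ∈ L.nbrs x, |L.w x y| * ‖φ y - φ x‖) ^ 2 ≤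
        (∑ y ∈ L.nbrs x, |L.w x y|) * ∑ y ∈ L.nbrs x, |L.w x y| * ‖φ y - φ x‖ ^ 2 := by
      apply Finset.sum_sq_le_sum_mul_sum_of_sq_le_mul
      · intro i _; positivity
      · intro i _; positivity
      · intro i _; exact le_of_eq (by ring)
    have e3 : ∑ y ∈ L.nbrs x, |L.w x y| * ‖φ y - φ x‖ ^ 2 ≤
        2 * ∑ y ∈ L.nbrs x, |L.w x y| * ‖φ y‖ ^ 2
          + 2 * (∑ y ∈ L.nbrs x, |L.w x y|) * ‖φ x‖ ^ 2 := by
      rw [Finset.mul_sum, Finset.mul_sum, Finset.sum_mul, ← Finset.sum_add_distrib]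
      apply Finset.sum_le_sum
      intro y _
      have h := norm_sub_le (φ y) (φ x)
      have h' : ‖φ y - φ x‖ ^ 2 ≤ 2 * ‖φ y‖ ^ 2 + 2 * ‖φ x‖ ^ 2 := by
        have : ‖φ y - φ x‖ ^ 2 ≤ (‖φ y‖ + ‖φ x‖) ^ 2 := by gcongr
        nlinarith [sq_nonneg (‖φ y‖ - ‖φ x‖)]
      nlinarith [abs_nonneg (L.w x y), mul_le_mul_of_nonneg_left h' (abs_nonneg (L.w x y))]
    have hS := hC x (L.nbrs x)
    have hS0 : 0 ≤ ∑ y ∈ L.nbrs x, |L.w x y| := Finset.sum_nonneg fun _ _ => abs_nonneg _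
    have hT0 : 0 ≤ ∑ y ∈ L.nbrs x, |L.w x y| * ‖φ y‖ ^ 2 :=
      Finset.sum_nonneg fun _ _ => by positivity
    calc ‖L.lap φ x‖ ^ 2 ≤ (∑ y ∈ L.nbrs x, |L.w x y| * ‖φ y - φ x‖) ^ 2 := by gcongr
      _ ≤ _ := e2
      _ ≤ C * (2 * ∑ y ∈ L.nbrs x, |L.w x y| * ‖φ y‖ ^ 2 + 2 * C * ‖φ x‖ ^ 2) := by
        apply mul_le_mul hS _ (Finset.sum_nonneg fun _ _ => by positivity) hC0
        refine e3.trans ?_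
        gcongr
      _ = _ := by ring
  have hsw : ∑ x ∈ t, ∑ y ∈ L.nbrs x, |L.w x y| * ‖φ y‖ ^ 2 ≤ C * ‖φ‖ ^ 2 := by
    calc ∑ x ∈ t, ∑ y ∈ L.nbrs x, |L.w x y| * ‖φ y‖ ^ 2
        = ∑ x ∈ t, ∑ y ∈ t.biUnion L.nbrs, |L.w x y| * ‖φ y‖ ^ 2 := by
          apply Finset.sum_congr rfl
          intro x hx
          apply Finset.sum_subset (Finset.subset_biUnion_of_mem L.nbrs hx)
          intro y _ hy
          rw [mem_nbrs, not_not] at hy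
          simp [hy]
      _ = ∑ y ∈ t.biUnion L.nbrs, (∑ x ∈ t, |L.w y x|) * ‖φ y‖ ^ 2 := by
          rw [Finset.sum_comm]
          apply Finset.sum_congr rfl
          intro y _
          rw [Finset.sum_mul]
          apply Finset.sum_congr rfl
          intro x _
          rw [L.w_symm]
      _ ≤ ∑ y ∈ t.biUnion L.nbrs, C * ‖φ y‖ ^ 2 := by
          apply Finset.sum_le_sum
          intro y _
          have := hC y t
          gcongr
      _ ≤ C * ‖φ‖ ^ 2 := by
          rw [← Finset.mul_sum]
          have := hφ (t.biUnion L.nbrs)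
          gcongr
  calc ∑ x ∈ t, ‖L.lap φ x‖ ^ 2
      ≤ ∑ x ∈ t, (2 * C ^ 2 * ‖φ x‖ ^ 2
          + 2 * C * ∑ y ∈ L.nbrs x, |L.w x y| * ‖φ y‖ ^ 2) :=
        Finset.sum_le_sum fun x _ => hpt x
    _ = 2 * C ^ 2 * ∑ x ∈ t, ‖φ x‖ ^ 2
          + 2 * C * ∑ x ∈ t, ∑ y ∈ L.nbrs x, |L.w x y| * ‖φ y‖ ^ 2 := by
        rw [Finset.sum_add_distrib, Finset.mul_sum, Finset.mul_sum]
    _ ≤ 2 * C ^ 2 * ‖φ‖ ^ 2 + 2 * C * (C * ‖φ‖ ^ 2) := by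
        have := hφ t
        gcongr
    _ = (2 * C * ‖φ‖) ^ 2 := by ring

/-- The Laplacian of an `ℓ²` wave function is in `ℓ²`. -/
def lapWave (L : WeightedMultiLattice d) (φ : L.Wave) : L.Wave :=
  ⟨L.lap φ, by
    obtain ⟨K, _, hK⟩ := L.lap_sum_bound
    apply memℓp_gen' (C := (K * ‖φ‖) ^ 2)
    intro t
    simpa using hK φ t⟩

/-- The bounded operator `-Δ` on `ℓ²`. -/
def negLaplacian (L : WeightedMultiLattice d) : L.Wave →L[ℂ] L.Wave :=
  LinearMap.mkContinuousOfExistsBound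
    { toFun := fun φ => -L.lapWave φ
      map_add' := by
        intro φ χ
        ext x
        simp only [lapWave, lp.coeFn_neg, lp.coeFn_add, Pi.neg_apply, Pi.add_apply, lap_eq_sum]
        rw [← neg_add, ← Finset.sum_add_distrib]
        congr 1
        apply Finset.sum_congr rfl
        intro y _
        ring
      map_smul' := by
        intro c φ
        ext x
        simp only [lapWave, lp.coeFn_neg, lp.coeFn_smul, Pi.neg_apply, Pi.smul_apply, lap_eq_sum,
          smul_eq_mul, RingHom.id_apply]
        rw [mul_neg, Finset.mul_sum]
        congr 1
        apply Finset.sum_congr rfl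
        intro y _
        ring }
    (by
      obtain ⟨K, hK0, hK⟩ := L.lap_sum_bound
      refine ⟨K, fun φ => ?_⟩
      change ‖-L.lapWave φ‖ ≤ K * ‖φ‖
      rw [norm_neg]
      apply lp.norm_le_of_forall_sum_le (p := 2) (by norm_num) (by positivity)
      intro t
      have h := hK φ t
      change ∑ x ∈ t, ‖L.lap φ x‖ ^ (2 : ℝ≥0∞).toReal ≤ (K * ‖φ‖) ^ (2 : ℝ≥0∞).toReal
      simpa using h)

theorem negLaplacian_apply (L : WeightedMultiLattice d) (φ : L.Wave) (x : L.Sites) :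
    L.negLaplacian φ x = -L.lap φ x := rfl

/-- The Bloch matrix at quasi-momentum `k`: the matrix of `-Δ` on the functions with
`φ(x + v) = e^{i k·v} φ(x)` for `v ∈ Λ`, in terms of the values of `φ` at the base points. -/
def blochMatrix (L : WeightedMultiLattice d) (k : EuclideanSpace ℝ (Fin d)) :
    Matrix (Fin L.N) (Fin L.N) ℂ :=
  Matrix.diagonal (fun i => ((∑ᶠ y, L.w (L.baseSite i) y : ℝ) : ℂ)) -
    Matrix.of fun i j => ∑ᶠ v : L.Λ,
      (L.w (L.baseSite i) (L.translate v (L.baseSite j)) : ℂ) *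
        Complex.exp (Complex.I * ((inner ℝ k v.1 : ℝ) : ℂ))

theorem blochMatrix_isHermitian (L : WeightedMultiLattice d) (k : EuclideanSpace ℝ (Fin d)) :
    (L.blochMatrix k).IsHermitian := by
  apply Matrix.IsHermitian.sub
  · rw [Matrix.isHermitian_diagonal_iff]
    intro i
    simp [isSelfAdjoint_iff]
  · ext i j
    rw [Matrix.conjTranspose_apply, Matrix.of_apply, Matrix.of_apply]
    have h := (starRingAut (R := ℂ)).toAddEquiv.map_finsum (fun v : L.Λ =>
      (L.w (L.baseSite j) (L.translate v (L.baseSite i)) : ℂ) *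
        Complex.exp (Complex.I * ((inner ℝ k v.1 : ℝ) : ℂ)))
    refine h.trans ?_
    refine finsum_eq_of_bijective (fun v : L.Λ => -v) (Equiv.neg _).bijective fun v => ?_
    have hw : L.w (L.baseSite j) (L.translate v (L.baseSite i))
        = L.w (L.baseSite i) (L.translate (-v) (L.baseSite j)) := by
      have := L.w_periodic (-v) (L.baseSite j) (L.translate v (L.baseSite i))
      rw [MultiLattice.translate_translate] at this
      simp only [add_neg_cancel, MultiLattice.translate_zero] at this
      rw [← this, L.w_symm]
    rw [← hw]
    simp [starRingAut, ← Complex.exp_conj]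

/-- The band functions `E_1(k) ≤ E_2(k) ≤ ⋯ ≤ E_N(k)`: the eigenvalues of the Bloch matrix,
with multiplicity, in increasing order. -/
def band (L : WeightedMultiLattice d) (j : Fin L.N) (k : EuclideanSpace ℝ (Fin d)) : ℝ :=
  (L.blochMatrix_isHermitian k).eigenvalues₀ (Fin.cast (by simp) (Fin.rev j))

/-- `-Δ` has a flat band at the energy `E`, and `E` is the maximum of its spectrum. -/
def HasFlatBandAtTop (L : WeightedMultiLattice d) (E : ℝ) : Prop :=
  (∃ j, ∀ k, L.band j k = E) ∧ IsGreatest (spectrum ℝ L.negLaplacian) E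

open scoped Classical in
/-- The wave function `∑_{j < s} c(j) δ_{𝔖^j x₀}`. -/
def orbitWave (L : WeightedMultiLattice d) (S : Equiv.Perm L.Sites) (s : ℕ) (x₀ : L.Sites)
    (c : ℕ → ℂ) : L.Wave :=
  ∑ j ∈ Finset.range s, lp.single 2 ((S ^ j) x₀) (c j)

/-- The alternating wave function `∑_{j < s} (-1)^j δ_{𝔖^j x₀}`. -/
def alternating (L : WeightedMultiLattice d) (S : Equiv.Perm L.Sites) (s : ℕ) (x₀ : L.Sites) :
    L.Wave :=
  L.orbitWave S s x₀ (fun j => (-1) ^ j)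

/-- The unit vector `e_n = s^{-1/2} ∑_{j < s} ω^{-nj} δ_{𝔖^j x₀}`, with `ω = e^{2πi/s}`, supported
on the orbit of `x₀` and satisfying `e_n(𝔖⁻¹ x) = ω^n e_n(x)`. -/
def orbitMode (L : WeightedMultiLattice d) (S : Equiv.Perm L.Sites) (s : ℕ) (x₀ : L.Sites)
    (n : ℕ) : L.Wave :=
  L.orbitWave S s x₀ (fun j =>
    ((1 / Real.sqrt s : ℝ) : ℂ) *
      Complex.exp (-(2 * Real.pi * Complex.I * (n : ℂ) * (j : ℂ) / (s : ℂ))))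

/-- The data `(𝔖, s, x₀)` generate a minimal compact flat band state at the energy `E`. -/
structure IsMinimalCompactState (L : WeightedMultiLattice d) (E : ℝ)
    (S : Equiv.Perm L.Sites) (s : ℕ) (x₀ : L.Sites) : Prop where
  /-- `𝔖` is cyclic of even order `s ≥ 1` -/
  s_pos : 0 < s
  s_even : Even s
  order_eq : orderOf S = s
  /-- `𝔖` is a symmetry of the connectivity matrix -/
  w_invariant : ∀ x y, L.w (S x) (S y) = L.w x y
  /-- the points `x₀, 𝔖 x₀, …, 𝔖^{s-1} x₀` are distinct -/
  orbit_distinct : Set.InjOn (fun j : ℕ => (S ^ j) x₀) (Set.Iio s)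
  /-- the alternating function on the orbit is an eigenfunction -/
  eigen : L.negLaplacian (L.alternating S s x₀) = (E : ℂ) • L.alternating S s x₀
  /-- minimality -/
  minimal : ∀ e : L.Wave, L.negLaplacian e = (E : ℂ) • e →
    Function.support e ⊆ Function.support (L.alternating S s x₀) →
    e ∈ Submodule.span ℂ {L.alternating S s x₀}

/-- The flat band eigenspace `ker(-Δ - E)` in `ℓ²`. -/
abbrev flatEigenspace (L : WeightedMultiLattice d) (E : ℝ) : Submodule ℂ L.Wave :=
  (L.negLaplacian - (E : ℂ) • ContinuousLinearMap.id ℂ L.Wave).ker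

/-- The power `𝒩[φ] = ∑_x |φ(x)|²`. -/
def power (L : WeightedMultiLattice d) (φ : L.Wave) : ℝ :=
  ∑' x, ‖φ x‖ ^ 2

/-- `Ψ` is a global `ℓ²`-valued solution of
`i ∂ₜΨ = -ΔΨ + |Ψ|^{2σ} Ψ`. -/
def IsDNLSSolution (L : WeightedMultiLattice d) (σ : ℝ) (Ψ : ℝ → L.Wave) : Prop :=
  ∀ t : ℝ, ∃ D : L.Wave, HasDerivAt Ψ D t ∧
    ∀ x, Complex.I * D x =
      L.negLaplacian (Ψ t) x + ((‖Ψ t x‖ ^ (2 * σ) : ℝ) : ℂ) * Ψ t x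

/-- The orbit `{e^{iθ} ψ : θ ∈ [0, 2π)}`. -/
def phaseOrbit (L : WeightedMultiLattice d) (ψ : L.Wave) : Set L.Wave :=
  (fun θ : ℝ => Complex.exp (Complex.I * (θ : ℂ)) • ψ) '' Set.Ico 0 (2 * Real.pi)

/-- Nonlinear orbital stability of `ψ`: every initial datum close enough to the orbit of `ψ`
launches a global solution, and every such solution stays close to the orbit for all times. -/
def IsOrbitallyStable (L : WeightedMultiLattice d) (σ : ℝ) (ψ : L.Wave) : Prop :=
  ∀ ε > 0, ∃ δ > 0, ∀ φ₀ : L.Wave, Metric.infDist φ₀ (L.phaseOrbit ψ) < δ →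
    (∃ Ψ : ℝ → L.Wave, L.IsDNLSSolution σ Ψ ∧ Ψ 0 = φ₀) ∧
    ∀ Ψ : ℝ → L.Wave, L.IsDNLSSolution σ Ψ → Ψ 0 = φ₀ →
      ∀ t, Metric.infDist (Ψ t) (L.phaseOrbit ψ) < ε

/-- Nonlinear orbital instability of `ψ`: there are solutions starting arbitrarily close to the
orbit of `ψ` that leave a fixed neighbourhood of it. -/
def IsOrbitallyUnstable (L : WeightedMultiLattice d) (σ : ℝ) (ψ : L.Wave) : Prop :=
  ∃ ε > 0, ∀ δ > 0, ∃ Ψ : ℝ → L.Wave, L.IsDNLSSolution σ Ψ ∧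
    Metric.infDist (Ψ 0) (L.phaseOrbit ψ) < δ ∧
    ∃ t, ε ≤ Metric.infDist (Ψ t) (L.phaseOrbit ψ)

/-- The spectral criterion `max_{n ≠ s/2} ‖P_E e_n‖² < 1 / (2σ + 1)`. -/
def SpectralCriterion (L : WeightedMultiLattice d) (E : ℝ) (S : Equiv.Perm L.Sites) (s : ℕ)
    (x₀ : L.Sites) (σ : ℝ) : Prop :=
  ∀ n < s, n ≠ s / 2 →
    ‖(L.flatEigenspace E).starProjection (L.orbitMode S s x₀ n)‖ ^ 2 < 1 / (2 * σ + 1)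

end WeightedMultiLattice

end

/-! ### Global solutions of Lipschitz differential equations -/

/-! Put A = E_F + Δ, which is nonnegative because E_F is the top of the spectrum. Rotate the phase
so that ψ = √ρ φ is real, with ρ = ν/s, and let κ = ρ^σ and χ be the restriction to the support of
φ. In the frame rotating with frequency E_F + κ, the linearization at ψ couples the real and
imaginary parts of a perturbation through L₋ = A + κ − κχ (`linMinus`) and L₊ = (2σ+1)κχ − (A + κ)
(`linPlus`). Everything depends on the sign of L₊ on the orthogonal complement of ψ.

By a Birman–Schwinger argument, L₊ is negative there exactly when (2σ+1) κ χ(A+κ)⁻¹χ < 1 on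
functions supported on the orbit and orthogonal to φ. The resolvent commutes with 𝔖, so this
compression is diagonal in the Fourier modes e_n, with entries F_n(κ) = κ⟨e_n, (A+κ)⁻¹e_n⟩
(`resolventForm`). The mode n = s/2 is φ itself; for the others minimality gives A e_n ≠ 0. Hence
F_n is strictly increasing in κ, its limit as κ → 0 is ‖P e_n‖², its limit as κ → ∞ is 1, and ‖P
e_n‖² < F_n < 1. The condition max F_n(κ) < 1/(2σ+1) therefore holds below a threshold in κ if max
‖P e_n‖² < 1/(2σ+1), and otherwise some F_n(κ) exceeds 1/(2σ+1) for every κ > 0, even in the case of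
equality. Since κ = (ν/s)^σ, a threshold in κ is one in ν. The critical exponent is the supremum of
the σ satisfying the spectral criterion, which is decreasing in σ.

Stability (`exists_stability_radius`): if all F_n are below 1/(2σ+1), then minus the energy, plus
(E_F+κ) times the mass, plus a penalty on the mass defect, is conserved and coercive at ψ modulo
phase.

Instability (`exists_unstable_radius`): since F_n < 1, L₋ is positive definite on the complement of
ψ, while some F_n above 1/(2σ+1) gives a direction where L₊ is positive. Dividing a solution by its
component along ψ leaves a perturbation orthogonal to ψ that obeys u' = L₋y, y' = L₊u up to
superlinear errors. A Chetaev argument in the variables ⟨u, L₋⁻¹u⟩ and ⟨u, y⟩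
(`exists_escape_radius`) forces it out of a fixed ball. It uses only quadratic forms, so no growing
eigenvector of the linearization is needed. -/

theorem exists_global_solution_of_lipschitz_of_bounded {E : Type*} [NormedAddCommGroup E]
    [NormedSpace ℝ E] [CompleteSpace E] {f : E → E} {K : NNReal} (hf : LipschitzWith K f)
    {M : ℝ} (hM : ∀ x, ‖f x‖ ≤ M) (x₀ : E) :
    ∃ γ : ℝ → E, γ 0 = x₀ ∧ ∀ t, HasDerivAt γ (f (γ t)) t := by
  have hM0 : 0 ≤ M := (norm_nonneg _).trans (hM x₀)
  have hloc : ∀ T : ℝ, ∃ α : ℝ → E, α 0 = x₀ ∧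
      ∀ t ∈ Set.Ioo (-T) T, HasDerivAt α (f (α t)) t := by
    intro T
    rcases lt_or_ge 0 T with hT | hT
    · have h0 : (0 : ℝ) ∈ Set.Icc (-T) T := ⟨by linarith, hT.le⟩
      have hPL : IsPicardLindelof (fun _ : ℝ => f) (⟨0, h0⟩ : Set.Icc (-T) T) x₀
          (M * T).toNNReal 0 M.toNNReal K := by
        apply IsPicardLindelof.of_time_independent
        · intro x _
          rw [Real.coe_toNNReal _ hM0]
          exact hM x
        · exact hf.lipschitzOnWith
        · rw [Real.coe_toNNReal _ hM0, Real.coe_toNNReal _ (by positivity)]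
          simp
      obtain ⟨α, h1, h2⟩ := hPL.exists_eq_forall_mem_Icc_hasDerivWithinAt₀
      exact ⟨α, h1, fun t ht =>
        (h2 t (Set.Ioo_subset_Icc_self ht)).hasDerivAt (Icc_mem_nhds ht.1 ht.2)⟩
    · exact ⟨fun _ => x₀, rfl, fun t ht => absurd (ht.1.trans ht.2) (by linarith)⟩
  choose α hα0 hα using hloc
  have huniq : ∀ a b : ℝ, 0 < a → a ≤ b → Set.EqOn (α a) (α b) (Set.Ioo (-a) a) := by
    intro a b ha hab
    refine ODE_solution_unique_of_mem_Ioo (v := fun _ => f) (s := fun _ => Set.univ) (K := K)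
      (t₀ := 0) (fun _ _ => hf.lipschitzOnWith) ⟨by linarith, ha⟩
      (fun t ht => ⟨hα a t ht, trivial⟩)
      (fun t ht => ⟨hα b t ⟨by linarith [ht.1], by linarith [ht.2]⟩, trivial⟩) ?_
    rw [hα0, hα0]
  -- Gluing: at time `t` the solution on the interval of radius `|t| + 1` is read off; by uniqueness
  -- the choices at nearby times agree, so the glued curve is differentiable.
  refine ⟨fun t => α (|t| + 1) t, hα0 _, fun t => ?_⟩
  have ht : t ∈ Set.Ioo (-(|t| + 1)) (|t| + 1) := by
    constructor <;> cases abs_cases t <;> linarith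
  refine (hα (|t| + 1) t ht).congr_of_eventuallyEq ?_
  filter_upwards [Ioo_mem_nhds ht.1 ht.2] with r hr
  have hr' : |r| < |t| + 1 := abs_lt.2 hr
  have hr2 : r ∈ Set.Ioo (-(|r| + 1)) (|r| + 1) := by
    constructor <;> cases abs_cases r <;> linarith
  have hr0 := abs_nonneg r
  have ht0 := abs_nonneg t
  rcases le_total (|r| + 1) (|t| + 1) with h | h
  · exact huniq _ _ (by positivity) h hr2
  · exact (huniq _ _ (by positivity) h hr).symm

/-- The radial retraction onto the ball of radius `r`. -/
noncomputable def radialRetraction {E : Type*} [NormedAddCommGroup E] [NormedSpace ℝ E] (r : ℝ) (x : E) : E :=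
  (r / max r ‖x‖) • x

section radialRetraction

variable {E : Type*} [NormedAddCommGroup E] [NormedSpace ℝ E] {r : ℝ}

theorem norm_radialRetraction_le (hr : 0 < r) (x : E) : ‖radialRetraction r x‖ ≤ r := by
  have hm : 0 < max r ‖x‖ := lt_max_of_lt_left hr
  rw [radialRetraction, norm_smul, Real.norm_of_nonneg (by positivity), div_mul_eq_mul_div,
    div_le_iff₀ hm]
  exact mul_le_mul_of_nonneg_left (le_max_right _ _) hr.le

theorem radialRetraction_of_norm_le (hr : 0 < r) {x : E} (hx : ‖x‖ ≤ r) :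
    radialRetraction r x = x := by
  rw [radialRetraction, max_eq_left hx, div_self hr.ne', one_smul]

/-- One unit of the constant comes from scaling `x - y`, the other from the change of the scaling
factor. No inner product is needed. -/
theorem radialRetraction_lipschitz (hr : 0 < r) (x y : E) :
    ‖radialRetraction r x - radialRetraction r y‖ ≤ 2 * ‖x - y‖ := by
  have hx : 0 < max r ‖x‖ := lt_max_of_lt_left hr
  have hy : 0 < max r ‖y‖ := lt_max_of_lt_left hr
  have e : radialRetraction r x - radialRetraction r y
      = (r / max r ‖x‖) • (x - y) + (r / max r ‖x‖ - r / max r ‖y‖) • y := by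
    simp only [radialRetraction, smul_sub, sub_smul]
    abel
  have h1 : ‖(r / max r ‖x‖) • (x - y)‖ ≤ ‖x - y‖ := by
    rw [norm_smul, Real.norm_of_nonneg (by positivity)]
    have : r / max r ‖x‖ ≤ 1 := (div_le_one hx).2 (le_max_left _ _)
    exact mul_le_of_le_one_left (norm_nonneg _) this
  have h2 : ‖(r / max r ‖x‖ - r / max r ‖y‖) • y‖ ≤ ‖x - y‖ := by
    have e2 : r / max r ‖x‖ - r / max r ‖y‖
        = (r / max r ‖x‖) * ((max r ‖y‖ - max r ‖x‖) / max r ‖y‖) := by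
      field_simp
    have e3 : |max r ‖y‖ - max r ‖x‖| ≤ ‖x - y‖ := by
      rw [max_comm r, max_comm r]
      exact ((abs_max_sub_max_le_abs _ _ _).trans (abs_norm_sub_norm_le y x)).trans
        (norm_sub_rev y x).le
    rw [norm_smul, e2, Real.norm_eq_abs, abs_mul, abs_div, abs_div, abs_of_pos hr, abs_of_pos hx,
      abs_of_pos hy]
    have h3 : r / max r ‖x‖ ≤ 1 := (div_le_one hx).2 (le_max_left _ _)
    have h4 : ‖y‖ / max r ‖y‖ ≤ 1 := (div_le_one hy).2 (le_max_right _ _)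
    calc r / max r ‖x‖ * (|max r ‖y‖ - max r ‖x‖| / max r ‖y‖) * ‖y‖
        = (r / max r ‖x‖) * (|max r ‖y‖ - max r ‖x‖| * (‖y‖ / max r ‖y‖)) := by ring
      _ ≤ 1 * (‖x - y‖ * 1) := by gcongr
      _ = _ := by ring
  rw [e]
  linarith [norm_add_le ((r / max r ‖x‖) • (x - y)) ((r / max r ‖x‖ - r / max r ‖y‖) • y)]

end radialRetraction

/-! ### The power nonlinearity on `ℂ` -/

/-- The function `z ↦ |z|^p z`. -/
noncomputable def powNL (p : ℝ) (z : ℂ) : ℂ := ((‖z‖ ^ p : ℝ) : ℂ) * z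

theorem norm_powNL (p : ℝ) (z : ℂ) : ‖powNL p z‖ = ‖z‖ ^ p * ‖z‖ := by
  rw [powNL, norm_mul, Complex.norm_real, Real.norm_of_nonneg (by positivity)]

/-- Bernoulli's inequality with exponent `p + 1` at the ratio `s / t`. It covers `0 ≤ p < 1`, where
the derivative of `t ^ p` is unbounded near 0. -/
theorem rpow_sub_rpow_mul_le {p s t : ℝ} (hp : 0 ≤ p) (hs : 0 ≤ s) (hst : s ≤ t) :
    (t ^ p - s ^ p) * t ≤ (p + 1) * t ^ p * (t - s) := by
  rcases hs.eq_or_lt with rfl | hs'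
  · have h1 : 0 ≤ t ^ p := by positivity
    have h2 : 0 ≤ (0 : ℝ) ^ p := by positivity
    have h3 : 0 ≤ p * t ^ p * t := by positivity
    nlinarith
  have ht : 0 < t := hs'.trans_le hst
  have h := one_add_mul_self_le_rpow_one_add (s := s / t - 1)
    (by have : 0 ≤ s / t := by positivity
        linarith) (p := p + 1) (by linarith)
  rw [add_sub_cancel, Real.div_rpow hs ht.le, Real.rpow_add_one hs'.ne', Real.rpow_add_one ht.ne',
    le_div_iff₀ (by positivity)] at h
  have e : (1 + (p + 1) * (s / t - 1)) * (t ^ p * t)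
      = t ^ p * t - (p + 1) * t ^ p * (t - s) := by
    field_simp
    ring
  rw [e] at h
  have h5 : s ^ p * s ≤ s ^ p * t := by gcongr
  linarith

theorem powNL_sub_le {p R : ℝ} (hp : 0 ≤ p) {z w : ℂ} (hz : ‖z‖ ≤ R) (hw : ‖w‖ ≤ R) :
    ‖powNL p z - powNL p w‖ ≤ (p + 2) * R ^ p * ‖z - w‖ := by
  wlog h : ‖w‖ ≤ ‖z‖ generalizing z w
  · rw [norm_sub_rev, norm_sub_rev z w]
    exact this hw hz (le_of_not_ge h)
  have e : powNL p z - powNL p w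
      = ((‖w‖ ^ p : ℝ) : ℂ) * (z - w) + ((‖z‖ ^ p - ‖w‖ ^ p : ℝ) : ℂ) * z := by
    simp only [powNL]
    push_cast
    ring
  have hwz : ‖w‖ ^ p ≤ ‖z‖ ^ p := Real.rpow_le_rpow (norm_nonneg _) h hp
  have hzR : ‖z‖ ^ p ≤ R ^ p := Real.rpow_le_rpow (norm_nonneg _) hz hp
  have hd : ‖z‖ - ‖w‖ ≤ ‖z - w‖ := norm_sub_norm_le z w
  calc ‖powNL p z - powNL p w‖
      ≤ ‖w‖ ^ p * ‖z - w‖ + (‖z‖ ^ p - ‖w‖ ^ p) * ‖z‖ := by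
        rw [e]
        refine (norm_add_le _ _).trans ?_
        rw [norm_mul, norm_mul, Complex.norm_real, Complex.norm_real,
          Real.norm_of_nonneg (by positivity), Real.norm_of_nonneg (by linarith)]
    _ ≤ ‖w‖ ^ p * ‖z - w‖ + (p + 1) * ‖z‖ ^ p * (‖z‖ - ‖w‖) := by
        exact add_le_add le_rfl (rpow_sub_rpow_mul_le hp (norm_nonneg _) h)
    _ ≤ R ^ p * ‖z - w‖ + (p + 1) * R ^ p * ‖z - w‖ := by
        have h0 : 0 ≤ ‖z‖ ^ p := by positivity
        have h1 := sub_nonneg.2 h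
        gcongr
        · nlinarith
    _ = _ := by ring

theorem inner_powNL (p : ℝ) (z w : ℂ) :
    inner ℝ (powNL p z) w = ‖z‖ ^ p * inner ℝ z w := by
  rw [powNL, ← Complex.real_smul, real_inner_smul_left]

/-- `(2/(p+2)) |z|^(p+2)` has the gradient `2 |z|^p z`, with quadratic error. -/
theorem abs_norm_rpow_add_sub_le {p R : ℝ} (hp : 0 ≤ p) {z w : ℂ} (hz : ‖z‖ ≤ R) (hw : ‖w‖ ≤ R) :
    |‖z + w‖ ^ (p + 2) - ‖z‖ ^ (p + 2) - (p + 2) * inner ℝ (powNL p z) w|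
      ≤ (p + 2) * ((p + 2) * (2 * R) ^ p) * ‖w‖ ^ 2 := by
  -- The linear term is subtracted along the segment from `z` to `z + w`, so the derivative of `g`
  -- is a difference of two values of `powNL` and `powNL_sub_le` bounds it.
  set g : ℝ → ℝ := fun s => ‖z + s • w‖ ^ (p + 2) - s * ((p + 2) * inner ℝ (powNL p z) w) with hg
  have hd : ∀ s : ℝ, HasDerivAt g
      ((p + 2) * (inner ℝ (powNL p (z + s • w) - powNL p z) w)) s := by
    intro s
    have h1 : HasDerivAt (fun s : ℝ => z + s • w) w s := by
      simpa using ((hasDerivAt_id s).smul_const w).const_add z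
    have h2 := (hasFDerivAt_norm_rpow (z + s • w) (p := p + 2) (by linarith)).comp_hasDerivAt s h1
    have h3 := h2.sub ((hasDerivAt_id s).mul_const ((p + 2) * inner ℝ (powNL p z) w))
    refine h3.congr_deriv ?_
    simp only [FunLike.coe_smul, Pi.smul_apply, innerSL_apply_apply, smul_eq_mul, inner_sub_left,
      inner_powNL]
    rw [add_sub_cancel_right]
    ring
  have hb : ∀ s ∈ Set.Ico (0 : ℝ) 1, ‖(p + 2) * (inner ℝ (powNL p (z + s • w) - powNL p z) w)‖
      ≤ (p + 2) * ((p + 2) * (2 * R) ^ p) * ‖w‖ ^ 2 := by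
    intro s hs
    have hsw : ‖s • w‖ ≤ ‖w‖ := by
      rw [norm_smul, Real.norm_of_nonneg hs.1]
      exact mul_le_of_le_one_left (norm_nonneg _) hs.2.le
    have h4 : ‖z + s • w‖ ≤ 2 * R := by linarith [norm_add_le z (s • w)]
    have hR : 0 ≤ R := (norm_nonneg _).trans hz
    have h5 := powNL_sub_le hp h4 (hz.trans (by linarith) : ‖z‖ ≤ 2 * R)
    rw [add_sub_cancel_left] at h5
    rw [norm_mul, Real.norm_of_nonneg (by linarith : 0 ≤ p + 2), mul_assoc (p + 2)]
    gcongr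
    refine (norm_inner_le_norm _ _).trans ?_
    calc _ ≤ ((p + 2) * (2 * R) ^ p * ‖s • w‖) * ‖w‖ := by gcongr
      _ ≤ ((p + 2) * (2 * R) ^ p * ‖w‖) * ‖w‖ := by gcongr
      _ = _ := by ring
  have := norm_image_sub_le_of_norm_deriv_le_segment_01' (f := g)
    (fun s _ => (hd s).hasDerivWithinAt) hb
  rw [Real.norm_eq_abs] at this
  refine le_of_eq_of_le ?_ this
  simp only [hg]
  congr 1
  simp
  ring

/-! ### Taylor estimates for real powers -/

/-- The mean value inequality on the interval of radius `|q|`; it raises the order of a Taylor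
estimate by one. -/
theorem abs_sub_le_of_abs_deriv_le_pow {g g' : ℝ → ℝ} {C r : ℝ} {k : ℕ} (hC : 0 ≤ C)
    (hd : ∀ s, |s| ≤ r → HasDerivAt g (g' s) s) (hb : ∀ s, |s| ≤ r → |g' s| ≤ C * |s| ^ k)
    {q : ℝ} (hq : |q| ≤ r) : |g q - g 0| ≤ C * |q| ^ (k + 1) := by
  have hs : ∀ s ∈ Metric.closedBall (0 : ℝ) |q|, |s| ≤ |q| := fun s hs => by simpa using hs
  have := (convex_closedBall (0 : ℝ) |q|).norm_image_sub_le_of_norm_hasDerivWithin_le (f := g)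
    (f' := g') (C := C * |q| ^ k) (x := 0) (y := q)
    (fun s h => (hd s ((hs s h).trans hq)).hasDerivWithinAt)
    (fun s h => (hb s ((hs s h).trans hq)).trans (by
      have := hs s h
      gcongr)) (by simp) (by simp)
  rw [Real.norm_eq_abs, sub_zero, Real.norm_eq_abs] at this
  rw [pow_succ, ← mul_assoc]
  exact this

/-- The remainder has derivative `σ ((ρ + s) ^ (σ - 1) - ρ ^ (σ - 1))`, which is O(s) because the
power is differentiable at `ρ > 0`. One integration gives the quadratic bound. -/
theorem exists_taylor_rpow_bound (σ : ℝ) {ρ : ℝ} (hρ : 0 < ρ) :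
    ∃ C ≥ 0, ∃ r > 0, (∀ q, |q| ≤ r →
      |(ρ + q) ^ σ - ρ ^ σ - σ * ρ ^ (σ - 1) * q| ≤ C * |q| ^ 2) ∧
      ∀ q, |q| ≤ r → 0 < ρ + q := by
  have h1 : HasDerivAt (fun s : ℝ => (ρ + s) ^ (σ - 1)) ((σ - 1) * (ρ + 0) ^ (σ - 1 - 1)) 0 := by
    have := ((hasDerivAt_id (0 : ℝ)).const_add ρ).rpow_const (p := σ - 1)
      (Or.inl (by simpa using hρ.ne'))
    refine this.congr_deriv ?_
    simp
  obtain ⟨c, hc⟩ := h1.isBigO_sub.bound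
  obtain ⟨r, hr, hcr⟩ := Metric.eventually_nhds_iff.1 hc
  have hpos : ∀ q, |q| ≤ min (r / 2) (ρ / 2) → 0 < ρ + q := by
    intro q hq
    have := (abs_le.1 (hq.trans (min_le_right _ _))).1
    linarith
  refine ⟨|σ| * |c|, by positivity, min (r / 2) (ρ / 2), by positivity, fun q hq => ?_, hpos⟩
  have := abs_sub_le_of_abs_deriv_le_pow (k := 1)
    (g := fun q => (ρ + q) ^ σ - ρ ^ σ - σ * ρ ^ (σ - 1) * q)
    (g' := fun s => σ * ((ρ + s) ^ (σ - 1) - ρ ^ (σ - 1))) (C := |σ| * |c|)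
    (by positivity) ?_ ?_ hq
  · simpa using this
  · intro s hs
    have h2 := ((hasDerivAt_id s).const_add ρ).rpow_const (p := σ) (Or.inl (hpos s hs).ne')
    refine ((h2.sub_const _).sub ((hasDerivAt_id s).const_mul (σ * ρ ^ (σ - 1)))).congr_deriv ?_
    simp
    ring
  · intro s hs
    have h3 := @hcr s (by
      have := hs.trans (min_le_left _ _)
      rw [Real.dist_eq, sub_zero]
      linarith)
    simp only [sub_zero, add_zero, Real.norm_eq_abs] at h3
    rw [abs_mul, mul_assoc, pow_one]
    refine mul_le_mul_of_nonneg_left (h3.trans ?_) (abs_nonneg _)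
    exact mul_le_mul_of_nonneg_right (le_abs_self c) (abs_nonneg s)

theorem exists_taylor_rpow_bound_cubic {σ : ℝ} (hσ : 0 < σ) {ρ : ℝ} (hρ : 0 < ρ) :
    ∃ C ≥ 0, ∃ r > 0, ∀ q, |q| ≤ r →
      |(ρ + q) ^ (σ + 1) - ρ ^ (σ + 1) - (σ + 1) * ρ ^ σ * q
        - (σ + 1) * σ * ρ ^ (σ - 1) * q ^ 2 / 2| ≤ C * |q| ^ 3 := by
  obtain ⟨C, hC, r, hr, h, hpos⟩ := exists_taylor_rpow_bound σ hρ
  refine ⟨(σ + 1) * C, by positivity, r, hr, fun q hq => ?_⟩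
  have := abs_sub_le_of_abs_deriv_le_pow (k := 2)
    (g := fun q => (ρ + q) ^ (σ + 1) - ρ ^ (σ + 1) - (σ + 1) * ρ ^ σ * q
        - (σ + 1) * σ * ρ ^ (σ - 1) * q ^ 2 / 2)
    (g' := fun s => (σ + 1) * ((ρ + s) ^ σ - ρ ^ σ - σ * ρ ^ (σ - 1) * s)) (C := (σ + 1) * C)
    (by positivity) ?_ ?_ hq
  · simpa using this
  · intro s hs
    have h2 := ((hasDerivAt_id s).const_add ρ).rpow_const (p := σ + 1) (Or.inl (hpos s hs).ne')
    refine (((h2.sub_const _).sub ((hasDerivAt_id s).const_mul ((σ + 1) * ρ ^ σ))).sub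
      ((((hasDerivAt_id s).pow 2).const_mul ((σ + 1) * σ * ρ ^ (σ - 1))).div_const 2)).congr_deriv ?_
    simp
    ring
  · intro s hs
    rw [abs_mul, abs_of_pos (by linarith : 0 < σ + 1)]
    exact (mul_le_mul_of_nonneg_left (h s hs) (by linarith : (0 : ℝ) ≤ σ + 1)).trans_eq (by ring)

/-- The linearization of `z ↦ |z|^(2σ) z` at a nonzero real number. -/
theorem exists_powNL_taylor_bound (σ : ℝ) {ρ : ℝ} (hρ : 0 < ρ) :
    ∃ C ≥ 0, ∃ r > 0, ∀ a : ℝ, a ^ 2 = ρ → ∀ w : ℂ, ‖w‖ ≤ r →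
      ‖powNL (2 * σ) (a + w) - powNL (2 * σ) a
        - ((ρ ^ σ : ℝ) : ℂ) * (w + ((2 * σ * w.re : ℝ) : ℂ))‖ ≤ C * ‖w‖ ^ 2 := by
  obtain ⟨C, hC, r, hr, h, -⟩ := exists_taylor_rpow_bound σ hρ
  set b := √ρ with hb
  have hb0 : 0 < b := Real.sqrt_pos.2 hρ
  set D := |σ * ρ ^ (σ - 1)| with hD
  refine ⟨C * (2 * b + 1) ^ 2 * (b + 1) + D * (b + (2 * b + 1)), by positivity,
    min 1 (r / (2 * b + 1)), by positivity, fun a ha w hw => ?_⟩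
  have hw1 : ‖w‖ ≤ 1 := hw.trans (min_le_left _ _)
  have hw2 : (2 * b + 1) * ‖w‖ ≤ r := by
    have := hw.trans (min_le_right _ _)
    rwa [le_div_iff₀ (by positivity), mul_comm] at this
  have hab : |a| = b := by rw [hb, ← ha, Real.sqrt_sq_eq_abs]
  -- `q` is the increment |a + w|² − ρ, so powers of |a + w| become powers of `ρ + q`.
  set q : ℝ := 2 * a * w.re + ‖w‖ ^ 2 with hq
  have hqw : |q| ≤ (2 * b + 1) * ‖w‖ := by
    have h1 : |2 * a * w.re| ≤ 2 * b * ‖w‖ := by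
      rw [abs_mul, abs_mul, hab, abs_two]
      exact mul_le_mul_of_nonneg_left (Complex.abs_re_le_norm w) (by positivity)
    have h2 : |‖w‖ ^ 2| ≤ ‖w‖ := by
      rw [abs_of_nonneg (by positivity)]
      nlinarith [norm_nonneg w]
    calc |q| ≤ |2 * a * w.re| + |‖w‖ ^ 2| := abs_add_le _ _
      _ ≤ _ := by linarith
  have hn : ‖(a : ℂ) + w‖ ^ 2 = ρ + q := by
    rw [← ha, hq, Complex.sq_norm, Complex.sq_norm, Complex.normSq_apply, Complex.normSq_apply]
    simp
    ring
  have hpow : ‖(a : ℂ) + w‖ ^ (2 * σ) = (ρ + q) ^ σ := by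
    rw [Real.rpow_mul (norm_nonneg _), Real.rpow_two, hn]
  have hpow0 : ‖(a : ℂ)‖ ^ (2 * σ) = ρ ^ σ := by
    rw [Real.rpow_mul (norm_nonneg _), Real.rpow_two, Complex.norm_real, Real.norm_eq_abs, sq_abs,
      ha]
  have hκ : ρ ^ σ = ρ ^ (σ - 1) * a ^ 2 := by
    rw [ha, Real.rpow_sub_one hρ.ne', div_mul_cancel₀ _ hρ.ne']
  have e : powNL (2 * σ) (a + w) - powNL (2 * σ) a
        - ((ρ ^ σ : ℝ) : ℂ) * (w + ((2 * σ * w.re : ℝ) : ℂ))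
      = (((ρ + q) ^ σ - ρ ^ σ - σ * ρ ^ (σ - 1) * q : ℝ) : ℂ) * (a + w)
        + ((σ * ρ ^ (σ - 1) : ℝ) : ℂ) * ((‖w‖ ^ 2 : ℝ) * a + (q : ℂ) * w) := by
    have hκ' : ((2 * σ * ρ ^ σ * w.re : ℝ) : ℂ) = ((2 * σ * (ρ ^ (σ - 1) * a ^ 2) * w.re : ℝ) : ℂ) := by
      rw [hκ]
    rw [powNL, powNL, hpow, hpow0]
    push_cast at hκ' ⊢
    have hq' : (q : ℂ) = 2 * a * w.re + (‖w‖ : ℂ) ^ 2 := by rw [hq]; push_cast; ring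
    rw [hq'] at *
    linear_combination -hκ'
  have hqr := h q (hqw.trans hw2)
  have hq2 : |q| ^ 2 ≤ ((2 * b + 1) * ‖w‖) ^ 2 := by gcongr
  have haw : ‖(a : ℂ) + w‖ ≤ b + 1 := by
    refine (norm_add_le _ _).trans ?_
    rw [Complex.norm_real, Real.norm_eq_abs, hab]
    linarith
  rw [e]
  refine (norm_add_le _ _).trans ?_
  rw [norm_mul, norm_mul, Complex.norm_real, Complex.norm_real, Real.norm_eq_abs, Real.norm_eq_abs,
    ← hD]
  have h6 : ‖(((‖w‖ ^ 2 : ℝ) : ℂ) * a + (q : ℂ) * w)‖ ≤ (b + (2 * b + 1)) * ‖w‖ ^ 2 := by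
    refine (norm_add_le _ _).trans ?_
    rw [norm_mul, norm_mul, Complex.norm_real, Complex.norm_real, Complex.norm_real,
      Real.norm_eq_abs, Real.norm_eq_abs, Real.norm_eq_abs, hab, abs_of_nonneg (by positivity)]
    nlinarith [norm_nonneg w, mul_le_mul_of_nonneg_right hqw (norm_nonneg w)]
  calc _ ≤ (C * ((2 * b + 1) * ‖w‖) ^ 2) * (b + 1) + D * ((b + (2 * b + 1)) * ‖w‖ ^ 2) := by
        gcongr
        exact hqr.trans (by gcongr)
    _ = _ := by ring

/-! ### A Chetaev instability criterion -/

/-- Finitely many functions, each of which is decreasing where it vanishes as long as none of them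
is positive, stay nonpositive. -/
theorem forall_nonpos_of_barrier {ι : Type*} [Finite ι] {f : ι → ℝ → ℝ}
    (hc : ∀ i, ContinuousOn (f i) (Set.Ici 0)) (h0 : ∀ i, f i 0 ≤ 0)
    (hd : ∀ t, 0 ≤ t → (∀ j, f j t ≤ 0) → ∀ i, f i t = 0 → ∃ d < 0, HasDerivAt (f i) d t)
    {t : ℝ} (ht : 0 ≤ t) (i : ι) : f i t ≤ 0 := by
  set s : Set ℝ := {t | ∀ i, f i t ≤ 0} with hs
  have hcl : IsClosed (s ∩ Set.Icc 0 (t + 1)) := by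
    have h1 : ContinuousOn (fun t i => f i t) (Set.Icc 0 (t + 1)) :=
      continuousOn_pi.2 fun i => (hc i).mono fun _ hx => hx.1
    have h2 := h1.preimage_isClosed_of_isClosed isClosed_Icc (isClosed_Iic (a := (0 : ι → ℝ)))
    rw [Set.inter_comm]
    exact h2
  -- Continuous induction: the good set is closed, and to the right of a good time every function
  -- stays nonpositive, by continuity if it is negative there and by its negative derivative if it
  -- vanishes.
  refine hcl.Icc_subset_of_forall_mem_nhdsWithin h0 ?_
    (⟨ht, by linarith⟩ : t ∈ Set.Icc 0 (t + 1)) i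
  rintro x ⟨hx, hx0, -⟩
  rw [hs, Set.ofPred_forall, Filter.iInter_mem]
  intro i
  rcases (hx i).lt_or_eq with h | h
  · have hci : ContinuousWithinAt (f i) (Set.Ioi x) x :=
      ((hc i) x hx0).mono fun z hz => hx0.trans (Set.mem_Ioi.1 hz).le
    exact (hci.eventually (gt_mem_nhds h)).mono fun _ hz => le_of_lt hz
  · obtain ⟨d, hd0, hd⟩ := hd x hx0 hx i h
    have h1 := (hasDerivAt_iff_tendsto_slope.1 hd).mono_left
      (nhdsWithin_mono x fun z (hz : x < z) => hz.ne')
    filter_upwards [h1.eventually (gt_mem_nhds hd0), self_mem_nhdsWithin] with z hz hxz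
    rw [slope_def_field, h, sub_zero] at hz
    have hxz' : 0 < z - x := sub_pos.2 hxz
    by_contra hcon
    exact absurd hz (not_lt.2 (div_nonneg (not_le.1 hcon).le hxz'.le))

/-- The scalar differential inequalities behind `exists_escape_radius`. -/
theorem exists_escape_level {C₁ q c : ℝ} (hC₁0 : 0 < C₁) (hq : 0 < q) (hc : 0 < c) :
    ∃ β > 0, ∀ I W h Y e₁ e₂ e₃ : ℝ → ℝ,
      (∀ t, 0 ≤ t → HasDerivAt I (2 * W t + e₁ t) t) →
      (∀ t, 0 ≤ t → HasDerivAt W (2 * Y t - h t + e₂ t) t) →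
      (∀ t, 0 ≤ t → HasDerivAt h (e₃ t) t) →
      (∀ t, W t ^ 2 ≤ I t * Y t) →
      (∀ t, 0 ≤ t → 0 < I t → h t ≤ I t → |e₁ t| ≤ C₁ * (I t * I t ^ q) ∧
        |e₂ t| ≤ C₁ * (I t * I t ^ q) ∧ |e₃ t| ≤ C₁ * (I t * I t ^ q)) →
      0 < I 0 → h 0 ≤ 0 → c * I 0 ≤ W 0 → ∃ t, 0 ≤ t ∧ 0 < I t ∧ β < I t ^ q := by
  -- Inside the barriers `I' ≥ c I`, so `I ^ (q + 1)` has derivative at least `c I · I ^ q`. As `C₂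
  -- c > C₁`, the function `C₂ I ^ (q + 1)` outgrows `h`.
  set C₂ : ℝ := C₁ / c + 1 with hC₂
  have hC₂0 : 0 < C₂ := by positivity
  have hC₂c : C₁ < C₂ * c := by rw [hC₂, add_mul, div_mul_cancel₀ _ hc.ne']; linarith
  -- `C₃ q c` pays for `h`, for `e₂` and for `r e₁` with `r ≤ c` in the derivative of the third
  -- barrier, with one unit to spare for strictness.
  set C₃ : ℝ := (C₂ + C₁ + c * C₁ + 1) / (q * c) with hC₃
  have hC₃0 : 0 < C₃ := by positivity
  have hC₃c : C₃ * q * c = C₂ + C₁ + c * C₁ + 1 := by rw [hC₃]; field_simp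
  -- While `I ^ q ≤ β`, the three bounds give respectively `h ≤ I`, `W ≥ (3/4) c I`, and an error in
  -- `I'` of at most `(c/2) I`; hence `I' ≥ c I`.
  set β : ℝ := min (1 / C₂) (min (c / (4 * C₃)) (c / (2 * C₁))) with hβ
  have hβ0 : 0 < β := by positivity
  have hβ1 : C₂ * β ≤ 1 := by
    have : β ≤ 1 / C₂ := min_le_left _ _
    rwa [le_div_iff₀ hC₂0, mul_comm] at this
  have hβ2 : C₃ * β ≤ c / 4 := by
    have : β ≤ c / (4 * C₃) := (min_le_right _ _).trans (min_le_left _ _)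
    rw [le_div_iff₀ (by positivity)] at this
    linarith
  have hβ3 : C₁ * β ≤ c / 2 := by
    have : β ≤ c / (2 * C₁) := (min_le_right _ _).trans (min_le_right _ _)
    rw [le_div_iff₀ (by positivity)] at this
    linarith
  refine ⟨β, hβ0, fun I W h Y e₁ e₂ e₃ hI' hW' hh' hcs herr hI0 hini1 hini2 => ?_⟩
  by_contra hcon
  push Not at hcon
  have hIβ : ∀ t, 0 ≤ t → 0 < I t → I t ^ q ≤ β := hcon
  -- Three barriers to be kept nonpositive together: linear growth of `I`, smallness of `h`, and the
  -- cone `W ≥ c I` weakened by a higher order term.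
  set f : Fin 3 → ℝ → ℝ := ![fun t => I 0 * (1 + c / 2 * t) - I t,
    fun t => h t - C₂ * I t ^ (q + 1),
    fun t => c * I t - C₃ * I t ^ (q + 1) - W t] with hf
  have hIc : ContinuousOn I (Set.Ici 0) := fun t ht => (hI' t ht).continuousAt.continuousWithinAt
  have hWc : ContinuousOn W (Set.Ici 0) := fun t ht => (hW' t ht).continuousAt.continuousWithinAt
  have hhc : ContinuousOn h (Set.Ici 0) := fun t ht => (hh' t ht).continuousAt.continuousWithinAt
  have hIqc : ContinuousOn (fun t => I t ^ (q + 1)) (Set.Ici 0) :=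
    hIc.rpow_const fun t _ => Or.inr (by linarith)
  have hfle : ∀ t, 0 ≤ t → ∀ i, f i t ≤ 0 := by
    refine fun t ht i => forall_nonpos_of_barrier ?_ ?_ ?_ ht i
    · intro i
      fin_cases i
      · exact ((by fun_prop : Continuous fun t : ℝ => I 0 * (1 + c / 2 * t)).continuousOn).sub hIc
      · exact hhc.sub (hIqc.const_smul C₂)
      · exact ((hIc.const_smul c).sub (hIqc.const_smul C₃)).sub hWc
    · intro i
      have h1 : 0 ≤ I 0 ^ (q + 1) := by positivity
      fin_cases i
      · simp [hf]
      · simp only [hf]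
        simp only [Fin.mk_one, Matrix.cons_val_one, Matrix.cons_val_zero]
        nlinarith
      · simp only [hf]
        simp only [Fin.reduceFinMk, Matrix.cons_val]
        nlinarith
    · intro t ht hle i hi
      have hle0 : I 0 * (1 + c / 2 * t) - I t ≤ 0 := hle 0
      have hle1 : h t - C₂ * I t ^ (q + 1) ≤ 0 := hle 1
      have hle2 : c * I t - C₃ * I t ^ (q + 1) - W t ≤ 0 := hle 2
      have hIge : I 0 ≤ I t := by
        have : 0 ≤ I 0 * (c / 2 * t) := by positivity
        linarith
      have hIt : 0 < I t := hI0.trans_le hIge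
      set J : ℝ := I t ^ q with hJ
      have hJ0 : 0 < J := by positivity
      have hJβ : J ≤ β := hIβ t ht hIt
      have hIJ : I t ^ (q + 1) = I t * J := by rw [Real.rpow_add_one hIt.ne', mul_comm]
      rw [hIJ] at hle1 hle2
      have hIJ0 : 0 < I t * J := by positivity
      have hhI : h t ≤ I t := by
        have h1 : C₂ * J ≤ 1 := (mul_le_mul_of_nonneg_left hJβ hC₂0.le).trans hβ1
        have h2 := mul_le_mul_of_nonneg_left h1 hIt.le
        linarith
      obtain ⟨he1, he2, he3⟩ := herr t ht hIt hhI
      have hWge : 3 / 4 * c * I t ≤ W t := by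
        have h1 : C₃ * J ≤ c / 4 := (mul_le_mul_of_nonneg_left hJβ hC₃0.le).trans hβ2
        have h2 := mul_le_mul_of_nonneg_left h1 hIt.le
        linarith
      have hIder : c * I t ≤ 2 * W t + e₁ t := by
        have h1 : C₁ * J ≤ c / 2 := (mul_le_mul_of_nonneg_left hJβ hC₁0.le).trans hβ3
        have h2 := mul_le_mul_of_nonneg_left h1 hIt.le
        have h3 := (abs_le.1 he1).1
        linarith
      have hIq' : HasDerivAt (fun t => I t ^ (q + 1)) ((2 * W t + e₁ t) * (q + 1) * J) t := by
        have := (hI' t ht).rpow_const (p := q + 1) (Or.inl hIt.ne')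
        rwa [add_sub_cancel_right] at this
      fin_cases i
      · refine ⟨I 0 * (c / 2) - (2 * W t + e₁ t), ?_, ?_⟩
        · have : I 0 * (c / 2) ≤ I t * (c / 2) := by gcongr
          have : 0 < I t * (c / 2) := by positivity
          linarith
        · refine HasDerivAt.sub ?_ (hI' t ht)
          have := (((hasDerivAt_id t).const_mul (c / 2)).const_add 1).const_mul (I 0)
          simpa using this
      · refine ⟨e₃ t - C₂ * ((2 * W t + e₁ t) * (q + 1) * J), ?_, (hh' t ht).sub (hIq'.const_mul C₂)⟩
        have h3 := (abs_le.1 he3).2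
        have h4 : c * I t * 1 * J ≤ (2 * W t + e₁ t) * (q + 1) * J := by
          gcongr
          · exact (by positivity : 0 ≤ c * I t).trans hIder
          · linarith
        have h5 := mul_le_mul_of_nonneg_left h4 hC₂0.le
        have h6 := mul_lt_mul_of_pos_right hC₂c hIJ0
        linarith
      · refine ⟨c * (2 * W t + e₁ t) - C₃ * ((2 * W t + e₁ t) * (q + 1) * J)
          - (2 * Y t - h t + e₂ t), ?_,
          (((hI' t ht).const_mul c).sub (hIq'.const_mul C₃)).sub (hW' t ht)⟩
        have hWeq : c * I t - C₃ * I t ^ (q + 1) - W t = 0 := hi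
        rw [hIJ] at hWeq
        set r : ℝ := c - C₃ * J with hr
        have hWr : W t = r * I t := by rw [hr]; linarith
        have hr0 : 0 ≤ r := by
          have h1 : C₃ * J ≤ c / 4 := (mul_le_mul_of_nonneg_left hJβ hC₃0.le).trans hβ2
          rw [hr]; linarith
        have hrc : r ≤ c := by
          have : 0 < C₃ * J := by positivity
          rw [hr]; linarith
        have hY : r * r * I t ≤ Y t := by
          have := hcs t
          rw [hWr] at this
          have h2 : I t * (r * r * I t) ≤ I t * Y t := by linarith
          exact le_of_mul_le_mul_left h2 hIt
        -- On the third barrier `W = r I`, and Cauchy–Schwarz gives `Y ≥ r² I`, so the leading terms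
        -- `2 r² I - 2 Y` have the right sign. The gain `C₃ q J I'` beats the remaining errors.
        have h4 : C₃ * q * J * (c * I t) ≤ C₃ * q * J * (2 * W t + e₁ t) := by gcongr
        have h5 : r * e₁ t ≤ c * (C₁ * (I t * J)) :=
          (mul_le_mul_of_nonneg_left (abs_le.1 he1).2 hr0).trans
            (mul_le_mul_of_nonneg_right hrc (by positivity))
        have h6 := (abs_le.1 he2).1
        have h7 : C₃ * q * J * (c * I t) = (C₂ + C₁ + c * C₁ + 1) * (I t * J) := by
          rw [← hC₃c]; ring
        have e : c * (2 * W t + e₁ t) - C₃ * ((2 * W t + e₁ t) * (q + 1) * J)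
            - (2 * Y t - h t + e₂ t)
            = r * e₁ t + 2 * (r * r * I t) - C₃ * q * J * (2 * W t + e₁ t)
              - 2 * Y t + h t - e₂ t := by
          rw [hWr, hr]; ring
        rw [e]
        linarith
  -- By this time the linear lower bound has pushed `I` beyond `β ^ (1 / q)`.
  set t₁ : ℝ := β ^ (1 / q) / (I 0 * (c / 2)) with ht₁
  have ht₁0 : 0 ≤ t₁ := by positivity
  have h1 : I 0 * (1 + c / 2 * t₁) - I t₁ ≤ 0 := hfle t₁ ht₁0 0
  have h3 : I 0 * (c / 2) * t₁ = β ^ (1 / q) := by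
    rw [ht₁, mul_div_cancel₀ _ (by positivity)]
  have h4 : β ^ (1 / q) < I t₁ := by linarith
  have h5 := Real.rpow_lt_rpow (by positivity) h4 hq
  rw [← Real.rpow_mul hβ0.le, one_div_mul_cancel hq.ne', Real.rpow_one] at h5
  exact absurd (hIβ t₁ ht₁0 ((by positivity : 0 < β ^ (1 / q)).trans h4)) (not_le.2 h5)

section Chetaev

variable {X : Type*} [NormedAddCommGroup X] [InnerProductSpace ℝ X]

/-- Small solutions of `u' = M y + r₁`, `y' = L u + r₂`, with `M` positive definite, that start in
the cone `⟪y, M y⟫ ≤ ⟪u, L u⟫`, `⟪u, y⟫ ≥ c ⟪u, M⁻¹ u⟫`, leave a fixed ball, if the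
remainders are superlinearly small. -/
theorem exists_escape_radius {M N L : X →L[ℝ] X}
    (hM : ∀ x y, inner ℝ (M x) y = inner ℝ x (M y)) (hN : ∀ x y, inner ℝ (N x) y = inner ℝ x (N y))
    (hL : ∀ x y, inner ℝ (L x) y = inner ℝ x (L y)) (hMN : ∀ x, M (N x) = x)
    {m n : ℝ} (hm : 0 < m) (hn : 0 < n) (hMpos : ∀ x, m * ‖x‖ ^ 2 ≤ inner ℝ x (M x))
    (hNpos : ∀ x, n * ‖x‖ ^ 2 ≤ inner ℝ x (N x)) {C q c : ℝ} (hC : 0 ≤ C) (hq : 0 < q)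
    (hc : 0 < c) :
    ∃ b > 0, ∀ u y r₁ r₂ : ℝ → X,
      (∀ t, 0 ≤ t → HasDerivAt u (M (y t) + r₁ t) t) →
      (∀ t, 0 ≤ t → HasDerivAt y (L (u t) + r₂ t) t) →
      (∀ t, 0 ≤ t → ‖u t‖ ^ 2 + ‖y t‖ ^ 2 ≤ b →
        ‖r₁ t‖ ≤ C * (‖u t‖ ^ 2 + ‖y t‖ ^ 2) ^ (q + 1 / 2) ∧
        ‖r₂ t‖ ≤ C * (‖u t‖ ^ 2 + ‖y t‖ ^ 2) ^ (q + 1 / 2)) →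
      u 0 ≠ 0 → inner ℝ (y 0) (M (y 0)) ≤ inner ℝ (u 0) (L (u 0)) →
      c * inner ℝ (u 0) (N (u 0)) ≤ inner ℝ (u 0) (y 0) →
      ∃ t, 0 ≤ t ∧ b < ‖u t‖ ^ 2 + ‖y t‖ ^ 2 := by
  -- When `h ≤ I`, the norm of `y` is controlled through `m ‖y‖² ≤ ⟪y, M y⟫ = h + ⟪u, L u⟫`, so `I`
  -- alone bounds `‖u‖² + ‖y‖²` with this constant.
  set C₀ : ℝ := 1 / n + (1 + ‖L‖ / n) / m with hC₀
  have hC₀0 : 0 < C₀ := by positivity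
  set C₁ : ℝ := 2 * C * (‖N‖ + ‖M‖ + ‖L‖ + 1) * C₀ ^ (q + 1) + 1 with hC₁
  have hC₁0 : 0 < C₁ := by positivity
  obtain ⟨β, hβ0, H⟩ := exists_escape_level hC₁0 hq hc
  -- Chosen so that `‖u‖² + ‖y‖² ≤ b` implies `I ^ q ≤ β`.
  set b : ℝ := β ^ (1 / q) / (‖N‖ + 1) with hb
  have hb0 : 0 < b := by positivity
  have hbβ : ((‖N‖ + 1) * b) ^ q = β := by
    rw [hb, mul_div_cancel₀ _ (by positivity), ← Real.rpow_mul hβ0.le, one_div_mul_cancel hq.ne',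
      Real.rpow_one]
  refine ⟨b, hb0, fun u y r₁ r₂ hu hy hr hu0 hini1 hini2 => ?_⟩
  by_contra hcon
  push Not at hcon
  -- Without remainders, with Y = ⟪y, M y⟫, `I' = 2W`, `W' = 2Y - h` and `h` is conserved. If `h ≤
  -- 0`, then `W² ≤ I Y` makes `W / I` nondecreasing, so `I` grows exponentially; the remainders
  -- perturb this.
  set I : ℝ → ℝ := fun t => inner ℝ (u t) (N (u t)) with hI
  set W : ℝ → ℝ := fun t => inner ℝ (u t) (y t) with hW
  set h : ℝ → ℝ := fun t => inner ℝ (y t) (M (y t)) - inner ℝ (u t) (L (u t)) with hh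
  set S : ℝ → ℝ := fun t => ‖u t‖ ^ 2 + ‖y t‖ ^ 2 with hS
  have hI' : ∀ t, 0 ≤ t → HasDerivAt I (2 * W t + 2 * inner ℝ (N (u t)) (r₁ t)) t := by
    intro t ht
    have h1 := (hu t ht).inner ℝ (N.hasFDerivAt.comp_hasDerivAt t (hu t ht))
    refine h1.congr_deriv ?_
    have e1 : inner ℝ (u t) (N (M (y t))) = inner ℝ (u t) (y t) := by
      rw [← hN, ← hM, hMN]
    have e2 : inner ℝ (M (y t)) (N (u t)) = inner ℝ (u t) (y t) := by
      rw [hM, hMN, real_inner_comm]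
    have e3 : inner ℝ (u t) (N (r₁ t)) = inner ℝ (N (u t)) (r₁ t) := (hN _ _).symm
    simp only [Function.comp_apply, map_add, inner_add_left, inner_add_right, e1, e2, e3,
      real_inner_comm (N (u t)) (r₁ t), hW]
    ring
  have hW' : ∀ t, 0 ≤ t → HasDerivAt W (2 * inner ℝ (y t) (M (y t)) - h t
      + (inner ℝ (r₁ t) (y t) + inner ℝ (u t) (r₂ t))) t := by
    intro t ht
    refine ((hu t ht).inner ℝ (hy t ht)).congr_deriv ?_
    simp only [inner_add_left, inner_add_right, hh, real_inner_comm (M (y t)) (y t)]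
    ring
  have hh' : ∀ t, 0 ≤ t → HasDerivAt h
      (2 * inner ℝ (M (y t)) (r₂ t) - 2 * inner ℝ (L (u t)) (r₁ t)) t := by
    intro t ht
    have h1 := (hy t ht).inner ℝ (M.hasFDerivAt.comp_hasDerivAt t (hy t ht))
    have h2 := (hu t ht).inner ℝ (L.hasFDerivAt.comp_hasDerivAt t (hu t ht))
    refine (h1.sub h2).congr_deriv ?_
    have e1 : inner ℝ (y t) (M (L (u t))) = inner ℝ (M (y t)) (L (u t)) := (hM _ _).symm
    have e2 : inner ℝ (y t) (M (r₂ t)) = inner ℝ (M (y t)) (r₂ t) := (hM _ _).symm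
    have e3 : inner ℝ (u t) (L (M (y t))) = inner ℝ (M (y t)) (L (u t)) := by
      rw [← hL, real_inner_comm]
    have e4 : inner ℝ (u t) (L (r₁ t)) = inner ℝ (L (u t)) (r₁ t) := (hL _ _).symm
    simp only [Function.comp_apply, map_add, inner_add_left, inner_add_right, e1, e2, e3, e4,
      real_inner_comm (M (y t)) (r₂ t), real_inner_comm (L (u t)) (r₁ t),
      real_inner_comm (M (y t)) (L (u t))]
    ring
  have hIn : ∀ t, n * ‖u t‖ ^ 2 ≤ I t := fun t => hNpos _
  have hInonneg : ∀ t, 0 ≤ I t := fun t => (by positivity : 0 ≤ n * ‖u t‖ ^ 2).trans (hIn t)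
  have hI0 : 0 < I 0 := (by
    have := norm_pos_iff.2 hu0
    positivity : 0 < n * ‖u 0‖ ^ 2).trans_le (hIn 0)
  have hIβ : ∀ t, 0 ≤ t → I t ^ q ≤ β := by
    intro t ht
    rw [← hbβ]
    refine Real.rpow_le_rpow (hInonneg t) ?_ hq.le
    have h1 : I t ≤ ‖N‖ * ‖u t‖ ^ 2 := by
      refine (real_inner_le_norm _ _).trans ?_
      have := N.le_opNorm (u t)
      nlinarith [norm_nonneg (u t)]
    have h2 : ‖u t‖ ^ 2 ≤ b := by nlinarith [hcon t ht, sq_nonneg ‖y t‖]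
    nlinarith [norm_nonneg N, sq_nonneg ‖u t‖]
  have hcs : ∀ t, W t ^ 2 ≤ I t * inner ℝ (y t) (M (y t)) := by
    intro t
    -- Cauchy–Schwarz for the form of `M` applied to `y` and `N u`, in discriminant form.
    have key : ∀ s : ℝ, 0 ≤ I t * (s * s) + (-2 * W t) * s + inner ℝ (y t) (M (y t)) := by
      intro s
      have h1 : 0 ≤ inner ℝ (y t - s • N (u t)) (M (y t - s • N (u t))) :=
        (by positivity : 0 ≤ m * ‖y t - s • N (u t)‖ ^ 2).trans (hMpos _)
      have e1 : inner ℝ (N (u t)) (M (y t)) = inner ℝ (u t) (y t) := by rw [← hM, hMN]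
      simp only [map_sub, map_smul, hMN, inner_sub_left, inner_sub_right, real_inner_smul_left,
        real_inner_smul_right, e1, real_inner_comm (u t) (y t), real_inner_comm (u t) (N (u t))]
        at h1
      simp only [hI, hW]
      linarith
    have := discrim_le_zero key
    rw [discrim] at this
    nlinarith
  -- bounds valid while `h ≤ I`
  have hSI : ∀ t, h t ≤ I t → S t ≤ C₀ * I t := by
    intro t ht
    have h1 : ‖u t‖ ^ 2 ≤ I t / n := by
      rw [le_div_iff₀ hn, mul_comm]
      exact hIn t
    have h2 : m * ‖y t‖ ^ 2 ≤ I t + ‖L‖ * (I t / n) := by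
      have h3 : inner ℝ (u t) (L (u t)) ≤ ‖L‖ * ‖u t‖ ^ 2 := by
        refine (real_inner_le_norm _ _).trans ?_
        have := L.le_opNorm (u t)
        nlinarith [norm_nonneg (u t)]
      have h4 := mul_le_mul_of_nonneg_left h1 (norm_nonneg L)
      have h5 := hMpos (y t)
      simp only [hh] at ht
      linarith
    have h3 : ‖y t‖ ^ 2 ≤ (I t + ‖L‖ * (I t / n)) / m := by
      rw [le_div_iff₀ hm, mul_comm]
      exact h2
    calc S t ≤ I t / n + (I t + ‖L‖ * (I t / n)) / m := add_le_add h1 h3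
      _ = C₀ * I t := by rw [hC₀]; ring
  have herr : ∀ t, 0 ≤ t → 0 < I t → h t ≤ I t →
      |2 * inner ℝ (N (u t)) (r₁ t)| ≤ C₁ * (I t * I t ^ q) ∧
      |inner ℝ (r₁ t) (y t) + inner ℝ (u t) (r₂ t)| ≤ C₁ * (I t * I t ^ q) ∧
      |2 * inner ℝ (M (y t)) (r₂ t) - 2 * inner ℝ (L (u t)) (r₁ t)| ≤ C₁ * (I t * I t ^ q) := by
    intro t ht hIt hhI
    obtain ⟨hr1, hr2⟩ := hr t ht (hcon t ht)
    have hS0 : 0 ≤ S t := by positivity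
    set R : ℝ := √(S t) with hR
    have hu1 : ‖u t‖ ≤ R := Real.le_sqrt_of_sq_le (by simp only [hS]; nlinarith [sq_nonneg ‖y t‖])
    have hy1 : ‖y t‖ ≤ R := Real.le_sqrt_of_sq_le (by simp only [hS]; nlinarith [sq_nonneg ‖u t‖])
    set T : ℝ := C * S t ^ (q + 1 / 2) with hT
    have hT0 : 0 ≤ T := by positivity
    have hR0 : 0 ≤ R := Real.sqrt_nonneg _
    have hRT : R * T ≤ C * (C₀ ^ (q + 1) * (I t * I t ^ q)) := by
      have e1 : R * S t ^ (q + 1 / 2) = S t ^ (q + 1) := by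
        rw [hR, Real.sqrt_eq_rpow, ← Real.rpow_add_of_nonneg hS0 (by norm_num) (by positivity)]
        congr 1
        ring
      have e2 : I t * I t ^ q = I t ^ (q + 1) := by
        rw [Real.rpow_add_one hIt.ne', mul_comm]
      rw [hT, mul_left_comm, e1, e2, ← Real.mul_rpow hC₀0.le hIt.le]
      exact mul_le_mul_of_nonneg_left
        (Real.rpow_le_rpow hS0 (hSI t hhI) (by linarith)) hC
    have hfin : 2 * (‖N‖ + ‖M‖ + ‖L‖ + 1) * (R * T) ≤ C₁ * (I t * I t ^ q) := by
      calc 2 * (‖N‖ + ‖M‖ + ‖L‖ + 1) * (R * T)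
          ≤ 2 * (‖N‖ + ‖M‖ + ‖L‖ + 1) * (C * (C₀ ^ (q + 1) * (I t * I t ^ q))) := by gcongr
        _ = (C₁ - 1) * (I t * I t ^ q) := by rw [hC₁]; ring
        _ ≤ _ := by
          have : 0 ≤ I t * I t ^ q := by positivity
          linarith
    have hRT0 : 0 ≤ R * T := by positivity
    have bd : ∀ (P : X →L[ℝ] X) (v r : X), ‖v‖ ≤ R → ‖r‖ ≤ T → |inner ℝ (P v) r| ≤ ‖P‖ * (R * T) := by
      intro P v r hv hr
      refine (abs_real_inner_le_norm _ _).trans ?_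
      rw [← mul_assoc]
      have := (P.le_opNorm v).trans (mul_le_mul_of_nonneg_left hv (norm_nonneg P))
      gcongr
    have bd1 : ∀ v r : X, ‖v‖ ≤ R → ‖r‖ ≤ T → |inner ℝ v r| ≤ R * T := by
      intro v r hv hr
      refine (abs_real_inner_le_norm _ _).trans ?_
      gcongr
    have hNM : 0 ≤ ‖N‖ * (R * T) := by positivity
    have hMM : 0 ≤ ‖M‖ * (R * T) := by positivity
    have hLL : 0 ≤ ‖L‖ * (R * T) := by positivity
    refine ⟨?_, ?_, ?_⟩
    · rw [abs_mul, abs_two]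
      have := bd N _ _ hu1 hr1
      linarith
    · have h1 := bd1 _ _ hy1 hr1
      have h2 := bd1 _ _ hu1 hr2
      rw [real_inner_comm] at h1
      have := abs_add_le (inner ℝ (r₁ t) (y t)) (inner ℝ (u t) (r₂ t))
      linarith
    · have h1 := bd M _ _ hy1 hr2
      have h2 := bd L _ _ hu1 hr1
      have := abs_sub (2 * inner ℝ (M (y t)) (r₂ t)) (2 * inner ℝ (L (u t)) (r₁ t))
      rw [abs_mul, abs_mul, abs_two] at this
      linarith
  obtain ⟨t, ht, hIt, hlt⟩ := H I W h (fun t => inner ℝ (y t) (M (y t))) _ _ _ hI' hW' hh' hcs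
    herr hI0 (by simpa [hh] using hini1) hini2
  exact absurd (hIβ t ht) (not_le.2 hlt)

end Chetaev

/-! ### Resolvents of nonnegative operators -/

section Resolvent

variable {V : Type*} [NormedAddCommGroup V] [InnerProductSpace ℂ V]

theorem re_inner_symm (x y : V) : (inner ℂ x y).re = (inner ℂ y x).re :=
  inner_re_symm (𝕜 := ℂ) x y

theorem re_inner_self (x : V) : (inner ℂ x x).re = ‖x‖ ^ 2 :=
  inner_self_eq_norm_sq (𝕜 := ℂ) x

theorem re_inner_le_norm_mul (x y : V) : (inner ℂ x y).re ≤ ‖x‖ * ‖y‖ :=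
  re_inner_le_norm (𝕜 := ℂ) x y

/-- The operator `A + κ`. -/
noncomputable def shifted (A : V →L[ℂ] V) (κ : ℝ) : V →L[ℂ] V :=
  A + (κ : ℂ) • ContinuousLinearMap.id ℂ V

@[simp] theorem shifted_apply (A : V →L[ℂ] V) (κ : ℝ) (x : V) :
    shifted A κ x = A x + (κ : ℂ) • x := by
  simp [shifted]

/-- A symmetric operator with nonnegative quadratic form. -/
structure IsNonnegSymm (A : V →L[ℂ] V) : Prop where
  symm : ∀ x y, inner ℂ (A x) y = inner ℂ x (A y)
  nonneg : ∀ x, 0 ≤ (inner ℂ x (A x)).re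

/-- The inverse of `A + κ`. -/
noncomputable def resolventAt (A : V →L[ℂ] V) (κ : ℝ) : V →L[ℂ] V := Ring.inverse (shifted A κ)

/-- A self-adjoint operator is bounded above by any upper bound of its spectrum. The hypothesis is
phrased through units, so no real algebra structure on the operators enters it. -/
theorem nonneg_of_spectrum_le [CompleteSpace V] {H : V →L[ℂ] V} (hH : IsSelfAdjoint H) {E : ℝ}
    (hE : ∀ r : ℝ, E < r → IsUnit ((r : ℂ) • (1 : V →L[ℂ] V) - H)) (x : V) :
    0 ≤ (inner ℂ x ((E : ℂ) • x - H x)).re := by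
  have h1 : H ≤ algebraMap ℝ (V →L[ℂ] V) E := by
    refine le_algebraMap_of_spectrum_le fun r hr => ?_
    by_contra hcon
    refine hr ?_
    rw [spectrum.mem_resolventSet_iff, Algebra.algebraMap_eq_smul_one]
    exact hE r (not_le.1 hcon)
  have h2 := ((ContinuousLinearMap.le_def _ _).1 h1).re_inner_nonneg_right x
  have e : (algebraMap ℝ (V →L[ℂ] V) E - H) x = (E : ℂ) • x - H x := by
    rw [sub_apply, Algebra.algebraMap_eq_smul_one]
    simp
  rw [e] at h2
  exact h2

variable {A : V →L[ℂ] V} (hA : IsNonnegSymm A)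
include hA

theorem IsNonnegSymm.shifted_symm (κ : ℝ) (x y : V) :
    inner ℂ (shifted A κ x) y = inner ℂ x (shifted A κ y) := by
  rw [shifted_apply, shifted_apply, inner_add_left, inner_add_right, hA.symm, inner_smul_left,
    inner_smul_right, Complex.conj_ofReal]

theorem IsNonnegSymm.le_shifted (κ : ℝ) (x : V) :
    κ * ‖x‖ ^ 2 ≤ (inner ℂ x (shifted A κ x)).re := by
  have h1 : (inner ℂ x (shifted A κ x)).re = (inner ℂ x (A x)).re + κ * ‖x‖ ^ 2 := by
    rw [shifted_apply, inner_add_right, inner_smul_right, Complex.add_re, Complex.re_ofReal_mul,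
      re_inner_self]
  rw [h1]
  linarith [hA.nonneg x]

variable [CompleteSpace V] {κ : ℝ} (hκ : 0 < κ)
include hκ

theorem IsNonnegSymm.isUnit_shifted : IsUnit (shifted A κ) := by
  refine ContinuousLinearMap.isUnit_of_forall_le_norm_inner_map _ (c := ⟨κ, hκ.le⟩) hκ fun x => ?_
  have h1 := hA.le_shifted κ x
  rw [hA.shifted_symm]
  calc ‖x‖ ^ 2 * κ = κ * ‖x‖ ^ 2 := mul_comm _ _
    _ ≤ _ := h1
    _ ≤ _ := Complex.re_le_norm _

theorem IsNonnegSymm.shifted_resolventAt (x : V) : shifted A κ (resolventAt A κ x) = x :=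
  DFunLike.congr_fun (Ring.mul_inverse_cancel _ (hA.isUnit_shifted hκ)) x

theorem IsNonnegSymm.resolventAt_shifted (x : V) : resolventAt A κ (shifted A κ x) = x :=
  DFunLike.congr_fun (Ring.inverse_mul_cancel _ (hA.isUnit_shifted hκ)) x

theorem IsNonnegSymm.resolventAt_symm (x y : V) :
    inner ℂ (resolventAt A κ x) y = inner ℂ x (resolventAt A κ y) := by
  conv_lhs => rw [← hA.shifted_resolventAt hκ y, ← hA.shifted_symm, hA.shifted_resolventAt hκ]

theorem IsNonnegSymm.resolventAt_eq_of_shifted_eq {x y : V} (h : shifted A κ x = y) :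
    resolventAt A κ y = x := by
  rw [← h, hA.resolventAt_shifted hκ]

theorem IsNonnegSymm.norm_resolventAt_le (x : V) : κ * ‖resolventAt A κ x‖ ≤ ‖x‖ := by
  have h1 := hA.le_shifted κ (resolventAt A κ x)
  rw [hA.shifted_resolventAt hκ] at h1
  have h2 := h1.trans (re_inner_le_norm_mul _ _)
  rcases (norm_nonneg (resolventAt A κ x)).eq_or_lt with h0 | h0
  · rw [← h0, mul_zero]; exact norm_nonneg x
  · nlinarith

theorem IsNonnegSymm.resolventAt_of_mem_ker {x : V} (hx : A x = 0) :
    (κ : ℂ) • resolventAt A κ x = x := by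
  rw [← map_smul]
  exact hA.resolventAt_eq_of_shifted_eq hκ (by simp [hx])

/-- The quadratic form of `κ (A + κ)⁻¹`. -/
noncomputable def resolventForm (A : V →L[ℂ] V) (κ : ℝ) (x : V) : ℝ :=
  κ * (inner ℂ x (resolventAt A κ x)).re

theorem IsNonnegSymm.resolventForm_eq (x : V) :
    resolventForm A κ x = ‖x‖ ^ 2 - (inner ℂ x (A (resolventAt A κ x))).re := by
  have h := congrArg (fun y => (inner ℂ x y).re) (hA.shifted_resolventAt hκ x)
  simp only [shifted_apply, inner_add_right, inner_smul_right, Complex.add_re,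
    Complex.re_ofReal_mul, re_inner_self] at h
  rw [resolventForm]
  linarith

/-- With `x = (A + κ) z` the deficit equals ‖A z‖² + κ⟨z, A z⟩, and `A z = 0` would force `A x = 0`.
This gives F_n < 1. -/
theorem IsNonnegSymm.resolventForm_lt {x : V} (hx : A x ≠ 0) :
    resolventForm A κ x < ‖x‖ ^ 2 := by
  rw [hA.resolventForm_eq hκ]
  set z := resolventAt A κ x with hz
  have hxz : x = shifted A κ z := (hA.shifted_resolventAt hκ x).symm
  have h1 : (inner ℂ x (A z)).re = ‖A z‖ ^ 2 + κ * (inner ℂ z (A z)).re := by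
    conv_lhs => rw [hxz]
    rw [shifted_apply, inner_add_left, inner_smul_left, Complex.conj_ofReal, Complex.add_re,
      Complex.re_ofReal_mul, re_inner_self]
  have h2 : A z ≠ 0 := fun h => hx (by rw [hxz, shifted_apply, h]; simp [h])
  have h3 : 0 < ‖A z‖ ^ 2 := by
    have := norm_pos_iff.2 h2
    positivity
  have := mul_nonneg hκ.le (hA.nonneg z)
  linarith

/-- With `x = (A + κ)(A + κ') z` the increment is (κ' − κ) Re⟨x, A z⟩. Expanding `x`, every term of
the pairing is nonnegative and the one in ‖A z‖² is positive. -/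
theorem IsNonnegSymm.resolventForm_strictMono {κ' : ℝ} (hκκ' : κ < κ') {x : V} (hx : A x ≠ 0) :
    resolventForm A κ x < resolventForm A κ' x := by
  have hκ' := hκ.trans hκκ'
  rw [hA.resolventForm_eq hκ, hA.resolventForm_eq hκ']
  set z := resolventAt A κ (resolventAt A κ' x) with hz
  have e1 : shifted A κ z = resolventAt A κ' x := hA.shifted_resolventAt hκ _
  have e2 : shifted A κ' (shifted A κ z) = x := by rw [e1, hA.shifted_resolventAt hκ']
  have e3 : resolventAt A κ x = shifted A κ' z := by
    apply hA.resolventAt_eq_of_shifted_eq hκ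
    rw [← e2]
    simp only [shifted_apply, map_add, map_smul, smul_add, smul_smul, mul_comm (κ : ℂ)]
    abel
  rw [e3, ← e1]
  have h1 : A (shifted A κ' z) = A (shifted A κ z) + ((κ' - κ : ℝ) : ℂ) • A z := by
    simp only [shifted_apply, map_add, map_smul, Complex.ofReal_sub, sub_smul]
    abel
  have h2 : (inner ℂ x (A z)).re
      = (inner ℂ (A z) (A (A z))).re + (κ + κ') * ‖A z‖ ^ 2 + κ * κ' * (inner ℂ z (A z)).re := by
    rw [← e2]
    simp only [shifted_apply, map_add, map_smul, smul_add, inner_add_left, inner_smul_left,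
      Complex.conj_ofReal, Complex.add_re, Complex.re_ofReal_mul, re_inner_self]
    rw [hA.symm (A z)]
    ring
  have h3 : A z ≠ 0 := fun h => hx (by rw [← e2]; simp [h])
  have h4 : 0 < ‖A z‖ ^ 2 := by
    have := norm_pos_iff.2 h3
    positivity
  have h5 : 0 < (inner ℂ x (A z)).re := by
    rw [h2]
    have := hA.nonneg (A z)
    have := mul_nonneg (mul_pos hκ hκ').le (hA.nonneg z)
    have : 0 < (κ + κ') * ‖A z‖ ^ 2 := by positivity
    linarith
  rw [h1, inner_add_right, inner_smul_right, Complex.add_re, Complex.re_ofReal_mul]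
  have := mul_pos (sub_pos.2 hκκ') h5
  linarith

/-- Forces the form to 1 as κ → ∞, which makes the threshold power finite. -/
theorem IsNonnegSymm.one_sub_resolventForm_le {x : V} (hx : ‖x‖ = 1) :
    1 - resolventForm A κ x ≤ ‖A‖ / κ := by
  rw [hA.resolventForm_eq hκ, hx, le_div_iff₀ hκ]
  have h1 := re_inner_le_norm_mul x (A (resolventAt A κ x))
  have h2 := A.le_opNorm (resolventAt A κ x)
  have h3 := hA.norm_resolventAt_le hκ x
  have h4 := norm_nonneg A
  rw [hx] at h1 h3
  nlinarith

/-! ### The resolvent form and the projection onto the kernel -/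

section Projection

variable {K : Submodule ℂ V} [K.HasOrthogonalProjection] (hK : ∀ x, x ∈ K ↔ A x = 0)
include hK

/-- On the kernel `κ (A + κ)⁻¹` is the identity, so the cross terms between the kernel and its
complement vanish. -/
theorem IsNonnegSymm.resolventForm_eq_proj (x : V) :
    resolventForm A κ x = ‖K.starProjection x‖ ^ 2
      + κ * (inner ℂ (x - K.starProjection x) (resolventAt A κ (x - K.starProjection x))).re := by
  set p := K.starProjection x with hp
  set y := x - p with hy
  have hpK : p ∈ K := Submodule.starProjection_apply_mem _ _
  have hxe : x = p + y := by rw [hy]; abel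
  have hp1 := hA.resolventAt_of_mem_ker hκ ((hK p).1 hpK)
  have hyp : inner ℂ y p = 0 := K.starProjection_inner_eq_zero x p hpK
  have hpy : inner ℂ p y = 0 := by rw [← inner_conj_symm, hyp, map_zero]
  have hp2 : (κ : ℂ) * inner ℂ p (resolventAt A κ p) = inner ℂ p p := by
    rw [← inner_smul_right, hp1]
  have hp3 : (κ : ℂ) * inner ℂ p (resolventAt A κ y) = 0 := by
    rw [← hA.resolventAt_symm hκ]
    have : (κ : ℂ) * inner ℂ (resolventAt A κ p) y = inner ℂ ((κ : ℂ) • resolventAt A κ p) y := by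
      rw [inner_smul_left, Complex.conj_ofReal]
    rw [this, hp1, hpy]
  have hp4 : (κ : ℂ) * inner ℂ y (resolventAt A κ p) = 0 := by
    rw [← inner_smul_right, hp1, hyp]
  rw [resolventForm, ← Complex.re_ofReal_mul, ← Complex.re_ofReal_mul]
  conv_lhs => rw [hxe]
  rw [map_add, inner_add_left, inner_add_right, inner_add_right, mul_add, mul_add, mul_add, hp2,
    hp3, hp4, add_zero, zero_add, Complex.add_re, re_inner_self]

/-- The component off the kernel is nonzero and the resolvent is strictly positive. This strictness
settles the borderline case of the spectral criterion. -/
theorem IsNonnegSymm.norm_proj_sq_lt_resolventForm {x : V} (hx : A x ≠ 0) :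
    ‖K.starProjection x‖ ^ 2 < resolventForm A κ x := by
  rw [hA.resolventForm_eq_proj hκ hK]
  set y := x - K.starProjection x with hy
  have hy0 : y ≠ 0 := by
    intro h
    apply hx
    rw [sub_eq_zero.1 h]
    exact (hK _).1 (Submodule.starProjection_apply_mem _ _)
  have h1 := hA.le_shifted κ (resolventAt A κ y)
  rw [hA.shifted_resolventAt hκ, re_inner_symm] at h1
  have h2 : resolventAt A κ y ≠ 0 := by
    intro h
    have := hA.shifted_resolventAt hκ y
    rw [h, map_zero] at this
    exact hy0 this.symm
  have h3 := norm_pos_iff.2 h2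
  have h4 : 0 < κ * ‖resolventAt A κ y‖ ^ 2 := by positivity
  have := mul_pos hκ (h4.trans_le h1)
  linarith

omit hκ in
-- `κ (A + κ)⁻¹` tends strongly to the kernel projection as κ → 0: off the kernel, a vector is
-- approximated by some `A z`, and `κ (A + κ)⁻¹ A z = κ (z - κ (A + κ)⁻¹ z)` is O(κ). No spectral
-- gap is assumed.
theorem IsNonnegSymm.exists_resolventForm_lt (x : V) {η : ℝ} (hη : 0 < η) :
    ∃ κ₀ > 0, ∀ κ, 0 < κ → κ < κ₀ → resolventForm A κ x < ‖K.starProjection x‖ ^ 2 + η := by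
  set y := x - K.starProjection x with hy
  have hcl : y ∈ (LinearMap.range (A : V →ₗ[ℂ] V)).topologicalClosure := by
    rw [← Submodule.orthogonal_orthogonal_eq_closure]
    have hle : (LinearMap.range (A : V →ₗ[ℂ] V))ᗮ ≤ K := by
      intro z hz
      rw [hK]
      have h1 := (Submodule.mem_orthogonal _ _).1 hz (A (A z)) ⟨A z, rfl⟩
      rw [hA.symm] at h1
      exact inner_self_eq_zero.1 h1
    exact Submodule.orthogonal_le hle (K.sub_starProjection_mem_orthogonal x)
  set δ := η / (2 * (‖y‖ + 1)) with hδ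
  have hδ0 : 0 < δ := by positivity
  obtain ⟨_, ⟨z, rfl⟩, hz⟩ := Metric.mem_closure_iff.1 hcl δ hδ0
  rw [dist_eq_norm] at hz
  change ‖y - A z‖ < δ at hz
  refine ⟨δ / (2 * ‖z‖ + 1), by positivity, fun κ hκ hκ0 => ?_⟩
  rw [hA.resolventForm_eq_proj hκ hK]
  rw [lt_div_iff₀ (by positivity)] at hκ0
  have e1 : (κ : ℂ) • resolventAt A κ y
      = (κ : ℂ) • resolventAt A κ (y - A z) + (κ : ℂ) • (z - (κ : ℂ) • resolventAt A κ z) := by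
    have : resolventAt A κ (A z) = z - (κ : ℂ) • resolventAt A κ z := by
      have h := hA.resolventAt_shifted hκ z
      rw [shifted_apply, map_add, map_smul] at h
      exact eq_sub_of_add_eq h
    rw [map_sub _ y (A z), this]
    simp only [smul_sub]
    abel
  have hsm : ∀ v : V, ‖(κ : ℂ) • v‖ = κ * ‖v‖ := fun v => by
    rw [norm_smul, Complex.norm_real, Real.norm_of_nonneg hκ.le]
  have h2 : ‖(κ : ℂ) • resolventAt A κ y‖ ≤ ‖y - A z‖ + κ * (2 * ‖z‖) := by
    rw [e1]
    refine (norm_add_le _ _).trans (add_le_add ?_ ?_)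
    · rw [hsm]; exact hA.norm_resolventAt_le hκ _
    · rw [hsm]
      refine mul_le_mul_of_nonneg_left ?_ hκ.le
      refine (norm_sub_le _ _).trans ?_
      rw [hsm]
      linarith [hA.norm_resolventAt_le hκ z]
  have h3 : κ * (inner ℂ y (resolventAt A κ y)).re ≤ ‖y‖ * (2 * δ) := by
    rw [← Complex.re_ofReal_mul, ← inner_smul_right]
    refine (re_inner_le_norm_mul _ _).trans ?_
    refine mul_le_mul_of_nonneg_left ?_ (norm_nonneg _)
    linarith
  have h4 : ‖y‖ * (2 * δ) < η := by
    have : 2 * δ * (‖y‖ + 1) = η := by rw [hδ]; field_simp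
    linarith
  linarith

end Projection

/-- Compression of the resolvent bounds the compression of the identity. -/
theorem IsNonnegSymm.norm_sq_le_of_compression {ξ f : V} {m : ℝ} (hm : 0 < m)
    (hf : (inner ℂ f ξ).re = ‖f‖ ^ 2) (hfm : (inner ℂ f (resolventAt A κ f)).re ≤ m * ‖f‖ ^ 2) :
    ‖f‖ ^ 2 ≤ m * (inner ℂ ξ (shifted A κ ξ)).re := by
  -- Positivity of `A + κ` is tested on `ξ - s (A + κ)⁻¹ f`; `s = 1 / m` optimizes the resulting
  -- quadratic in `s`.
  set s : ℝ := 1 / m with hs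
  have h := hA.le_shifted κ (ξ - (s : ℂ) • resolventAt A κ f)
  have h0 : 0 ≤ κ * ‖ξ - (s : ℂ) • resolventAt A κ f‖ ^ 2 := by positivity
  have h1 := h0.trans h
  have e1 : inner ℂ (resolventAt A κ f) (shifted A κ ξ) = inner ℂ f ξ := by
    rw [← hA.shifted_symm, hA.shifted_resolventAt hκ]
  simp only [map_sub, map_smul, hA.shifted_resolventAt hκ, inner_sub_left, inner_sub_right,
    inner_smul_left, inner_smul_right, Complex.conj_ofReal, Complex.sub_re,
    Complex.re_ofReal_mul, e1, hf] at h1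
  rw [re_inner_symm ξ f, hf, re_inner_symm _ f] at h1
  have h2 : s * (s * (inner ℂ f (resolventAt A κ f)).re) ≤ s * (s * (m * ‖f‖ ^ 2)) := by
    gcongr
  have h3 : s * (s * (m * ‖f‖ ^ 2)) = s * ‖f‖ ^ 2 := by rw [hs]; field_simp
  have h4 : s * ‖f‖ ^ 2 ≤ (inner ℂ ξ (shifted A κ ξ)).re := by linarith
  calc ‖f‖ ^ 2 = m * (s * ‖f‖ ^ 2) := by rw [hs]; field_simp
    _ ≤ _ := by gcongr

end Resolvent

/-! ### The space `ℓ²(ι; ℂ)` -/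

/-- Square summable complex functions. -/
abbrev EllTwo (ι : Type*) : Type _ := lp (fun _ : ι => ℂ) 2

namespace EllTwo

variable {ι : Type*}

theorem hasSum_norm_sq (f : EllTwo ι) : HasSum (fun x => ‖f x‖ ^ 2) (‖f‖ ^ 2) := by
  have := lp.hasSum_norm (p := 2) (by norm_num) f
  simpa using this

theorem norm_apply_le (f : EllTwo ι) (x : ι) : ‖f x‖ ≤ ‖f‖ :=
  lp.norm_apply_le_norm two_ne_zero f x

theorem real_inner_eq (f g : EllTwo ι) : inner ℝ f g = (inner ℂ f g).re := by
  rw [lp.inner_eq_tsum, lp.inner_eq_tsum, Complex.re_tsum (lp.summable_inner f g)]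
  rfl

theorem hasSum_real_inner (f g : EllTwo ι) : HasSum (fun x => inner ℝ (f x) (g x)) (inner ℝ f g) :=
  lp.hasSum_inner f g

theorem memℓp_of_norm_le {f : ι → ℂ} {g : EllTwo ι} {C : ℝ} (h : ∀ x, ‖f x‖ ≤ C * ‖g x‖) :
    Memℓp f 2 := by
  apply memℓp_gen' (C := C ^ 2 * ‖g‖ ^ 2)
  intro s
  have h1 := sum_le_hasSum s (fun _ _ => by positivity) (hasSum_norm_sq g)
  calc ∑ i ∈ s, ‖f i‖ ^ (2 : ℝ≥0∞).toReal = ∑ i ∈ s, ‖f i‖ ^ 2 := by simp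
    _ ≤ ∑ i ∈ s, C ^ 2 * ‖g i‖ ^ 2 := by
      gcongr with i _
      rw [← mul_pow]
      exact pow_le_pow_left₀ (norm_nonneg _) (h i) 2
    _ = C ^ 2 * ∑ i ∈ s, ‖g i‖ ^ 2 := by rw [Finset.mul_sum]
    _ ≤ _ := by gcongr

theorem norm_le_of_forall_norm_le {f g : EllTwo ι} {C : ℝ} (hC : 0 ≤ C)
    (h : ∀ x, ‖f x‖ ≤ C * ‖g x‖) : ‖f‖ ≤ C * ‖g‖ := by
  refine le_of_sq_le_sq ?_ (by positivity)
  rw [mul_pow]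
  refine hasSum_le (fun x => ?_) (hasSum_norm_sq f) ((hasSum_norm_sq g).mul_left (C ^ 2))
  rw [← mul_pow]
  exact pow_le_pow_left₀ (norm_nonneg _) (h x) 2

/-- The nonlinearity `f ↦ |f|^p f` on `ℓ²`. -/
noncomputable def nl (p : ℝ) (f : EllTwo ι) : EllTwo ι :=
  if hp : 0 ≤ p then ⟨fun x => powNL p (f x), memℓp_of_norm_le (g := f) (C := ‖f‖ ^ p) fun x => by
    rw [norm_powNL]
    have := norm_apply_le f x
    gcongr⟩ else 0

variable {p : ℝ}

theorem nl_apply (hp : 0 ≤ p) (f : EllTwo ι) (x : ι) : nl p f x = powNL p (f x) := by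
  rw [nl, dif_pos hp]

theorem norm_nl_le (hp : 0 ≤ p) (f : EllTwo ι) : ‖nl p f‖ ≤ ‖f‖ ^ p * ‖f‖ := by
  refine norm_le_of_forall_norm_le (by positivity) fun x => ?_
  rw [nl_apply hp, norm_powNL]
  have := norm_apply_le f x
  gcongr

theorem nl_sub_le (hp : 0 ≤ p) {R : ℝ} {f g : EllTwo ι} (hf : ‖f‖ ≤ R) (hg : ‖g‖ ≤ R) :
    ‖nl p f - nl p g‖ ≤ (p + 2) * R ^ p * ‖f - g‖ := by
  have hR : 0 ≤ R := (norm_nonneg _).trans hf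
  refine norm_le_of_forall_norm_le (by positivity) fun x => ?_
  rw [lp.coeFn_sub, lp.coeFn_sub, Pi.sub_apply, Pi.sub_apply, nl_apply hp, nl_apply hp]
  exact powNL_sub_le hp ((norm_apply_le f x).trans hf) ((norm_apply_le g x).trans hg)

theorem re_inner_I_smul (f g : EllTwo ι) :
    (inner ℂ f (Complex.I • g)).re = -(inner ℂ f g).im := by
  rw [inner_smul_right, Complex.I_mul_re]

theorem im_inner_nl (hp : 0 ≤ p) (f : EllTwo ι) : (inner ℂ f (nl p f)).im = 0 := by
  rw [lp.inner_eq_tsum, Complex.im_tsum (lp.summable_inner f (nl p f))]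
  convert tsum_zero with x
  rw [nl_apply hp, powNL, ← smul_eq_mul, inner_smul_right, Complex.im_ofReal_mul]
  simp [← Complex.ofReal_pow]

/-! ### The potential energy -/

theorem summable_norm_rpow (hp : 0 ≤ p) (f : EllTwo ι) : Summable fun x => ‖f x‖ ^ (p + 2) := by
  refine Summable.of_nonneg_of_le (fun x => by positivity) (fun x => ?_)
    ((hasSum_norm_sq f).summable.mul_left (‖f‖ ^ p))
  rw [Real.rpow_add_of_nonneg (norm_nonneg _) hp (by norm_num), Real.rpow_two]
  have := norm_apply_le f x
  gcongr

/-- The potential energy `∑ |f|^(p+2)`. -/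
noncomputable def potential (p : ℝ) (f : EllTwo ι) : ℝ := ∑' x, ‖f x‖ ^ (p + 2)

theorem hasSum_potential (hp : 0 ≤ p) (f : EllTwo ι) :
    HasSum (fun x => ‖f x‖ ^ (p + 2)) (potential p f) :=
  (summable_norm_rpow hp f).hasSum

theorem abs_potential_add_sub_le (hp : 0 ≤ p) {R : ℝ} {f g : EllTwo ι} (hf : ‖f‖ ≤ R)
    (hg : ‖g‖ ≤ R) :
    |potential p (f + g) - potential p f - (p + 2) * inner ℝ (nl p f) g|
      ≤ (p + 2) * ((p + 2) * (2 * R) ^ p) * ‖g‖ ^ 2 := by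
  have h1 := ((hasSum_potential hp (f + g)).sub (hasSum_potential hp f)).sub
    ((hasSum_real_inner (nl p f) g).mul_left (p + 2))
  have h2 := (hasSum_norm_sq g).mul_left ((p + 2) * ((p + 2) * (2 * R) ^ p))
  have h3 : ∀ x, |‖(f + g) x‖ ^ (p + 2) - ‖f x‖ ^ (p + 2) - (p + 2) * inner ℝ (nl p f x) (g x)|
      ≤ (p + 2) * ((p + 2) * (2 * R) ^ p) * ‖g x‖ ^ 2 := by
    intro x
    rw [nl_apply hp, lp.coeFn_add, Pi.add_apply]
    exact abs_norm_rpow_add_sub_le hp ((norm_apply_le f x).trans hf) ((norm_apply_le g x).trans hg)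
  rw [abs_le]
  refine ⟨?_, hasSum_le (fun x => (abs_le.1 (h3 x)).2) h1 h2⟩
  exact hasSum_le (fun x => (abs_le.1 (h3 x)).1) h2.neg h1

theorem hasFDerivAt_potential (hp : 0 ≤ p) (f : EllTwo ι) :
    HasFDerivAt (potential p) ((p + 2) • innerSL ℝ (nl p f)) f := by
  rw [hasFDerivAt_iff_isLittleO_nhds_zero]
  refine Asymptotics.IsBigO.trans_isLittleO (g := fun h : EllTwo ι => ‖h‖ ^ 2) ?_ ?_
  · refine Asymptotics.IsBigO.of_bound ((p + 2) * ((p + 2) * (2 * (‖f‖ + 1)) ^ p)) ?_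
    filter_upwards [Metric.ball_mem_nhds (0 : EllTwo ι) one_pos] with g hg
    have hg1 : ‖g‖ ≤ ‖f‖ + 1 := by
      have := mem_ball_zero_iff.1 hg
      linarith [norm_nonneg f]
    have := abs_potential_add_sub_le hp (by linarith : ‖f‖ ≤ ‖f‖ + 1) hg1
    simpa using this
  · exact Asymptotics.isLittleO_norm_pow_id one_lt_two

/-! ### The discrete nonlinear Schrödinger flow -/

section Flow

variable {H : EllTwo ι →L[ℂ] EllTwo ι} (hH : ∀ f g, inner ℂ (H f) g = inner ℂ f (H g))

/-- The vector field of the discrete nonlinear Schrödinger equation. -/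
noncomputable def dnlsField (H : EllTwo ι →L[ℂ] EllTwo ι) (p : ℝ) (f : EllTwo ι) : EllTwo ι :=
  -(Complex.I • (H f + nl p f))

theorem dnlsField_sub_le (hp : 0 ≤ p) {R : ℝ} {f g : EllTwo ι} (hf : ‖f‖ ≤ R) (hg : ‖g‖ ≤ R) :
    ‖dnlsField H p f - dnlsField H p g‖ ≤ (‖H‖ + (p + 2) * R ^ p) * ‖f - g‖ := by
  have e : dnlsField H p f - dnlsField H p g
      = -(Complex.I • (H (f - g) + (nl p f - nl p g))) := by
    simp only [dnlsField, map_sub, smul_add, smul_sub]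
    abel
  rw [e, norm_neg, norm_smul, Complex.norm_I, one_mul, add_mul]
  exact (norm_add_le _ _).trans (add_le_add (H.le_opNorm _) (nl_sub_le hp hf hg))

include hH

theorem im_inner_symm_self (f : EllTwo ι) : (inner ℂ f (H f)).im = 0 := by
  have h := inner_conj_symm (𝕜 := ℂ) f (H f)
  rw [hH] at h
  exact Complex.conj_eq_iff_im.1 h

theorem real_inner_dnlsField (hp : 0 ≤ p) (f : EllTwo ι) : inner ℝ f (dnlsField H p f) = 0 := by
  rw [real_inner_eq, dnlsField, inner_neg_right, Complex.neg_re, re_inner_I_smul, inner_add_right,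
    Complex.add_im, im_inner_symm_self hH, im_inner_nl hp]
  simp

omit hH in
-- The vector field is −i times `H f + nl p f`, half the gradient of the energy, hence orthogonal to
-- it in the real inner product.
theorem real_inner_field_gradient (f : EllTwo ι) :
    inner ℝ (H f + nl p f) (dnlsField H p f) = 0 := by
  rw [real_inner_eq, dnlsField, inner_neg_right, Complex.neg_re, re_inner_I_smul, neg_neg]
  exact inner_self_im (𝕜 := ℂ) _

/-- The mass is conserved. -/
theorem norm_eq_of_hasDerivAt (hp : 0 ≤ p) {Ψ : ℝ → EllTwo ι}
    (hΨ : ∀ t, HasDerivAt Ψ (dnlsField H p (Ψ t)) t) (t : ℝ) : ‖Ψ t‖ = ‖Ψ 0‖ := by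
  have h : ∀ t, HasDerivAt (fun t => ‖Ψ t‖ ^ 2) 0 t := by
    intro t
    refine (hΨ t).norm_sq.congr_deriv ?_
    rw [real_inner_dnlsField hH hp, mul_zero]
  have := is_const_of_deriv_eq_zero (fun t => (h t).differentiableAt) (fun t => (h t).deriv) t 0
  exact (pow_left_inj₀ (norm_nonneg _) (norm_nonneg _) two_ne_zero).1 this

/-- The energy functional. -/
noncomputable def energy (H : EllTwo ι →L[ℂ] EllTwo ι) (p : ℝ) (f : EllTwo ι) : ℝ :=
  (inner ℂ f (H f)).re + 2 / (p + 2) * potential p f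

omit hH in
theorem continuous_energy (hp : 0 ≤ p) : Continuous (energy H p) := by
  have h1 : Continuous fun f : EllTwo ι => (inner ℂ f (H f)).re :=
    Complex.continuous_re.comp (continuous_id.inner H.continuous)
  have h2 : Continuous (potential (ι := ι) p) :=
    continuous_iff_continuousAt.2 fun f => (hasFDerivAt_potential hp f).continuousAt
  exact h1.add (h2.const_smul (2 / (p + 2)))

/-- The energy is conserved. -/
theorem energy_eq_of_hasDerivAt (hp : 0 ≤ p) {Ψ : ℝ → EllTwo ι}
    (hΨ : ∀ t, HasDerivAt Ψ (dnlsField H p (Ψ t)) t) (t : ℝ) :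
    energy H p (Ψ t) = energy H p (Ψ 0) := by
  have h : ∀ t, HasDerivAt (fun t => energy H p (Ψ t)) 0 t := by
    intro t
    have h1 : HasDerivAt (fun t => (inner ℂ (Ψ t) (H (Ψ t))).re)
        (2 * inner ℝ (H (Ψ t)) (dnlsField H p (Ψ t))) t := by
      have h2 := (hΨ t).inner ℝ ((H.restrictScalars ℝ).hasFDerivAt.comp_hasDerivAt t (hΨ t))
      refine (h2.congr_deriv ?_).congr_of_eventuallyEq (.of_forall fun s => ?_)
      · simp only [Function.comp_apply, ContinuousLinearMap.coe_restrictScalars']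
        rw [real_inner_eq, real_inner_eq, real_inner_eq, ← hH, re_inner_symm (dnlsField H p (Ψ t))]
        ring
      · simp [real_inner_eq]
    have h3 := (hasFDerivAt_potential hp (Ψ t)).comp_hasDerivAt t (hΨ t)
    refine (h1.add (h3.const_mul (2 / (p + 2)))).congr_deriv ?_
    have h4 := real_inner_field_gradient (H := H) (p := p) (Ψ t)
    rw [inner_add_left] at h4
    have hp2 : p + 2 ≠ 0 := by positivity
    simp only [FunLike.coe_smul, Pi.smul_apply, innerSL_apply_apply, smul_eq_mul]
    field_simp
    linarith
  exact is_const_of_deriv_eq_zero (fun t => (h t).differentiableAt) (fun t => (h t).deriv) t 0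

/-- The discrete nonlinear Schrödinger equation is globally well posed. -/
theorem exists_global_solution (hp : 0 ≤ p) (f₀ : EllTwo ι) :
    ∃ Ψ : ℝ → EllTwo ι, Ψ 0 = f₀ ∧ ∀ t, HasDerivAt Ψ (dnlsField H p (Ψ t)) t := by
  set R : ℝ := ‖f₀‖ + 1 with hR
  have hR0 : 0 < R := by positivity
  -- The field is cut off beyond radius `‖f₀‖ + 1`, which makes it bounded and globally Lipschitz.
  set F : EllTwo ι → EllTwo ι := fun f => dnlsField H p (radialRetraction R f) with hF
  have hLip : LipschitzWith (2 * (‖H‖ + (p + 2) * R ^ p)).toNNReal F := by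
    refine LipschitzWith.of_dist_le_mul fun f g => ?_
    rw [Real.coe_toNNReal _ (by positivity), dist_eq_norm, dist_eq_norm]
    refine (dnlsField_sub_le hp (norm_radialRetraction_le hR0 f)
      (norm_radialRetraction_le hR0 g)).trans ?_
    have := radialRetraction_lipschitz hR0 f g
    calc _ ≤ (‖H‖ + (p + 2) * R ^ p) * (2 * ‖f - g‖) := by gcongr
      _ = _ := by ring
  have hbd : ∀ f, ‖F f‖ ≤ ‖H‖ * R + R ^ p * R := by
    intro f
    have h1 := norm_radialRetraction_le hR0 f
    simp only [hF, dnlsField]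
    rw [norm_neg, norm_smul, Complex.norm_I, one_mul]
    refine (norm_add_le _ _).trans (add_le_add ?_ ?_)
    · exact (H.le_opNorm _).trans (by gcongr)
    · exact (norm_nl_le hp _).trans (by gcongr)
  obtain ⟨Ψ, h0, hΨ⟩ := exists_global_solution_of_lipschitz_of_bounded hLip hbd f₀
  -- The retraction of `Ψ t` is a positive multiple of `Ψ t`, so the truncated field is still
  -- orthogonal to `Ψ t`. The norm is conserved and the cutoff is never active.
  have hnorm : ∀ t, ‖Ψ t‖ = ‖f₀‖ := by
    have h : ∀ t, HasDerivAt (fun t => ‖Ψ t‖ ^ 2) 0 t := by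
      intro t
      refine (hΨ t).norm_sq.congr_deriv ?_
      have h1 := real_inner_dnlsField hH hp (radialRetraction R (Ψ t))
      rw [radialRetraction, real_inner_smul_left] at h1
      have h2 : R / max R ‖Ψ t‖ ≠ 0 := (div_pos hR0 (lt_max_of_lt_left hR0)).ne'
      have h3 := (mul_eq_zero.1 h1).resolve_left h2
      rw [mul_eq_zero]
      exact Or.inr h3
    intro t
    have := is_const_of_deriv_eq_zero (fun t => (h t).differentiableAt) (fun t => (h t).deriv) t 0
    rw [← h0]
    exact (pow_left_inj₀ (norm_nonneg _) (norm_nonneg _) two_ne_zero).1 this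
  refine ⟨Ψ, h0, fun t => ?_⟩
  have := hΨ t
  simp only [hF] at this
  rwa [radialRetraction_of_norm_le hR0 (by rw [hnorm]; linarith)] at this

end Flow

end EllTwo

namespace EllTwo

variable {ι : Type*}

/-! ### Restriction to a finite set -/

section Restrict

variable [DecidableEq ι] (C : Finset ι)

/-- Restriction of a wave function to a finite set of sites. -/
noncomputable def restrict : EllTwo ι →L[ℂ] EllTwo ι :=
  ∑ x ∈ C, (lp.singleContinuousLinearMap ℂ (fun _ : ι => ℂ) 2 x).comp
    (lp.evalCLM ℂ (fun _ : ι => ℂ) 2 x)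

theorem restrict_apply (f : EllTwo ι) (x : ι) : restrict C f x = if x ∈ C then f x else 0 := by
  have : restrict C f = ∑ y ∈ C, lp.single 2 y (f y) := by
    simp only [restrict, sum_apply]
    rfl
  rw [this, lp.coeFn_sum, Finset.sum_apply]
  simp [lp.single_apply, Pi.single_apply]

theorem restrict_symm (f g : EllTwo ι) : inner ℂ (restrict C f) g = inner ℂ f (restrict C g) := by
  rw [lp.inner_eq_tsum, lp.inner_eq_tsum]
  congr 1 with x
  rw [restrict_apply, restrict_apply]
  split_ifs <;> simp

theorem restrict_restrict (f : EllTwo ι) : restrict C (restrict C f) = restrict C f := by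
  ext x
  rw [restrict_apply, restrict_apply]
  split_ifs <;> rfl

theorem re_inner_restrict (f : EllTwo ι) : (inner ℂ f (restrict C f)).re = ‖restrict C f‖ ^ 2 := by
  rw [← re_inner_self, restrict_symm, restrict_restrict]

theorem hasSum_restrict (f : EllTwo ι) :
    HasSum (fun x => if x ∈ C then ‖f x‖ ^ 2 else 0) (‖restrict C f‖ ^ 2) := by
  convert hasSum_norm_sq (restrict C f) using 2 with x
  rw [restrict_apply]
  split_ifs <;> simp

end Restrict

/-! ### Pointwise lower bounds for the Lyapunov functional -/

/-- In the increment q = |a + w|² − ρ the linear terms cancel, leaving −σρ^(σ−1)q²/2 up to a cubic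
error. As q = 2a Re w + |w|², only the real part of `w` appears at second order. -/
theorem exists_pointwise_lower_bound_on {σ ρ : ℝ} (hσ : 0 < σ) (hρ : 0 < ρ) {η : ℝ} (hη : 0 < η) :
    ∃ r > 0, ∀ a : ℝ, a ^ 2 = ρ → ∀ w : ℂ, ‖w‖ ≤ r →
      -(2 * σ * ρ ^ σ * w.re ^ 2) - η * ‖w‖ ^ 2 ≤
        ρ ^ σ * (‖(a : ℂ) + w‖ ^ 2 - ρ)
          - (‖(a : ℂ) + w‖ ^ (2 * σ + 2) - ρ ^ (σ + 1)) / (σ + 1) := by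
  obtain ⟨C, hC, r, hr, h⟩ := exists_taylor_rpow_bound_cubic hσ hρ
  set b := √ρ with hb
  have hb0 : 0 < b := Real.sqrt_pos.2 hρ
  set D : ℝ := σ * ρ ^ (σ - 1) / 2 with hD
  have hD0 : 0 < D := by positivity
  set K : ℝ := D * (4 * b + 1) + C * (2 * b + 1) ^ 3 with hK
  have hK0 : 0 < K := by positivity
  refine ⟨min (min 1 (η / K)) (r / (2 * b + 1)), by positivity, fun a ha w hw => ?_⟩
  have hw1 : ‖w‖ ≤ 1 := hw.trans ((min_le_left _ _).trans (min_le_left _ _))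
  have hw3 : K * ‖w‖ ≤ η := by
    have := hw.trans ((min_le_left _ _).trans (min_le_right _ _))
    rwa [le_div_iff₀ hK0, mul_comm] at this
  have hw2 : (2 * b + 1) * ‖w‖ ≤ r := by
    have := hw.trans (min_le_right _ _)
    rwa [le_div_iff₀ (by positivity), mul_comm] at this
  have hn0 := norm_nonneg w
  have hab : |a| = b := by rw [hb, ← ha, Real.sqrt_sq_eq_abs]
  have h1 : |a * w.re| ≤ b * ‖w‖ := by
    rw [abs_mul, hab]
    exact mul_le_mul_of_nonneg_left (Complex.abs_re_le_norm w) hb0.le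
  set q : ℝ := 2 * a * w.re + ‖w‖ ^ 2 with hq
  have hqw : |q| ≤ (2 * b + 1) * ‖w‖ := by
    have h2 : ‖w‖ ^ 2 ≤ ‖w‖ := by nlinarith
    rw [abs_le] at h1 ⊢
    constructor <;> nlinarith
  have hn : ‖(a : ℂ) + w‖ ^ 2 = ρ + q := by
    rw [← ha, hq, Complex.sq_norm, Complex.sq_norm, Complex.normSq_apply, Complex.normSq_apply]
    simp
    ring
  have hpow : ‖(a : ℂ) + w‖ ^ (2 * σ + 2) = (ρ + q) ^ (σ + 1) := by
    rw [show 2 * σ + 2 = 2 * (σ + 1) by ring, Real.rpow_mul (norm_nonneg _), Real.rpow_two, hn]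
  have hκ : ρ ^ σ = ρ ^ (σ - 1) * a ^ 2 := by
    rw [ha, Real.rpow_sub_one hρ.ne', div_mul_cancel₀ _ hρ.ne']
  have ht := (abs_le.1 (h q (hqw.trans hw2))).2
  have hq3 : |q| ^ 3 ≤ (2 * b + 1) ^ 3 * (‖w‖ * ‖w‖ ^ 2) := by
    calc |q| ^ 3 ≤ ((2 * b + 1) * ‖w‖) ^ 3 := by gcongr
      _ = _ := by ring
  have hq2 : q ^ 2 ≤ 4 * a ^ 2 * w.re ^ 2 + (4 * b + 1) * (‖w‖ * ‖w‖ ^ 2) := by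
    have e : q ^ 2 = 4 * a ^ 2 * w.re ^ 2 + 4 * (a * w.re) * ‖w‖ ^ 2 + ‖w‖ * (‖w‖ * ‖w‖ ^ 2) := by
      rw [hq]; ring
    have h2 : (a * w.re) * ‖w‖ ^ 2 ≤ b * ‖w‖ * ‖w‖ ^ 2 :=
      mul_le_mul_of_nonneg_right ((le_abs_self _).trans h1) (by positivity)
    have h3 : ‖w‖ * (‖w‖ * ‖w‖ ^ 2) ≤ 1 * (‖w‖ * ‖w‖ ^ 2) :=
      mul_le_mul_of_nonneg_right hw1 (by positivity)
    rw [e]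
    linarith
  have hs1 : 0 < σ + 1 := by linarith
  rw [hn, hpow, add_sub_cancel_left]
  have hdiv : ((ρ + q) ^ (σ + 1) - ρ ^ (σ + 1)) / (σ + 1)
      ≤ ρ ^ σ * q + D * q ^ 2 + C * |q| ^ 3 := by
    rw [div_le_iff₀ hs1]
    have h4 : 0 ≤ σ * (C * |q| ^ 3) := by positivity
    have e : (ρ ^ σ * q + D * q ^ 2 + C * |q| ^ 3) * (σ + 1)
        = (σ + 1) * ρ ^ σ * q + (σ + 1) * σ * ρ ^ (σ - 1) * q ^ 2 / 2 + C * |q| ^ 3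
          + σ * (C * |q| ^ 3) := by
      rw [hD]; ring
    rw [e]
    linarith
  have h5 := mul_le_mul_of_nonneg_left hq2 hD0.le
  have h6 := mul_le_mul_of_nonneg_left hq3 hC
  have h7 := mul_le_mul_of_nonneg_right hw3 (by positivity : 0 ≤ ‖w‖ ^ 2)
  have e1 : D * (4 * a ^ 2 * w.re ^ 2) = 2 * σ * ρ ^ σ * w.re ^ 2 := by
    rw [hκ, hD]; ring
  have e2 : K * ‖w‖ * ‖w‖ ^ 2 = D * ((4 * b + 1) * (‖w‖ * ‖w‖ ^ 2))
      + C * ((2 * b + 1) ^ 3 * (‖w‖ * ‖w‖ ^ 2)) := by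
    rw [hK]; ring
  linarith

/-- Off the support the nonlinear term has order 2σ + 2 > 2; the radius is where ‖w‖^(2σ) reaches `η
(σ + 1)`. -/
theorem exists_pointwise_lower_bound_off {σ : ℝ} (hσ : 0 < σ) (κ : ℝ) {η : ℝ} (hη : 0 < η) :
    ∃ r > 0, ∀ w : ℂ, ‖w‖ ≤ r →
      (κ - η) * ‖w‖ ^ 2 ≤ κ * ‖w‖ ^ 2 - ‖w‖ ^ (2 * σ + 2) / (σ + 1) := by
  refine ⟨(η * (σ + 1)) ^ (1 / (2 * σ)), by positivity, fun w hw => ?_⟩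
  have h1 : ‖w‖ ^ (2 * σ) ≤ η * (σ + 1) := by
    have := Real.rpow_le_rpow (norm_nonneg w) hw (by positivity : 0 ≤ 2 * σ)
    rwa [← Real.rpow_mul (by positivity), one_div_mul_cancel (by positivity), Real.rpow_one] at this
  have h2 : ‖w‖ ^ (2 * σ + 2) / (σ + 1) ≤ η * ‖w‖ ^ 2 := by
    rw [div_le_iff₀ (by positivity), Real.rpow_add_of_nonneg (norm_nonneg _) (by positivity)
      (by norm_num), Real.rpow_two]
    have := mul_le_mul_of_nonneg_right h1 (by positivity : 0 ≤ ‖w‖ ^ 2)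
    linarith
  linarith

end EllTwo

namespace EllTwo

variable {ι : Type*}

/-! ### The orbit of a state -/

/-- The circle `{z ψ : |z| = 1}`. -/
def phaseCircle (ψ : EllTwo ι) : Set (EllTwo ι) := (fun z : ℂ => z • ψ) '' {z | ‖z‖ = 1}

theorem mem_phaseCircle_self (ψ : EllTwo ι) : ψ ∈ phaseCircle ψ := ⟨1, by simp, one_smul _ _⟩

theorem norm_sub_phase (ψ f : EllTwo ι) {z : ℂ} (hz : ‖z‖ = 1) :
    ‖(starRingEnd ℂ) z • f - ψ‖ = ‖f - z • ψ‖ := by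
  have h1 : z * (starRingEnd ℂ) z = 1 := by rw [Complex.mul_conj']; simp [hz]
  have : f - z • ψ = z • ((starRingEnd ℂ) z • f - ψ) := by
    rw [smul_sub, smul_smul, h1, one_smul]
  rw [this, norm_smul, hz, one_mul]

theorem exists_phase_of_infDist_lt {ψ f : EllTwo ι} {δ : ℝ}
    (h : Metric.infDist f (phaseCircle ψ) < δ) : ∃ z : ℂ, ‖z‖ = 1 ∧ ‖z • f - ψ‖ < δ := by
  obtain ⟨_, ⟨z, hz, rfl⟩, hlt⟩ := (Metric.infDist_lt_iff ⟨ψ, mem_phaseCircle_self ψ⟩).1 h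
  refine ⟨(starRingEnd ℂ) z, by simpa using hz, ?_⟩
  rw [norm_sub_phase ψ f hz]
  rwa [dist_eq_norm] at hlt

theorem infDist_le_norm_sub (ψ f : EllTwo ι) {z : ℂ} (hz : ‖z‖ = 1) :
    Metric.infDist f (phaseCircle ψ) ≤ ‖z • f - ψ‖ := by
  have h2 := norm_sub_phase ψ f (z := (starRingEnd ℂ) z) (by simpa using hz)
  rw [Complex.conj_conj] at h2
  rw [h2, ← dist_eq_norm]
  exact Metric.infDist_le_dist_of_mem ⟨(starRingEnd ℂ) z, by simpa using hz, rfl⟩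

/-- The nearest phase makes the inner product with `ψ` real and nonnegative. Its vanishing imaginary
part removes the neutral direction iψ. -/
theorem exists_optimal_phase (ψ f : EllTwo ι) :
    ∃ z : ℂ, ‖z‖ = 1 ∧ (inner ℂ ψ (z • f)).im = 0 ∧
      ‖z • f - ψ‖ = Metric.infDist f (phaseCircle ψ) := by
  obtain ⟨z, hz, hzp⟩ : ∃ z : ℂ, ‖z‖ = 1 ∧ z * inner ℂ ψ f = (‖inner ℂ ψ f‖ : ℂ) := by
    by_cases hp : inner ℂ ψ f = 0
    · exact ⟨1, by simp, by simp [hp]⟩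
    · have hn : ‖inner ℂ ψ f‖ ≠ 0 := norm_ne_zero_iff.2 hp
      refine ⟨(starRingEnd ℂ) (inner ℂ ψ f) / ‖inner ℂ ψ f‖, ?_, ?_⟩
      · rw [norm_div, RCLike.norm_conj, Complex.norm_real, norm_norm, div_self hn]
      · rw [div_mul_eq_mul_div, Complex.conj_mul', sq, mul_div_assoc, div_self (by exact_mod_cast hn),
          mul_one]
  have hin : inner ℂ ψ (z • f) = (‖inner ℂ ψ f‖ : ℂ) := by rw [inner_smul_right, hzp]
  refine ⟨z, hz, by rw [hin, Complex.ofReal_im], le_antisymm ?_ (infDist_le_norm_sub ψ f hz)⟩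
  refine (Metric.le_infDist ⟨ψ, mem_phaseCircle_self ψ⟩).2 ?_
  rintro _ ⟨z', hz', rfl⟩
  rw [dist_eq_norm]
  refine le_of_sq_le_sq ?_ (norm_nonneg _)
  have e1 := norm_sub_sq (𝕜 := ℂ) (z • f) ψ
  have e2 := norm_sub_sq (𝕜 := ℂ) f (z' • ψ)
  rw [norm_smul, hz, one_mul, inner_re_symm (𝕜 := ℂ), hin] at e1
  rw [norm_smul, hz', one_mul] at e2
  have h3 : RCLike.re (inner ℂ f (z' • ψ)) ≤ ‖inner ℂ ψ f‖ := by
    refine (RCLike.re_le_norm _).trans ?_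
    rw [inner_smul_right, norm_mul, hz', one_mul, norm_inner_symm]
  have e3 : RCLike.re (‖inner ℂ ψ f‖ : ℂ) = ‖inner ℂ ψ f‖ := Complex.ofReal_re _
  rw [e3] at e1
  linarith

/-! ### Orbital stability -/

variable [DecidableEq ι]

/-- A real standing wave of constant modulus `√ρ` on a finite set `C`, in the kernel of `A`. -/
structure IsCompactSoliton (A : EllTwo ι →L[ℂ] EllTwo ι) (C : Finset ι) (ρ : ℝ) (a : ι → ℝ)
    (ψ : EllTwo ι) : Prop where
  apply_eq : ∀ x, ψ x = (a x : ℂ)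
  sq_eq : ∀ x ∈ C, a x ^ 2 = ρ
  eq_zero : ∀ x ∉ C, a x = 0
  map_eq_zero : A ψ = 0
  ne_zero : ψ ≠ 0
  pos : 0 < ρ

variable {A : EllTwo ι →L[ℂ] EllTwo ι} {C : Finset ι} {ρ : ℝ} {a : ι → ℝ} {ψ : EllTwo ι}

theorem IsCompactSoliton.restrict_eq (hψ : IsCompactSoliton A C ρ a ψ) : restrict C ψ = ψ := by
  ext x
  rw [restrict_apply]
  split_ifs with h
  · rfl
  · rw [hψ.apply_eq, hψ.eq_zero x h, Complex.ofReal_zero]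

omit [DecidableEq ι] in
theorem IsCompactSoliton.sum_mul_re (hψ : IsCompactSoliton A C ρ a ψ) (f : EllTwo ι) :
    HasSum (fun x => a x * (f x).re) (inner ℂ ψ f).re := by
  rw [← real_inner_eq]
  convert hasSum_real_inner ψ f using 2 with x
  rw [hψ.apply_eq, Complex.inner]
  simp [mul_comm]

/-- The Lyapunov functional. -/
noncomputable def lyapunov (A : EllTwo ι →L[ℂ] EllTwo ι) (E σ κ M ν : ℝ) (f : EllTwo ι) : ℝ :=
  -energy ((E : ℂ) • ContinuousLinearMap.id ℂ _ - A) (2 * σ) f + (E + κ) * ‖f‖ ^ 2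
    + M * (‖f‖ ^ 2 - ν) ^ 2

omit [DecidableEq ι] in
theorem lyapunov_eq (E : ℝ) {σ : ℝ} (κ M ν : ℝ) (f : EllTwo ι) :
    lyapunov A E σ κ M ν f = (inner ℂ f (A f)).re
      + (κ * ‖f‖ ^ 2 - potential (2 * σ) f / (σ + 1)) + M * (‖f‖ ^ 2 - ν) ^ 2 := by
  rw [lyapunov, energy]
  simp only [sub_apply, FunLike.coe_smul, Pi.smul_apply,
    ContinuousLinearMap.coe_id', id_eq, inner_sub_right, inner_smul_right, Complex.sub_re,
    Complex.re_ofReal_mul, re_inner_self]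
  have : 2 / (2 * σ + 2) * potential (2 * σ) f = potential (2 * σ) f / (σ + 1) := by
    rw [show 2 * σ + 2 = 2 * (σ + 1) by ring, div_mul_eq_mul_div, mul_div_mul_left _ _ two_ne_zero]
  rw [this]
  ring

omit [DecidableEq ι] in
theorem continuous_lyapunov {E σ κ M ν : ℝ} (hσ : 0 < σ) :
    Continuous (lyapunov A E σ κ M ν) := by
  have := continuous_energy (H := (E : ℂ) • ContinuousLinearMap.id ℂ _ - A)
    (by positivity : 0 ≤ 2 * σ)
  unfold lyapunov
  fun_prop

omit [DecidableEq ι] in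
theorem lyapunov_smul {E σ κ M ν : ℝ} {z : ℂ} (hz : ‖z‖ = 1) (f : EllTwo ι) :
    lyapunov A E σ κ M ν (z • f) = lyapunov A E σ κ M ν f := by
  rw [lyapunov_eq, lyapunov_eq]
  have e1 : inner ℂ (z • f) (A (z • f)) = inner ℂ f (A f) := by
    rw [map_smul, inner_smul_left, inner_smul_right, ← mul_assoc, Complex.conj_mul', hz]
    simp
  have e2 : potential (2 * σ) (z • f) = potential (2 * σ) f := by
    simp [potential, hz]
  rw [e1, e2, norm_smul, hz, one_mul]

/-- The second variation is that of `A + κ - κχ` minus 2σκ times the squared real part on `C`. On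
the complement of `ψ`, `hcoer` makes it positive; along iψ the phase condition leaves nothing; along
`ψ` it is negative, and the mass penalty compensates. -/
theorem exists_lyapunov_lower_bound (hA : IsNonnegSymm A) (hψ : IsCompactSoliton A C ρ a ψ)
    {σ : ℝ} (hσ : 0 < σ) {m : ℝ} (hm : (2 * σ + 1) * ρ ^ σ * m < 1)
    (hcoer : ∀ ξ, inner ℂ ψ ξ = 0 →
      ‖restrict C ξ‖ ^ 2 ≤ m * (inner ℂ ξ (shifted A (ρ ^ σ) ξ)).re) (E : ℝ) :
    ∃ M : ℝ, ∃ c > 0, ∃ r > 0, ∀ f, (inner ℂ ψ f).im = 0 → ‖f - ψ‖ ≤ r →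
      c * ‖f - ψ‖ ^ 2 ≤ lyapunov A E σ (ρ ^ σ) M (‖ψ‖ ^ 2) f
        - lyapunov A E σ (ρ ^ σ) M (‖ψ‖ ^ 2) ψ := by
  have hρ := hψ.pos
  set κ := ρ ^ σ with hκ
  have hκ0 : 0 < κ := by positivity
  set ν := ‖ψ‖ ^ 2 with hν
  have hψn : 0 < ‖ψ‖ := norm_pos_iff.2 hψ.ne_zero
  have hν0 : 0 < ν := by positivity
  set c₀ : ℝ := (1 - (2 * σ + 1) * κ * m) * κ with hc₀
  have hc₀0 : 0 < c₀ := mul_pos (by linarith) hκ0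
  -- For ξ = τψ + ζ the penalty contributes 4Mν²τ² at leading order. This choice cancels the −2σκντ²
  -- of the second variation and leaves `c₀ ν τ²`.
  set M : ℝ := (2 * σ * κ + c₀) / (4 * ν) with hM
  have hM0 : 0 < M := by positivity
  have hMν : 4 * M * ν ^ 2 = (2 * σ * κ + c₀) * ν := by rw [hM]; field_simp
  -- The error `η ‖ξ‖²` is spent twice, in the pointwise bounds and in the mass penalty, leaving the
  -- constant `c₀ / 2`.
  set η : ℝ := c₀ / 4 with hη
  have hη0 : 0 < η := by positivity
  obtain ⟨r₁, hr₁, hon⟩ := exists_pointwise_lower_bound_on hσ hρ hη0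
  obtain ⟨r₂, hr₂, hoff⟩ := exists_pointwise_lower_bound_off hσ κ hη0
  refine ⟨M, c₀ / 2, by positivity, min (min r₁ r₂) (c₀ / (16 * M * ‖ψ‖)), by positivity,
    fun f hf hfr => ?_⟩
  obtain ⟨ξ, hξ⟩ : ∃ ξ, ξ = f - ψ := ⟨_, rfl⟩
  have hfξ : f = ψ + ξ := by rw [hξ]; abel
  rw [← hξ] at hfr ⊢
  have hξ1 : ‖ξ‖ ≤ r₁ := hfr.trans ((min_le_left _ _).trans (min_le_left _ _))
  have hξ2 : ‖ξ‖ ≤ r₂ := hfr.trans ((min_le_left _ _).trans (min_le_right _ _))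
  have hξ3 : 16 * M * ‖ψ‖ * ‖ξ‖ ≤ c₀ := by
    have := hfr.trans (min_le_right _ _)
    rwa [le_div_iff₀ (by positivity), mul_comm] at this
  have him : (inner ℂ ψ ξ).im = 0 := by
    rw [hξ, inner_sub_right, Complex.sub_im, hf]
    have : (inner ℂ ψ ψ).im = 0 := inner_self_im (𝕜 := ℂ) ψ
    rw [this, sub_zero]
  -- splitting off the component along `ψ`
  set τ : ℝ := (inner ℂ ψ ξ).re / ν with hτ
  have hτν : (inner ℂ ψ ξ).re = τ * ν := by rw [hτ, div_mul_cancel₀ _ hν0.ne']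
  have hψψ : inner ℂ ψ ψ = (ν : ℂ) := by
    rw [inner_self_eq_norm_sq_to_K, hν]
    simp
  obtain ⟨ζ, hζ⟩ : ∃ ζ, ζ = ξ - (τ : ℂ) • ψ := ⟨_, rfl⟩
  have hξζ : ξ = (τ : ℂ) • ψ + ζ := by rw [hζ]; abel
  have horth : inner ℂ ψ ζ = 0 := by
    rw [hζ, inner_sub_right, inner_smul_right, hψψ]
    apply Complex.ext <;> simp [hτν, him]
  have horth' : inner ℂ ζ ψ = 0 := by rw [← inner_conj_symm, horth, map_zero]
  have hχζ : inner ℂ ψ (restrict C ζ) = 0 := by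
    rw [← restrict_symm, hψ.restrict_eq, horth]
  have hnξ : ‖ξ‖ ^ 2 = τ ^ 2 * ν + ‖ζ‖ ^ 2 := by
    rw [hξζ, ← re_inner_self, inner_add_left, inner_add_right, inner_add_right, inner_smul_left,
      inner_smul_left, inner_smul_right, inner_smul_right, horth, horth', hψψ]
    simp only [Complex.conj_ofReal, mul_zero, add_zero, zero_add, Complex.add_re, re_inner_self]
    rw [← Complex.ofReal_mul, ← Complex.ofReal_mul, Complex.ofReal_re]
    ring
  have hnχξ : ‖restrict C ξ‖ ^ 2 = τ ^ 2 * ν + ‖restrict C ζ‖ ^ 2 := by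
    have h' : inner ℂ (restrict C ζ) ψ = 0 := by rw [← inner_conj_symm, hχζ, map_zero]
    rw [hξζ, map_add, map_smul, hψ.restrict_eq, ← re_inner_self, inner_add_left, inner_add_right,
      inner_add_right, inner_smul_left, inner_smul_left, inner_smul_right, inner_smul_right, hχζ,
      h', hψψ]
    simp only [Complex.conj_ofReal, mul_zero, add_zero, zero_add, Complex.add_re, re_inner_self]
    rw [← Complex.ofReal_mul, ← Complex.ofReal_mul, Complex.ofReal_re]
    ring
  have hAξ : (inner ℂ ξ (A ξ)).re = (inner ℂ ζ (A ζ)).re := by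
    have e1 : A ξ = A ζ := by rw [hξζ, map_add, map_smul, hψ.map_eq_zero, smul_zero, zero_add]
    rw [e1, ← hA.symm, e1, hA.symm]
  have hAf : (inner ℂ f (A f)).re = (inner ℂ ξ (A ξ)).re := by
    have e1 : A f = A ξ := by rw [hfξ, map_add, hψ.map_eq_zero, zero_add]
    rw [e1, ← hA.symm, e1, hA.symm]
  -- the real parts on `C`
  have hreC : ∑ x ∈ C, (ξ x).re ^ 2 ≤ τ ^ 2 * ν + ‖restrict C ζ‖ ^ 2 := by
    have e1 : ∀ x, (ξ x).re = τ * a x + (ζ x).re := by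
      intro x
      rw [hξζ, lp.coeFn_add, lp.coeFn_smul, Pi.add_apply, Pi.smul_apply, hψ.apply_eq]
      simp
    have e2 : ∑ x ∈ C, a x * (ζ x).re = 0 := by
      have h1 := hψ.sum_mul_re ζ
      rw [horth, Complex.zero_re] at h1
      refine HasSum.unique (hasSum_sum_of_ne_finset_zero (f := fun x => a x * (ζ x).re)
        fun x hx => ?_) h1
      rw [hψ.eq_zero x hx, zero_mul]
    have e3 : ∑ x ∈ C, a x * a x = ν := by
      have h1 := hψ.sum_mul_re ψ
      rw [hψψ, Complex.ofReal_re] at h1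
      have h2 : HasSum (fun x => a x * a x) ν := by simpa [hψ.apply_eq] using h1
      refine HasSum.unique (hasSum_sum_of_ne_finset_zero (f := fun x => a x * a x)
        fun x hx => ?_) h2
      rw [hψ.eq_zero x hx, zero_mul]
    have e4 : ∑ x ∈ C, (ζ x).re ^ 2 ≤ ‖restrict C ζ‖ ^ 2 := by
      have h1 : ∑ x ∈ C, ‖restrict C ζ x‖ ^ 2 ≤ ‖restrict C ζ‖ ^ 2 :=
        sum_le_hasSum C (fun _ _ => sq_nonneg _) (hasSum_norm_sq (restrict C ζ))
      refine le_trans (Finset.sum_le_sum fun x hx => ?_) h1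
      rw [restrict_apply, if_pos hx, ← sq_abs]
      have := Complex.abs_re_le_norm (ζ x)
      gcongr
    calc ∑ x ∈ C, (ξ x).re ^ 2
        = ∑ x ∈ C, (τ ^ 2 * (a x * a x) + 2 * τ * (a x * (ζ x).re) + (ζ x).re ^ 2) := by
          refine Finset.sum_congr rfl fun x _ => ?_
          rw [e1]; ring
      _ = τ ^ 2 * ν + ∑ x ∈ C, (ζ x).re ^ 2 := by
          rw [Finset.sum_add_distrib, Finset.sum_add_distrib, ← Finset.mul_sum, ← Finset.mul_sum,
            e2, e3]
          ring
      _ ≤ _ := by linarith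
  -- summing the pointwise bounds
  have hsum : (κ - η) * ‖ξ‖ ^ 2 - κ * ‖restrict C ξ‖ ^ 2 - 2 * σ * κ * ∑ x ∈ C, (ξ x).re ^ 2
      ≤ (κ * ‖f‖ ^ 2 - potential (2 * σ) f / (σ + 1))
        - (κ * ‖ψ‖ ^ 2 - potential (2 * σ) ψ / (σ + 1)) := by
    have hp : 0 ≤ 2 * σ := by positivity
    have h1 := (((hasSum_norm_sq f).mul_left κ).sub ((hasSum_potential hp f).div_const (σ + 1))).sub
      (((hasSum_norm_sq ψ).mul_left κ).sub ((hasSum_potential hp ψ).div_const (σ + 1)))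
    have h2 : HasSum (fun x => if x ∈ C then (ξ x).re ^ 2 else 0) (∑ x ∈ C, (ξ x).re ^ 2) := by
      have : HasSum (fun x => if x ∈ C then (ξ x).re ^ 2 else 0)
          (∑ x ∈ C, if x ∈ C then (ξ x).re ^ 2 else 0) :=
        hasSum_sum_of_ne_finset_zero fun x hx => if_neg hx
      rwa [Finset.sum_congr rfl fun x hx => if_pos hx] at this
    have h3 := (((hasSum_norm_sq ξ).mul_left (κ - η)).sub ((hasSum_restrict C ξ).mul_left κ)).sub
      (h2.mul_left (2 * σ * κ))
    refine hasSum_le (fun x => ?_) h3 h1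
    have hfx : f x = (a x : ℂ) + ξ x := by
      rw [hfξ, lp.coeFn_add, Pi.add_apply, hψ.apply_eq]
    have hξx := norm_apply_le ξ x
    simp only [hfx, hψ.apply_eq]
    by_cases hx : x ∈ C
    · simp only [if_pos hx]
      have := hon (a x) (hψ.sq_eq x hx) (ξ x) (hξx.trans hξ1)
      have e1 : ‖(a x : ℂ)‖ ^ 2 = ρ := by
        rw [Complex.norm_real, Real.norm_eq_abs, sq_abs, hψ.sq_eq x hx]
      have e2 : ‖(a x : ℂ)‖ ^ (2 * σ + 2) = ρ ^ (σ + 1) := by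
        rw [show 2 * σ + 2 = 2 * (σ + 1) by ring, Real.rpow_mul (norm_nonneg _), Real.rpow_two, e1]
      rw [e1, e2]
      rw [sub_div] at this
      linarith
    · simp only [if_neg hx]
      have := hoff (ξ x) (hξx.trans hξ2)
      have e2 : (0 : ℝ) ^ (2 * σ + 2) = 0 := Real.zero_rpow (by positivity)
      simp only [hψ.eq_zero x hx, Complex.ofReal_zero, zero_add, norm_zero, e2, zero_div, mul_zero,
        ne_eq, OfNat.ofNat_ne_zero, not_false_eq_true, zero_pow, sub_zero]
      linarith
  -- the mass
  have hmass : ‖f‖ ^ 2 - ν = 2 * (τ * ν) + ‖ξ‖ ^ 2 := by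
    have := norm_add_sq (𝕜 := ℂ) ψ ξ
    rw [← hfξ] at this
    have h' : RCLike.re (inner ℂ ψ ξ) = τ * ν := hτν
    rw [h'] at this
    linarith
  have hMsq : (2 * σ * κ + c₀) * ν * τ ^ 2 - η * ‖ξ‖ ^ 2 ≤ M * (‖f‖ ^ 2 - ν) ^ 2 := by
    have h1 : |τ * ν| ≤ ‖ψ‖ * ‖ξ‖ := by
      rw [← hτν]
      exact (Complex.abs_re_le_norm _).trans (norm_inner_le_norm _ _)
    have h2 : -(‖ψ‖ * ‖ξ‖) * (4 * M * ‖ξ‖ ^ 2) ≤ τ * ν * (4 * M * ‖ξ‖ ^ 2) :=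
      mul_le_mul_of_nonneg_right (abs_le.1 h1).1 (by positivity)
    have h3 := mul_le_mul_of_nonneg_right hξ3 (by positivity : 0 ≤ ‖ξ‖ ^ 2)
    have h4 : 0 ≤ M * (‖ξ‖ ^ 2) ^ 2 := by positivity
    rw [hmass]
    have e : M * (2 * (τ * ν) + ‖ξ‖ ^ 2) ^ 2
        = 4 * M * ν ^ 2 * τ ^ 2 + τ * ν * (4 * M * ‖ξ‖ ^ 2) + M * (‖ξ‖ ^ 2) ^ 2 := by ring
    rw [e, hMν, hη]
    linarith
  -- coercivity
  have hco := hcoer ζ horth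
  have hB : (inner ℂ ζ (shifted A κ ζ)).re = (inner ℂ ζ (A ζ)).re + κ * ‖ζ‖ ^ 2 := by
    rw [shifted_apply, inner_add_right, inner_smul_right, Complex.add_re, Complex.re_ofReal_mul,
      re_inner_self]
  have hBge := hA.le_shifted κ ζ
  have hco2 : c₀ * ‖ζ‖ ^ 2 ≤ (inner ℂ ζ (shifted A κ ζ)).re
      - (2 * σ + 1) * κ * ‖restrict C ζ‖ ^ 2 := by
    have h1 := mul_le_mul_of_nonneg_left hco (by positivity : 0 ≤ (2 * σ + 1) * κ)
    have h2 := mul_le_mul_of_nonneg_left hBge (by linarith : 0 ≤ 1 - (2 * σ + 1) * κ * m)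
    rw [hc₀]
    linarith
  rw [lyapunov_eq, lyapunov_eq, hψ.map_eq_zero, inner_zero_right, Complex.zero_re, sub_self, hAf,
    hAξ]
  rw [hnχξ] at hsum
  have hre2 := mul_le_mul_of_nonneg_left hreC (by positivity : 0 ≤ 2 * σ * κ)
  rw [hB] at hco2
  have e1 : η * ‖ξ‖ ^ 2 = c₀ / 4 * ‖ξ‖ ^ 2 := by rw [hη]
  have e2 : c₀ * ‖ξ‖ ^ 2 = c₀ * (τ ^ 2 * ν) + c₀ * ‖ζ‖ ^ 2 := by rw [hnξ]; ring
  have e3 : κ * ‖ξ‖ ^ 2 = κ * (τ ^ 2 * ν) + κ * ‖ζ‖ ^ 2 := by rw [hnξ]; ring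
  linarith

/-- The Lyapunov functional is conserved, being built from energy and mass, and is at least `c ε'²`
above its value at `ψ` at distance `ε'` from the orbit. Trajectories starting with less excess
cannot cross that level. -/
theorem exists_stability_radius (hA : IsNonnegSymm A) (hψ : IsCompactSoliton A C ρ a ψ)
    {σ : ℝ} (hσ : 0 < σ) {m : ℝ} (hm : (2 * σ + 1) * ρ ^ σ * m < 1)
    (hcoer : ∀ ξ, inner ℂ ψ ξ = 0 →
      ‖restrict C ξ‖ ^ 2 ≤ m * (inner ℂ ξ (shifted A (ρ ^ σ) ξ)).re) {E : ℝ}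
    {H : EllTwo ι →L[ℂ] EllTwo ι} (hH : H = (E : ℂ) • ContinuousLinearMap.id ℂ _ - A)
    {ε : ℝ} (hε : 0 < ε) :
    ∃ δ > 0, ∀ Ψ : ℝ → EllTwo ι, (∀ t, HasDerivAt Ψ (dnlsField H (2 * σ) (Ψ t)) t) →
      Metric.infDist (Ψ 0) (phaseCircle ψ) < δ →
      ∀ t, Metric.infDist (Ψ t) (phaseCircle ψ) < ε := by
  have hp : 0 ≤ 2 * σ := by positivity
  have hHs : ∀ f g, inner ℂ (H f) g = inner ℂ f (H g) := by
    intro f g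
    simp only [hH, sub_apply, FunLike.coe_smul, Pi.smul_apply, ContinuousLinearMap.coe_id', id_eq,
      inner_sub_left, inner_sub_right, hA.symm, inner_smul_left, inner_smul_right,
      Complex.conj_ofReal]
  obtain ⟨M, c, hc, r, hr, hlow⟩ := exists_lyapunov_lower_bound hA hψ hσ hm hcoer E
  set F := lyapunov A E σ (ρ ^ σ) M (‖ψ‖ ^ 2) with hF
  set ε' := min ε r with hε'
  have hε'0 : 0 < ε' := by positivity
  obtain ⟨δ, hδ, hδF⟩ := Metric.continuous_iff.1 (continuous_lyapunov (A := A) (E := E)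
    (κ := ρ ^ σ) (M := M) (ν := ‖ψ‖ ^ 2) hσ) ψ (c * ε' ^ 2) (by positivity)
  refine ⟨min δ ε', by positivity, fun Ψ hΨ h0 t => ?_⟩
  have hconst : ∀ t, F (Ψ t) = F (Ψ 0) := by
    intro t
    have h1 := energy_eq_of_hasDerivAt hHs hp hΨ t
    rw [hH] at h1
    simp only [hF, lyapunov]
    rw [h1, norm_eq_of_hasDerivAt hHs hp hΨ t]
  have hΨ0 : F (Ψ 0) - F ψ < c * ε' ^ 2 := by
    obtain ⟨z, hz, hlt⟩ := exists_phase_of_infDist_lt (h0.trans_le (min_le_left _ _))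
    have h1 := hδF (z • Ψ 0) (by rwa [dist_eq_norm])
    rw [lyapunov_smul hz, Real.dist_eq] at h1
    exact (le_abs_self _).trans_lt h1
  by_contra hcon
  rw [not_lt] at hcon
  have hcont : Continuous fun t => Metric.infDist (Ψ t) (phaseCircle ψ) :=
    (Metric.continuous_infDist_pt _).comp
      (continuous_iff_continuousAt.2 fun t => (hΨ t).continuousAt)
  -- The lower bound is only local, so the contradiction is sought at a time when the distance
  -- equals `ε'` exactly.
  obtain ⟨t', ht'⟩ := mem_range_of_exists_le_of_exists_ge hcont
    ⟨0, (h0.trans_le (min_le_right _ _)).le⟩ ⟨t, (min_le_left ε r).trans hcon⟩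
  obtain ⟨z, hz, him, hdist⟩ := exists_optimal_phase ψ (Ψ t')
  have ht'' : Metric.infDist (Ψ t') (phaseCircle ψ) = ε' := ht'
  rw [ht''] at hdist
  have h2 := hlow (z • Ψ t') him (by rw [hdist]; exact min_le_right _ _)
  rw [hdist, hF, lyapunov_smul hz] at h2
  have h3 := hconst t'
  linarith

end EllTwo

namespace EllTwo

variable {ι : Type*}

/-! ### Real and imaginary parts -/

/-- The real part of a wave function. -/
noncomputable def reP : EllTwo ι →L[ℝ] EllTwo ι :=
  LinearMap.mkContinuous
    { toFun := fun f => ⟨fun x => ((f x).re : ℂ), memℓp_of_norm_le (g := f) (C := 1) fun x => by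
        rw [one_mul, Complex.norm_real]
        exact Complex.abs_re_le_norm _⟩
      map_add' := fun f g => by
        ext x
        change (((f + g : EllTwo ι) x).re : ℂ) = ((f x).re : ℂ) + ((g x).re : ℂ)
        rw [lp.coeFn_add, Pi.add_apply, Complex.add_re, Complex.ofReal_add]
      map_smul' := fun c f => by
        ext x
        change (((c • f : EllTwo ι) x).re : ℂ) = c • ((f x).re : ℂ)
        rw [lp.coeFn_smul, Pi.smul_apply, Complex.smul_re, Complex.real_smul, smul_eq_mul,
          Complex.ofReal_mul] } 1
    fun f => norm_le_of_forall_norm_le zero_le_one fun x => by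
      change ‖((f x).re : ℂ)‖ ≤ _
      rw [one_mul, Complex.norm_real]
      exact Complex.abs_re_le_norm _

theorem reP_apply (f : EllTwo ι) (x : ι) : reP f x = ((f x).re : ℂ) := rfl

/-- The imaginary part of a wave function. -/
noncomputable def imP (f : EllTwo ι) : EllTwo ι := reP (-(Complex.I • f))

theorem imP_apply (f : EllTwo ι) (x : ι) : imP f x = ((f x).im : ℂ) := by
  rw [imP, reP_apply, lp.coeFn_neg, Pi.neg_apply, lp.coeFn_smul, Pi.smul_apply]
  simp

theorem eq_reP_add_imP (f : EllTwo ι) : f = reP f + Complex.I • imP f := by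
  ext x
  rw [lp.coeFn_add, Pi.add_apply, lp.coeFn_smul, Pi.smul_apply, reP_apply, imP_apply, smul_eq_mul,
    mul_comm, Complex.re_add_im]

theorem norm_sq_eq_reP_imP (f : EllTwo ι) : ‖f‖ ^ 2 = ‖reP f‖ ^ 2 + ‖imP f‖ ^ 2 := by
  refine (hasSum_norm_sq f).unique ?_
  convert (hasSum_norm_sq (reP f)).add (hasSum_norm_sq (imP f)) using 2 with x
  rw [reP_apply, imP_apply, Complex.norm_real, Complex.norm_real, Complex.sq_norm,
    Complex.normSq_apply, Real.norm_eq_abs, Real.norm_eq_abs, sq_abs, sq_abs]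
  ring

theorem norm_reP_le (f : EllTwo ι) : ‖reP f‖ ≤ ‖f‖ := by
  refine le_of_sq_le_sq ?_ (norm_nonneg _)
  rw [norm_sq_eq_reP_imP f]
  linarith [sq_nonneg ‖imP f‖]

theorem norm_imP_le (f : EllTwo ι) : ‖imP f‖ ≤ ‖f‖ := by
  refine le_of_sq_le_sq ?_ (norm_nonneg _)
  rw [norm_sq_eq_reP_imP f]
  linarith [sq_nonneg ‖reP f‖]

theorem imP_reP (f : EllTwo ι) : imP (reP f) = 0 := by
  ext x
  rw [imP_apply, reP_apply]
  simp

theorem reP_reP (f : EllTwo ι) : reP (reP f) = reP f := by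
  ext x
  rw [reP_apply, reP_apply, Complex.ofReal_re]

theorem reP_imP (f : EllTwo ι) : reP (imP f) = imP f := reP_reP _

theorem imP_add (f g : EllTwo ι) : imP (f + g) = imP f + imP g := by
  rw [imP, smul_add, neg_add, map_add, imP, imP]

theorem imP_comm {T : EllTwo ι →L[ℂ] EllTwo ι} (hT : ∀ f, T (reP f) = reP (T f)) (f : EllTwo ι) :
    T (imP f) = imP (T f) := by
  rw [imP, imP, hT, map_neg, map_smul]

theorem reP_ofReal_smul (c : ℝ) (f : EllTwo ι) : reP ((c : ℂ) • f) = (c : ℂ) • reP f := by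
  ext x
  simp only [reP_apply, lp.coeFn_smul, Pi.smul_apply, smul_eq_mul, Complex.re_ofReal_mul,
    Complex.ofReal_mul]

theorem real_inner_reP_imP (f g : EllTwo ι) : inner ℝ (reP f) (Complex.I • imP g) = 0 := by
  rw [lp.inner_eq_tsum]
  convert tsum_zero with x
  rw [lp.coeFn_smul, Pi.smul_apply, reP_apply, imP_apply, Complex.inner]
  simp

/-- The quadratic form of a real symmetric operator splits into real and imaginary parts. -/
theorem re_inner_map_self_split {T : EllTwo ι →L[ℂ] EllTwo ι} (hT : ∀ f, T (reP f) = reP (T f))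
    (hs : ∀ f g, inner ℂ (T f) g = inner ℂ f (T g)) (f : EllTwo ι) :
    (inner ℂ f (T f)).re
      = (inner ℂ (reP f) (T (reP f))).re + (inner ℂ (imP f) (T (imP f))).re := by
  have h1 : (inner ℂ (reP f) (Complex.I • T (imP f))).re = 0 := by
    rw [imP_comm hT, ← real_inner_eq, real_inner_reP_imP]
  have h2 : (inner ℂ (Complex.I • imP f) (T (reP f))).re = 0 := by
    rw [re_inner_symm, hs, map_smul]
    exact h1
  conv_lhs => rw [eq_reP_add_imP f]
  rw [map_add, map_smul, inner_add_left, inner_add_right, inner_add_right, Complex.add_re,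
    Complex.add_re, Complex.add_re, h1, h2, inner_smul_left, inner_smul_right, ← mul_assoc]
  simp

theorem restrict_reP [DecidableEq ι] (C : Finset ι) (f : EllTwo ι) :
    restrict C (reP f) = reP (restrict C f) := by
  ext x
  rw [restrict_apply, reP_apply, reP_apply, restrict_apply]
  split_ifs <;> simp

theorem nl_smul {p : ℝ} (hp : 0 ≤ p) (c : ℂ) (f : EllTwo ι) :
    nl p (c • f) = ((‖c‖ ^ p : ℝ) : ℂ) • c • nl p f := by
  ext x
  simp only [nl_apply hp, lp.coeFn_smul, Pi.smul_apply, powNL, smul_eq_mul, norm_mul,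
    Real.mul_rpow (norm_nonneg _) (norm_nonneg _)]
  push_cast
  ring

variable [DecidableEq ι] {A : EllTwo ι →L[ℂ] EllTwo ι} {C : Finset ι} {ρ : ℝ} {a : ι → ℝ}
  {ψ : EllTwo ι}

omit [DecidableEq ι] in
theorem IsCompactSoliton.inner_reP (hψ : IsCompactSoliton A C ρ a ψ) (f : EllTwo ι) :
    inner ℂ ψ (reP f) = ((inner ℂ ψ f).re : ℂ) := by
  rw [lp.inner_eq_tsum, lp.inner_eq_tsum, Complex.re_tsum (lp.summable_inner ψ f),
    Complex.ofReal_tsum]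
  congr 1 with x
  rw [reP_apply, hψ.apply_eq]
  simp

/-! ### Linearization of the nonlinearity and its remainder -/

theorem one_sub_rpow_neg_le {σ x : ℝ} (hσ : 0 ≤ σ) (hx : 0 ≤ x) :
    |(1 + x)⁻¹ ^ σ - 1| ≤ σ * x := by
  have h1 : (1 + x)⁻¹ ^ σ ≤ 1 :=
    Real.rpow_le_one (by positivity) (inv_le_one_of_one_le₀ (by linarith)) hσ
  rw [abs_of_nonpos (by linarith)]
  have h2 : (1 + x)⁻¹ ^ σ = Real.exp (-(σ * Real.log (1 + x))) := by
    rw [Real.rpow_def_of_pos (by positivity), Real.log_inv]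
    congr 1
    ring
  have h3 := Real.add_one_le_exp (-(σ * Real.log (1 + x)))
  have h4 := Real.log_le_sub_one_of_pos (by positivity : 0 < 1 + x)
  have h5 : σ * Real.log (1 + x) ≤ σ * x := by
    gcongr
    linarith
  rw [h2]
  linarith

/-- The linearization at `ψ` of the nonlinearity of the modulated equation. -/
noncomputable def linPart (C : Finset ι) (ψ : EllTwo ι) (σ κ : ℝ) (ζ : EllTwo ι) : EllTwo ι :=
  (κ : ℂ) • ψ + (κ : ℂ) • restrict C ζ + ((2 * σ * κ : ℝ) : ℂ) • restrict C (reP ζ)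

/-- The scalar factor is the value of |c|^(2σ) on the mass sphere and differs from 1 by O(‖ζ‖²). On
`C` the nonlinearity has a quadratic remainder; off `C` it is |ζ|^(2σ)ζ itself, whence the exponent
`min (2 * σ) 1`. -/
theorem exists_remainder_bound (hψ : IsCompactSoliton A C ρ a ψ) {σ : ℝ} (hσ : 0 < σ) :
    ∃ K ≥ 0, ∃ r > 0, ∀ ζ : EllTwo ι, ‖ζ‖ ≤ r →
      ‖(((‖ψ‖ ^ 2 / (‖ψ‖ ^ 2 + ‖ζ‖ ^ 2)) ^ σ : ℝ) : ℂ) • nl (2 * σ) (ψ + ζ)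
        - linPart C ψ σ (ρ ^ σ) ζ‖ ≤ K * (‖ζ‖ ^ min (2 * σ) 1 * ‖ζ‖) := by
  have hp : 0 ≤ 2 * σ := by positivity
  obtain ⟨K₁, hK₁, r₁, hr₁, hT⟩ := exists_powNL_taylor_bound σ hψ.pos
  have hψn : 0 < ‖ψ‖ := norm_pos_iff.2 hψ.ne_zero
  set ν := ‖ψ‖ ^ 2 with hν
  have hν0 : 0 < ν := by positivity
  set p := min (2 * σ) 1 with hpdef
  have hp0 : 0 < p := lt_min (by positivity) one_pos
  set K₂ : ℝ := σ / ν * ((‖ψ‖ + 1) ^ (2 * σ) * (‖ψ‖ + 1)) with hK₂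
  refine ⟨K₂ + (K₁ + 1), by positivity, min 1 r₁, by positivity, fun ζ hζ => ?_⟩
  have hζ1 : ‖ζ‖ ≤ 1 := hζ.trans (min_le_left _ _)
  have hζr : ‖ζ‖ ≤ r₁ := hζ.trans (min_le_right _ _)
  have hpow : ∀ q : ℝ, p ≤ q → ∀ x : ℝ, 0 ≤ x → x ≤ ‖ζ‖ → x ^ q ≤ ‖ζ‖ ^ p := by
    intro q hq x hx hxζ
    calc x ^ q ≤ ‖ζ‖ ^ q := Real.rpow_le_rpow hx hxζ (hp0.le.trans hq)
      _ ≤ ‖ζ‖ ^ p := Real.rpow_le_rpow_of_exponent_ge_of_imp (norm_nonneg _) hζ1 hq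
          fun _ h => absurd h (hp0.trans_le hq).ne'
  have hζsq : ‖ζ‖ ^ 2 ≤ ‖ζ‖ ^ p * ‖ζ‖ := by
    have := hpow 1 (min_le_right _ _) ‖ζ‖ (norm_nonneg _) le_rfl
    rw [Real.rpow_one] at this
    rw [sq]
    gcongr
  have h1 : ‖nl (2 * σ) (ψ + ζ) - linPart C ψ σ (ρ ^ σ) ζ‖ ≤ (K₁ + 1) * ‖ζ‖ ^ p * ‖ζ‖ := by
    refine norm_le_of_forall_norm_le (by positivity) fun x => ?_
    have hx := norm_apply_le ζ x
    have hx0 := norm_nonneg (ζ x)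
    have hxp : 0 ≤ ‖ζ‖ ^ p := by positivity
    have e : (nl (2 * σ) (ψ + ζ) - linPart C ψ σ (ρ ^ σ) ζ) x
        = powNL (2 * σ) (a x + ζ x) - (((ρ ^ σ : ℝ) : ℂ) * a x
          + ((ρ ^ σ : ℝ) : ℂ) * (if x ∈ C then ζ x else 0)
          + ((2 * σ * ρ ^ σ : ℝ) : ℂ) * (if x ∈ C then ((ζ x).re : ℂ) else 0)) := by
      simp only [linPart, lp.coeFn_sub, lp.coeFn_add, lp.coeFn_smul, Pi.sub_apply, Pi.add_apply,
        Pi.smul_apply, smul_eq_mul, nl_apply hp, restrict_apply, reP_apply, hψ.apply_eq]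
    rw [e]
    by_cases hC : x ∈ C
    · have h2 := hT (a x) (hψ.sq_eq x hC) (ζ x) (hx.trans hζr)
      have e2 : powNL (2 * σ) (a x) = ((ρ ^ σ : ℝ) : ℂ) * a x := by
        rw [powNL, Real.rpow_mul (norm_nonneg _), Real.rpow_two, Complex.norm_real,
          Real.norm_eq_abs, sq_abs, hψ.sq_eq x hC]
      rw [e2] at h2
      rw [if_pos hC, if_pos hC]
      have e3 : powNL (2 * σ) (a x + ζ x) - (((ρ ^ σ : ℝ) : ℂ) * a x + ((ρ ^ σ : ℝ) : ℂ) * ζ x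
          + ((2 * σ * ρ ^ σ : ℝ) : ℂ) * ((ζ x).re : ℂ))
          = powNL (2 * σ) (a x + ζ x) - ((ρ ^ σ : ℝ) : ℂ) * a x
            - ((ρ ^ σ : ℝ) : ℂ) * (ζ x + ((2 * σ * (ζ x).re : ℝ) : ℂ)) := by
        push_cast
        ring
      rw [e3]
      refine h2.trans ?_
      have h3 := hpow 1 (min_le_right _ _) ‖ζ x‖ hx0 hx
      rw [Real.rpow_one] at h3
      calc K₁ * ‖ζ x‖ ^ 2 = K₁ * ‖ζ x‖ * ‖ζ x‖ := by ring
        _ ≤ (K₁ + 1) * ‖ζ‖ ^ p * ‖ζ x‖ := by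
          gcongr
          linarith
    · rw [if_neg hC, if_neg hC, hψ.eq_zero x hC]
      simp only [Complex.ofReal_zero, zero_add, mul_zero, add_zero, sub_zero, norm_powNL]
      have h3 := hpow (2 * σ) (min_le_left _ _) ‖ζ x‖ hx0 hx
      calc ‖ζ x‖ ^ (2 * σ) * ‖ζ x‖ ≤ ‖ζ‖ ^ p * ‖ζ x‖ := by gcongr
        _ ≤ (K₁ + 1) * ‖ζ‖ ^ p * ‖ζ x‖ := by
          gcongr
          nlinarith
  set k : ℝ := (ν / (ν + ‖ζ‖ ^ 2)) ^ σ with hk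
  have hk1 : |k - 1| ≤ σ / ν * ‖ζ‖ ^ 2 := by
    have := one_sub_rpow_neg_le hσ.le (by positivity : 0 ≤ ‖ζ‖ ^ 2 / ν)
    have e1 : (1 + ‖ζ‖ ^ 2 / ν)⁻¹ = ν / (ν + ‖ζ‖ ^ 2) := by field_simp
    rw [e1] at this
    calc |k - 1| ≤ σ * (‖ζ‖ ^ 2 / ν) := this
      _ = _ := by ring
  have h2 : ‖(((k - 1 : ℝ)) : ℂ) • nl (2 * σ) (ψ + ζ)‖ ≤ K₂ * (‖ζ‖ ^ p * ‖ζ‖) := by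
    rw [norm_smul, Complex.norm_real, Real.norm_eq_abs]
    have h3 : ‖ψ + ζ‖ ≤ ‖ψ‖ + 1 := (norm_add_le _ _).trans (by linarith)
    have h4 : ‖nl (2 * σ) (ψ + ζ)‖ ≤ (‖ψ‖ + 1) ^ (2 * σ) * (‖ψ‖ + 1) :=
      (norm_nl_le hp _).trans (by gcongr)
    calc |k - 1| * ‖nl (2 * σ) (ψ + ζ)‖
        ≤ (σ / ν * ‖ζ‖ ^ 2) * ((‖ψ‖ + 1) ^ (2 * σ) * (‖ψ‖ + 1)) := by gcongr
      _ = K₂ * ‖ζ‖ ^ 2 := by rw [hK₂]; ring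
      _ ≤ _ := by gcongr
  have e : (k : ℂ) • nl (2 * σ) (ψ + ζ) - linPart C ψ σ (ρ ^ σ) ζ
      = ((k - 1 : ℝ) : ℂ) • nl (2 * σ) (ψ + ζ)
        + (nl (2 * σ) (ψ + ζ) - linPart C ψ σ (ρ ^ σ) ζ) := by
    rw [Complex.ofReal_sub, sub_smul, Complex.ofReal_one, one_smul]
    abel
  rw [e]
  refine (norm_add_le _ _).trans ((add_le_add h2 h1).trans_eq (by ring))

/-! ### The modulated equation -/

/-- The component of a state along `ψ`. -/
noncomputable def modulation (ψ f : EllTwo ι) : ℂ := inner ℂ ψ f / ((‖ψ‖ ^ 2 : ℝ) : ℂ)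

/-- The remainder in the modulated equation. -/
noncomputable def modRemainder (C : Finset ι) (ψ : EllTwo ι) (σ κ k : ℝ) (ζ : EllTwo ι) :
    EllTwo ι :=
  ((k : ℂ) • nl (2 * σ) (ψ + ζ) - linPart C ψ σ κ ζ)
    - (inner ℂ ψ ((k : ℂ) • nl (2 * σ) (ψ + ζ) - linPart C ψ σ κ ζ) / ((‖ψ‖ ^ 2 : ℝ) : ℂ)) • (ψ + ζ)

omit [DecidableEq ι] in
theorem inner_self_ofReal (ψ : EllTwo ι) : inner ℂ ψ ψ = ((‖ψ‖ ^ 2 : ℝ) : ℂ) := by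
  rw [inner_self_eq_norm_sq_to_K]
  simp

/-- Dividing by the component along `ψ` divides out phase and amplitude together, so the
perturbation stays orthogonal to `ψ` over ℂ. The motion of that component is absorbed in
`modRemainder`. -/
theorem hasDerivAt_modulated (hA : IsNonnegSymm A) (hψ : IsCompactSoliton A C ρ a ψ) {σ : ℝ}
    (hσ : 0 < σ) {E : ℝ} {H : EllTwo ι →L[ℂ] EllTwo ι}
    (hH : H = (E : ℂ) • ContinuousLinearMap.id ℂ _ - A) {Ψ : ℝ → EllTwo ι} {t : ℝ}
    (hΨ : HasDerivAt Ψ (dnlsField H (2 * σ) (Ψ t)) t) (hc : modulation ψ (Ψ t) ≠ 0) (κ : ℝ)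
    {ζ : EllTwo ι} (hζ : ζ = (modulation ψ (Ψ t))⁻¹ • Ψ t - ψ) :
    HasDerivAt (fun s => (modulation ψ (Ψ s))⁻¹ • Ψ s - ψ)
      (-(Complex.I • (-(shifted A κ ζ - (κ : ℂ) • restrict C ζ)
        + ((2 * σ * κ : ℝ) : ℂ) • restrict C (reP ζ)
        + modRemainder C ψ σ κ (‖modulation ψ (Ψ t)‖ ^ (2 * σ)) ζ))) t := by
  have hp : 0 ≤ 2 * σ := by positivity
  have hψn : 0 < ‖ψ‖ := norm_pos_iff.2 hψ.ne_zero
  set c := modulation ψ (Ψ t) with hcdef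
  set k : ℝ := ‖c‖ ^ (2 * σ) with hk
  have hν : ((‖ψ‖ ^ 2 : ℝ) : ℂ) ≠ 0 := by
    exact_mod_cast (by positivity : ‖ψ‖ ^ 2 ≠ 0)
  have hX : Ψ t = c • (ψ + ζ) := by rw [hζ, add_sub_cancel, smul_smul, mul_inv_cancel₀ hc, one_smul]
  set X := ψ + ζ with hXdef
  have horth : inner ℂ ψ ζ = 0 := by
    rw [hζ, inner_sub_right, inner_smul_right, inner_self_ofReal, hcdef, modulation]
    rw [hcdef, modulation] at hc
    have h0 : inner ℂ ψ (Ψ t) ≠ 0 := fun h => hc (by rw [h, zero_div])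
    field_simp
    simp
  set R₀ := (k : ℂ) • nl (2 * σ) X - linPart C ψ σ κ ζ with hR₀
  have hF : dnlsField H (2 * σ) (Ψ t) = -(Complex.I • c • (H X + (k : ℂ) • nl (2 * σ) X)) := by
    rw [dnlsField, hX, nl_smul hp, map_smul, smul_comm (k : ℂ) c, ← smul_add]
  have hHX : H X = (E : ℂ) • X - A ζ := by
    rw [hH, sub_apply, hXdef, map_add A, hψ.map_eq_zero, zero_add]
    simp only [FunLike.coe_smul, Pi.smul_apply, ContinuousLinearMap.coe_id', id_eq]
  have hAψ : inner ℂ ψ (A ζ) = 0 := by rw [← hA.symm, hψ.map_eq_zero, inner_zero_left]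
  have hψX : inner ℂ ψ X = ((‖ψ‖ ^ 2 : ℝ) : ℂ) := by
    rw [hXdef, inner_add_right, horth, add_zero, inner_self_ofReal]
  have hlin : inner ℂ ψ (linPart C ψ σ κ ζ) = (κ : ℂ) * ((‖ψ‖ ^ 2 : ℝ) : ℂ) := by
    rw [linPart, inner_add_right, inner_add_right, inner_smul_right, inner_smul_right,
      inner_smul_right, ← restrict_symm, ← restrict_symm, hψ.restrict_eq, hψ.inner_reP, horth,
      inner_self_ofReal]
    simp
  -- `γ` is the instantaneous complex frequency: c' = −i γ c. Its unperturbed value is `E + κ`.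
  set γ : ℂ := (E : ℂ) + κ + inner ℂ ψ R₀ / ((‖ψ‖ ^ 2 : ℝ) : ℂ) with hγ
  have hc' : HasDerivAt (fun s => modulation ψ (Ψ s)) (-(Complex.I * (c * γ))) t := by
    have h1 := ((innerSL ℂ ψ).restrictScalars ℝ).hasFDerivAt.comp_hasDerivAt t hΨ
    have h2 := h1.div_const (((‖ψ‖ ^ 2 : ℝ) : ℂ))
    refine h2.congr_deriv ?_
    have e1 : inner ℂ ψ ((k : ℂ) • nl (2 * σ) X)
        = inner ℂ ψ R₀ + (κ : ℂ) * ((‖ψ‖ ^ 2 : ℝ) : ℂ) := by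
      rw [hR₀, inner_sub_right, hlin]
      ring
    have e2 : inner ℂ ψ (dnlsField H (2 * σ) (Ψ t)) = -(Complex.I * (c * γ)) * ((‖ψ‖ ^ 2 : ℝ) : ℂ) := by
      rw [hF, inner_neg_right, inner_smul_right, inner_smul_right, inner_add_right, e1, hHX,
        inner_sub_right, inner_smul_right, hAψ, hψX, hγ]
      field_simp
      ring
    change inner ℂ ψ (dnlsField H (2 * σ) (Ψ t)) / _ = _
    rw [e2, mul_div_cancel_right₀ _ hν]
  have hmain := ((hc'.fun_inv hc).smul hΨ).sub_const ψ
  refine hmain.congr_deriv ?_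
  have e1 : -(shifted A κ ζ - (κ : ℂ) • restrict C ζ)
        + ((2 * σ * κ : ℝ) : ℂ) • restrict C (reP ζ) + modRemainder C ψ σ κ k ζ
      = H X + (k : ℂ) • nl (2 * σ) X - γ • X := by
    rw [modRemainder, ← hXdef, ← hR₀]
    have e2 : (k : ℂ) • nl (2 * σ) X = R₀ + linPart C ψ σ κ ζ := by rw [hR₀]; abel
    rw [e2, hHX, hγ, shifted_apply, linPart, hXdef]
    module
  rw [e1, hF, ← hcdef, hX]
  have e3 : -(-(Complex.I * (c * γ))) / c ^ 2 * c = Complex.I * γ := by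
    field_simp
  have e4 : c⁻¹ * Complex.I * c = Complex.I := by field_simp
  rw [smul_neg, smul_smul, smul_smul, smul_smul, e4, e3, smul_sub, smul_smul]
  abel

end EllTwo

/-! ### Inverses of coercive symmetric operators -/

section CoerciveInverse

variable {V : Type*} [NormedAddCommGroup V] [InnerProductSpace ℂ V] [CompleteSpace V]

theorem exists_coercive_inverse {M : V →L[ℂ] V} (hM : ∀ x y, inner ℂ (M x) y = inner ℂ x (M y))
    {m : ℝ} (hm : 0 < m) (hpos : ∀ x, m * ‖x‖ ^ 2 ≤ (inner ℂ x (M x)).re) :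
    ∃ N : V →L[ℂ] V, (∀ x, M (N x) = x) ∧ (∀ x y, inner ℂ (N x) y = inner ℂ x (N y)) ∧
      ∃ n > 0, ∀ x, n * ‖x‖ ^ 2 ≤ (inner ℂ x (N x)).re := by
  have hu : IsUnit M := by
    refine ContinuousLinearMap.isUnit_of_forall_le_norm_inner_map _ (c := ⟨m, hm.le⟩) hm fun x => ?_
    rw [hM]
    calc ‖x‖ ^ 2 * m = m * ‖x‖ ^ 2 := mul_comm _ _
      _ ≤ _ := hpos x
      _ ≤ _ := Complex.re_le_norm _
  have hMN : ∀ x, M (Ring.inverse M x) = x := fun x =>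
    DFunLike.congr_fun (Ring.mul_inverse_cancel _ hu) x
  refine ⟨Ring.inverse M, hMN, fun x y => ?_, m / (‖M‖ + 1) ^ 2, by positivity, fun x => ?_⟩
  · conv_lhs => rw [← hMN y, ← hM, hMN]
  · obtain ⟨z, hz⟩ : ∃ z, z = Ring.inverse M x := ⟨_, rfl⟩
    have hx : x = M z := by rw [hz, hMN]
    rw [← hz, hx, re_inner_symm]
    refine le_trans ?_ (hpos z)
    rw [div_mul_eq_mul_div, div_le_iff₀ (by positivity), mul_assoc]
    have h1 : ‖M z‖ ≤ (‖M‖ + 1) * ‖z‖ := (M.le_opNorm z).trans (by gcongr; linarith)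
    have h2 : ‖M z‖ ^ 2 ≤ ((‖M‖ + 1) * ‖z‖) ^ 2 := by gcongr
    have h3 : ‖z‖ ^ 2 * (‖M‖ + 1) ^ 2 = ((‖M‖ + 1) * ‖z‖) ^ 2 := by ring
    rw [h3]
    gcongr

end CoerciveInverse

/-! ### The linearized operators and estimates for the modulation -/

namespace EllTwo

variable {ι : Type*} [DecidableEq ι] {A : EllTwo ι →L[ℂ] EllTwo ι} {C : Finset ι} {ρ : ℝ}
  {a : ι → ℝ} {ψ : EllTwo ι}

/-- The operator governing the imaginary part of the linearization. -/
noncomputable def linMinus (A : EllTwo ι →L[ℂ] EllTwo ι) (C : Finset ι) (κ : ℝ) :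
    EllTwo ι →L[ℂ] EllTwo ι :=
  shifted A κ - (κ : ℂ) • restrict C

theorem linMinus_apply (κ : ℝ) (f : EllTwo ι) :
    linMinus A C κ f = shifted A κ f - (κ : ℂ) • restrict C f := rfl

/-- The operator governing the real part of the linearization, with the opposite sign. -/
noncomputable def linPlus (A : EllTwo ι →L[ℂ] EllTwo ι) (C : Finset ι) (σ κ : ℝ) :
    EllTwo ι →L[ℂ] EllTwo ι :=
  (((2 * σ + 1) * κ : ℝ) : ℂ) • restrict C - shifted A κ

theorem linPlus_apply (σ κ : ℝ) (f : EllTwo ι) :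
    linPlus A C σ κ f = (((2 * σ + 1) * κ : ℝ) : ℂ) • restrict C f - shifted A κ f := rfl

/-- `linMinus` made positive definite along its kernel. -/
noncomputable def linMinusPos (A : EllTwo ι →L[ℂ] EllTwo ι) (C : Finset ι) (κ : ℝ)
    (ψ : EllTwo ι) : EllTwo ι →L[ℂ] EllTwo ι :=
  linMinus A C κ + (innerSL ℂ ψ).smulRight ψ

theorem linMinusPos_apply (κ : ℝ) (f : EllTwo ι) :
    linMinusPos A C κ ψ f = linMinus A C κ f + inner ℂ ψ f • ψ := rfl

theorem linMinus_symm (hA : IsNonnegSymm A) (κ : ℝ) (f g : EllTwo ι) :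
    inner ℂ (linMinus A C κ f) g = inner ℂ f (linMinus A C κ g) := by
  rw [linMinus_apply, linMinus_apply, inner_sub_left, inner_sub_right, hA.shifted_symm,
    inner_smul_left, inner_smul_right, restrict_symm, Complex.conj_ofReal]

theorem linPlus_symm (hA : IsNonnegSymm A) (σ κ : ℝ) (f g : EllTwo ι) :
    inner ℂ (linPlus A C σ κ f) g = inner ℂ f (linPlus A C σ κ g) := by
  rw [linPlus_apply, linPlus_apply, inner_sub_left, inner_sub_right, hA.shifted_symm,
    inner_smul_left, inner_smul_right, restrict_symm, Complex.conj_ofReal]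

theorem linMinusPos_symm (hA : IsNonnegSymm A) (κ : ℝ) (f g : EllTwo ι) :
    inner ℂ (linMinusPos A C κ ψ f) g = inner ℂ f (linMinusPos A C κ ψ g) := by
  rw [linMinusPos_apply, linMinusPos_apply, inner_add_left, inner_add_right, linMinus_symm hA,
    inner_smul_left, inner_smul_right, inner_conj_symm]
  ring

theorem IsCompactSoliton.linMinus_eq_zero (hψ : IsCompactSoliton A C ρ a ψ) (κ : ℝ) :
    linMinus A C κ ψ = 0 := by
  rw [linMinus_apply, shifted_apply, hψ.map_eq_zero, hψ.restrict_eq, zero_add, sub_self]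

theorem re_inner_linMinus (κ : ℝ) (f : EllTwo ι) :
    (inner ℂ f (linMinus A C κ f)).re
      = (inner ℂ f (shifted A κ f)).re - κ * ‖restrict C f‖ ^ 2 := by
  rw [linMinus_apply, inner_sub_right, inner_smul_right, Complex.sub_re, Complex.re_ofReal_mul,
    re_inner_restrict]

theorem re_inner_linPlus (σ κ : ℝ) (f : EllTwo ι) :
    (inner ℂ f (linPlus A C σ κ f)).re
      = (2 * σ + 1) * κ * ‖restrict C f‖ ^ 2 - (inner ℂ f (shifted A κ f)).re := by
  rw [linPlus_apply, inner_sub_right, inner_smul_right, Complex.sub_re, Complex.re_ofReal_mul,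
    re_inner_restrict]

/-- `ψ` spans the null direction: on its complement `hcoer` with `κ m < 1` gives the constant `(1 -
κ m) κ`, and along `ψ` the added rank-one term gives `‖ψ‖ ^ 2`. -/
theorem IsCompactSoliton.exists_linMinusPos_coercive (hA : IsNonnegSymm A)
    (hψ : IsCompactSoliton A C ρ a ψ) {κ m : ℝ} (hκ : 0 < κ) (hm : κ * m < 1)
    (hcoer : ∀ ξ, inner ℂ ψ ξ = 0 →
      ‖restrict C ξ‖ ^ 2 ≤ m * (inner ℂ ξ (shifted A κ ξ)).re) :
    ∃ c > 0, ∀ f, c * ‖f‖ ^ 2 ≤ (inner ℂ f (linMinusPos A C κ ψ f)).re := by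
  have hν : 0 < ‖ψ‖ ^ 2 := by
    have := norm_pos_iff.2 hψ.ne_zero
    positivity
  have hν' : ((‖ψ‖ ^ 2 : ℝ) : ℂ) ≠ 0 := by exact_mod_cast hν.ne'
  refine ⟨min ((1 - κ * m) * κ) (‖ψ‖ ^ 2),
    lt_min (mul_pos (by linarith) hκ) hν, fun f => ?_⟩
  obtain ⟨τ, hτ⟩ : ∃ τ : ℂ, τ = inner ℂ ψ f / ((‖ψ‖ ^ 2 : ℝ) : ℂ) := ⟨_, rfl⟩
  obtain ⟨ξ, hξ⟩ : ∃ ξ, ξ = f - τ • ψ := ⟨_, rfl⟩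
  have hf : f = τ • ψ + ξ := by rw [hξ]; abel
  have hψf : inner ℂ ψ f = τ * ((‖ψ‖ ^ 2 : ℝ) : ℂ) := by rw [hτ, div_mul_cancel₀ _ hν']
  have horth : inner ℂ ψ ξ = 0 := by
    rw [hξ, inner_sub_right, inner_smul_right, inner_self_ofReal, hψf, sub_self]
  have horth' : inner ℂ ξ ψ = 0 := by rw [← inner_conj_symm, horth, map_zero]
  have h1 : inner ℂ f (linMinus A C κ f) = inner ℂ ξ (linMinus A C κ ξ) := by
    rw [hf, map_add, map_smul, hψ.linMinus_eq_zero, smul_zero, zero_add, inner_add_left,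
      inner_smul_left, ← linMinus_symm hA, hψ.linMinus_eq_zero, inner_zero_left, mul_zero, zero_add]
  have h2 : (inner ℂ f (linMinusPos A C κ ψ f)).re
      = (inner ℂ ξ (linMinus A C κ ξ)).re + ‖inner ℂ ψ f‖ ^ 2 := by
    rw [linMinusPos_apply, inner_add_right, h1, inner_smul_right, Complex.add_re,
      ← inner_conj_symm f ψ, Complex.mul_conj']
    norm_cast
  have h3 : ‖f‖ ^ 2 = ‖τ‖ ^ 2 * ‖ψ‖ ^ 2 + ‖ξ‖ ^ 2 := by
    rw [← re_inner_self, hf, inner_add_left, inner_add_right, inner_add_right, inner_smul_left,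
      inner_smul_right, inner_smul_left, inner_smul_right, horth, horth', Complex.add_re,
      Complex.add_re, Complex.add_re, re_inner_self, ← mul_assoc, Complex.conj_mul',
      inner_self_ofReal]
    norm_cast
    simp
  have h4 := hcoer ξ horth
  have h5 := hA.le_shifted κ ξ
  have h6 := re_inner_linMinus (A := A) (C := C) κ ξ
  have h7 : ‖inner ℂ ψ f‖ ^ 2 = ‖ψ‖ ^ 2 * (‖τ‖ ^ 2 * ‖ψ‖ ^ 2) := by
    rw [hψf, norm_mul, Complex.norm_real, Real.norm_eq_abs, abs_of_pos hν]
    ring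
  have h8 : (1 - κ * m) * κ * ‖ξ‖ ^ 2 ≤ (inner ℂ ξ (linMinus A C κ ξ)).re := by
    rw [h6]
    have := mul_le_mul_of_nonneg_left h5 (by linarith : 0 ≤ 1 - κ * m)
    have := mul_le_mul_of_nonneg_left h4 hκ.le
    nlinarith
  have h9 : min ((1 - κ * m) * κ) (‖ψ‖ ^ 2) * ‖ξ‖ ^ 2 ≤ (1 - κ * m) * κ * ‖ξ‖ ^ 2 := by
    gcongr
    exact min_le_left _ _
  have h10 : min ((1 - κ * m) * κ) (‖ψ‖ ^ 2) * (‖τ‖ ^ 2 * ‖ψ‖ ^ 2)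
      ≤ ‖ψ‖ ^ 2 * (‖τ‖ ^ 2 * ‖ψ‖ ^ 2) := by
    gcongr
    exact min_le_right _ _
  rw [h2, h3, h7, mul_add]
  linarith

theorem norm_modRemainder_le {σ κ k K p : ℝ} (hψ : ψ ≠ 0) {ζ : EllTwo ι} (hζ : ‖ζ‖ ≤ 1)
    (hR : ‖(k : ℂ) • nl (2 * σ) (ψ + ζ) - linPart C ψ σ κ ζ‖ ≤ K * (‖ζ‖ ^ p * ‖ζ‖)) :
    ‖modRemainder C ψ σ κ k ζ‖ ≤ (1 + (‖ψ‖ + 1) / ‖ψ‖) * K * (‖ζ‖ ^ p * ‖ζ‖) := by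
  have hψn : 0 < ‖ψ‖ := norm_pos_iff.2 hψ
  rw [modRemainder]
  obtain ⟨R, hRd⟩ : ∃ R, R = (k : ℂ) • nl (2 * σ) (ψ + ζ) - linPart C ψ σ κ ζ := ⟨_, rfl⟩
  rw [← hRd] at hR ⊢
  have h1 : ‖inner ℂ ψ R / ((‖ψ‖ ^ 2 : ℝ) : ℂ)‖ ≤ ‖R‖ / ‖ψ‖ := by
    rw [norm_div, Complex.norm_real, Real.norm_eq_abs, abs_of_pos (by positivity),
      div_le_div_iff₀ (by positivity) hψn]
    have := norm_inner_le_norm (𝕜 := ℂ) ψ R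
    nlinarith
  have h2 : ‖ψ + ζ‖ ≤ ‖ψ‖ + 1 := (norm_add_le _ _).trans (by linarith)
  calc ‖R - (inner ℂ ψ R / ((‖ψ‖ ^ 2 : ℝ) : ℂ)) • (ψ + ζ)‖
      ≤ ‖R‖ + ‖inner ℂ ψ R / ((‖ψ‖ ^ 2 : ℝ) : ℂ)‖ * ‖ψ + ζ‖ := by
        rw [← norm_smul]
        exact norm_sub_le _ _
    _ ≤ ‖R‖ + ‖R‖ / ‖ψ‖ * (‖ψ‖ + 1) := by gcongr
    _ = (1 + (‖ψ‖ + 1) / ‖ψ‖) * ‖R‖ := by field_simp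
    _ ≤ (1 + (‖ψ‖ + 1) / ‖ψ‖) * (K * (‖ζ‖ ^ p * ‖ζ‖)) := by gcongr
    _ = _ := by ring

omit [DecidableEq ι] in
/-- Near the phase circle of `ψ` the modulation parameter is bounded below and the modulated
perturbation is small. -/
theorem modulation_estimates (hψ : ψ ≠ 0) {f : EllTwo ι} {ε : ℝ} (hε : ε ≤ ‖ψ‖ / 2)
    (hf : Metric.infDist f (phaseCircle ψ) < ε) :
    modulation ψ f ≠ 0 ∧ ‖(modulation ψ f)⁻¹ • f - ψ‖ ≤ 4 * ε := by
  have hψn : 0 < ‖ψ‖ := norm_pos_iff.2 hψ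
  have hν : ((‖ψ‖ ^ 2 : ℝ) : ℂ) ≠ 0 := by exact_mod_cast (by positivity : ‖ψ‖ ^ 2 ≠ 0)
  obtain ⟨z, hz, hlt⟩ := exists_phase_of_infDist_lt hf
  obtain ⟨c, hc⟩ : ∃ c, c = modulation ψ f := ⟨_, rfl⟩
  rw [← hc]
  have e1 : inner ℂ ψ (z • f - ψ) = (z * c - 1) * ((‖ψ‖ ^ 2 : ℝ) : ℂ) := by
    rw [inner_sub_right, inner_smul_right, inner_self_ofReal, hc, modulation]
    field_simp
  have h1 : ‖z * c - 1‖ * ‖ψ‖ ≤ ε := by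
    have h := norm_inner_le_norm (𝕜 := ℂ) ψ (z • f - ψ)
    rw [e1, norm_mul, Complex.norm_real, Real.norm_eq_abs, abs_of_pos (by positivity)] at h
    have : ‖z * c - 1‖ * ‖ψ‖ ≤ ‖z • f - ψ‖ := by
      refine le_of_mul_le_mul_left ?_ hψn
      calc ‖ψ‖ * (‖z * c - 1‖ * ‖ψ‖) = ‖z * c - 1‖ * ‖ψ‖ ^ 2 := by ring
        _ ≤ _ := h
    linarith
  have h2 : ‖z * c - 1‖ ≤ 1 / 2 := by
    have : ‖z * c - 1‖ * ‖ψ‖ ≤ 1 / 2 * ‖ψ‖ := by linarith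
    exact le_of_mul_le_mul_right this hψn
  have h3 : 1 / 2 ≤ ‖c‖ := by
    have h := norm_sub_norm_le (1 : ℂ) (1 - z * c)
    rw [sub_sub_cancel, norm_mul, hz, one_mul, norm_one, norm_sub_rev] at h
    linarith
  have hc0 : c ≠ 0 := by
    intro h
    rw [h, norm_zero] at h3
    linarith
  refine ⟨hc0, ?_⟩
  have e2 : z • c • (c⁻¹ • f - ψ) = (z • f - ψ) - (z * c - 1) • ψ := by
    rw [smul_sub, smul_smul c, mul_inv_cancel₀ hc0, one_smul]
    module
  have h4 : ‖c‖ * ‖c⁻¹ • f - ψ‖ ≤ 2 * ε := by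
    have h := congrArg norm e2
    rw [norm_smul, norm_smul, hz, one_mul] at h
    rw [h]
    refine (norm_sub_le _ _).trans ?_
    rw [norm_smul]
    linarith
  have := mul_le_mul_of_nonneg_right h3 (norm_nonneg (c⁻¹ • f - ψ))
  linarith

omit [DecidableEq ι] in
theorem inner_modulated (hψ : ψ ≠ 0) {f : EllTwo ι} (hc : modulation ψ f ≠ 0) :
    inner ℂ ψ ((modulation ψ f)⁻¹ • f - ψ) = 0 := by
  have hψn : 0 < ‖ψ‖ := norm_pos_iff.2 hψ
  have hν : ((‖ψ‖ ^ 2 : ℝ) : ℂ) ≠ 0 := by exact_mod_cast (by positivity : ‖ψ‖ ^ 2 ≠ 0)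
  have e : inner ℂ ψ f = modulation ψ f * ((‖ψ‖ ^ 2 : ℝ) : ℂ) := by
    rw [modulation, div_mul_cancel₀ _ hν]
  rw [inner_sub_right, inner_smul_right, inner_self_ofReal, e, inv_mul_cancel_left₀ hc, sub_self]

omit [DecidableEq ι] in
theorem norm_add_sq_of_inner_eq_zero {ζ : EllTwo ι} (h : inner ℂ ψ ζ = 0) :
    ‖ψ + ζ‖ ^ 2 = ‖ψ‖ ^ 2 + ‖ζ‖ ^ 2 := by
  rw [← re_inner_self, inner_add_left, inner_add_right, inner_add_right, ← inner_conj_symm ζ ψ, h]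
  simp only [map_zero, add_zero, zero_add, Complex.add_re, re_inner_self]

omit [DecidableEq ι] in
-- Pythagoras: on the mass sphere of `ψ` the modulus of the modulation parameter is a function of
-- the perturbation, so no separate equation for it is needed.
theorem norm_modulation_rpow (hψ : ψ ≠ 0) (σ : ℝ) {f : EllTwo ι} (hc : modulation ψ f ≠ 0)
    (hf : ‖f‖ = ‖ψ‖) :
    ‖modulation ψ f‖ ^ (2 * σ)
      = (‖ψ‖ ^ 2 / (‖ψ‖ ^ 2 + ‖(modulation ψ f)⁻¹ • f - ψ‖ ^ 2)) ^ σ := by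
  have hψn : 0 < ‖ψ‖ := norm_pos_iff.2 hψ
  have h1 := norm_add_sq_of_inner_eq_zero (inner_modulated hψ hc)
  have hcn : 0 < ‖modulation ψ f‖ := norm_pos_iff.2 hc
  rw [add_sub_cancel, norm_smul, norm_inv, hf] at h1
  rw [← h1, Real.rpow_mul (norm_nonneg _), Real.rpow_two]
  congr 1
  field_simp

end EllTwo

/-! ### Real coordinates for the modulated flow and its initial data -/

namespace EllTwo

variable {ι : Type*} [DecidableEq ι] {A : EllTwo ι →L[ℂ] EllTwo ι} {C : Finset ι} {ρ : ℝ}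
  {a : ι → ℝ} {ψ : EllTwo ι}

omit [DecidableEq ι] in
theorem reP_I_smul_neg_I_smul (f : EllTwo ι) : reP (Complex.I • -(Complex.I • f)) = reP f := by
  rw [smul_neg, smul_smul, Complex.I_mul_I, neg_one_smul, neg_neg]

omit [DecidableEq ι] in
theorem reP_I_smul (f : EllTwo ι) : reP (Complex.I • f) = -imP f := by
  rw [imP, map_neg, neg_neg]

omit [DecidableEq ι] in
theorem shifted_reP (hreal : ∀ f, A (reP f) = reP (A f)) (κ : ℝ) (f : EllTwo ι) :
    shifted A κ (reP f) = reP (shifted A κ f) := by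
  rw [shifted_apply, shifted_apply, hreal, map_add, reP_ofReal_smul]

theorem linMinus_reP (hreal : ∀ f, A (reP f) = reP (A f)) (κ : ℝ) (f : EllTwo ι) :
    linMinus A C κ (reP f) = reP (linMinus A C κ f) := by
  rw [linMinus_apply, linMinus_apply, shifted_reP hreal, map_sub, reP_ofReal_smul, restrict_reP]

omit [DecidableEq ι] in
/-- The initial data of an escaping solution. -/
theorem exists_initial_datum (hψ : ψ ≠ 0) {w : EllTwo ι} (hw : inner ℂ ψ w = 0) {δ : ℝ}
    (hδ : 0 < δ) :
    ∃ s : ℝ, 0 < s ∧ ∃ f : EllTwo ι, ‖f‖ = ‖ψ‖ ∧ Metric.infDist f (phaseCircle ψ) < δ ∧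
      modulation ψ f ≠ 0 ∧ (modulation ψ f)⁻¹ • f - ψ = (s : ℂ) • w := by
  have hψn : 0 < ‖ψ‖ := norm_pos_iff.2 hψ
  have hν : ((‖ψ‖ ^ 2 : ℝ) : ℂ) ≠ 0 := by exact_mod_cast (by positivity : ‖ψ‖ ^ 2 ≠ 0)
  have hpos : ∀ s : ℝ, 0 < ‖ψ + (s : ℂ) • w‖ := by
    intro s
    rw [norm_pos_iff]
    intro h
    have h1 := congrArg (inner ℂ ψ) h
    rw [inner_add_right, inner_smul_right, hw, mul_zero, add_zero,
      inner_zero_right, inner_self_eq_zero] at h1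
    exact hψ h1
  -- The perturbed state is rescaled to the mass of `ψ`; the scaling is a real factor, so it cancels
  -- in the modulated perturbation.
  obtain ⟨g, hg⟩ : ∃ g : ℝ → EllTwo ι, ∀ s,
      g s = ((‖ψ‖ / ‖ψ + (s : ℂ) • w‖ : ℝ) : ℂ) • (ψ + (s : ℂ) • w) := ⟨_, fun _ => rfl⟩
  have hcont : Continuous g := by
    have h1 : Continuous fun s : ℝ => ψ + (s : ℂ) • w :=
      continuous_const.add (Complex.continuous_ofReal.smul continuous_const)
    have h2 := (Complex.continuous_ofReal.comp
      (continuous_const.div h1.norm fun s => (hpos s).ne' : Continuous fun s : ℝ =>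
        ‖ψ‖ / ‖ψ + (s : ℂ) • w‖)).smul h1
    exact h2.congr fun s => (hg s).symm
  have hg0 : g 0 = ψ := by
    rw [hg, Complex.ofReal_zero, zero_smul, add_zero, div_self hψn.ne', Complex.ofReal_one,
      one_smul]
  obtain ⟨r, hr, hball⟩ := Metric.continuous_iff.1 hcont 0 δ hδ
  refine ⟨r / 2, by positivity, g (r / 2), ?_, ?_, ?_⟩
  · rw [hg, norm_smul, Complex.norm_real, Real.norm_of_nonneg (by positivity),
      div_mul_cancel₀ _ (hpos _).ne']
  · have h1 := hball (r / 2) (by rw [Real.dist_eq, sub_zero, abs_of_pos (by positivity)]; linarith)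
    rw [hg0, dist_eq_norm] at h1
    have h2 := infDist_le_norm_sub ψ (g (r / 2)) (z := 1) (by simp)
    rw [one_smul] at h2
    exact h2.trans_lt h1
  · have h0 : ((‖ψ‖ / ‖ψ + ((r / 2 : ℝ) : ℂ) • w‖ : ℝ) : ℂ) ≠ 0 := by
      exact_mod_cast (div_pos hψn (hpos _)).ne'
    have hm : modulation ψ (g (r / 2)) = ((‖ψ‖ / ‖ψ + ((r / 2 : ℝ) : ℂ) • w‖ : ℝ) : ℂ) := by
      rw [modulation, hg, inner_smul_right, inner_add_right,
        inner_smul_right, hw, mul_zero, add_zero, inner_self_ofReal, mul_div_assoc, div_self hν,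
        mul_one]
    rw [hm, hg, smul_smul, inv_mul_cancel₀ h0, one_smul, add_sub_cancel_left]
    exact ⟨h0, rfl⟩

/-- The velocity of the modulated perturbation. -/
noncomputable def modVelocity (A : EllTwo ι →L[ℂ] EllTwo ι) (C : Finset ι) (σ κ : ℝ)
    (ζ R : EllTwo ι) : EllTwo ι :=
  -(Complex.I • (-(shifted A κ ζ - (κ : ℂ) • restrict C ζ)
        + ((2 * σ * κ : ℝ) : ℂ) • restrict C (reP ζ) + R))

/-- `reP (Complex.I • ζ)` is minus the imaginary part, with which the system reads u' = L₋y, y' =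
L₊u without signs. As it is orthogonal to `ψ`, `linMinus` may be replaced by its invertible version.
-/
theorem reP_modVelocity (hreal : ∀ f, A (reP f) = reP (A f)) (σ κ : ℝ) {ζ : EllTwo ι}
    (hζ : inner ℂ ψ (reP (Complex.I • ζ)) = 0) (R : EllTwo ι) :
    reP (modVelocity A C σ κ ζ R) = linMinusPos A C κ ψ (reP (Complex.I • ζ)) + imP R := by
  have e : imP (-linMinus A C κ ζ) = linMinus A C κ (reP (Complex.I • ζ)) := by
    rw [linMinus_reP hreal, imP, map_smul, smul_neg, neg_neg]
  have e2 : imP (((2 * σ * κ : ℝ) : ℂ) • restrict C (reP ζ)) = 0 := by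
    rw [restrict_reP, ← reP_ofReal_smul, imP_reP]
  rw [linMinusPos_apply, hζ, zero_smul, add_zero, ← e, modVelocity, ← imP, imP_add, imP_add, e2,
    add_zero, linMinus_apply]

theorem reP_I_smul_modVelocity (hreal : ∀ f, A (reP f) = reP (A f)) (σ κ : ℝ) (ζ R : EllTwo ι) :
    reP (Complex.I • modVelocity A C σ κ ζ R) = linPlus A C σ κ (reP ζ) + reP R := by
  rw [modVelocity, reP_I_smul_neg_I_smul, map_add, map_add, ← linMinus_apply, map_neg, ← linMinus_reP hreal,
    reP_ofReal_smul, ← restrict_reP, reP_reP, linPlus_apply, linMinus_apply]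
  push_cast
  module

omit [DecidableEq ι] in
theorem reP_real_sub_imaginary {u : EllTwo ι} (hu : reP u = u) (s μ : ℝ) :
    reP ((s : ℂ) • (u - ((μ : ℂ) * Complex.I) • u)) = (s : ℂ) • u ∧
      reP (Complex.I • (s : ℂ) • (u - ((μ : ℂ) * Complex.I) • u)) = ((s * μ : ℝ) : ℂ) • u := by
  have h1 : reP (Complex.I • u) = 0 := by rw [reP_I_smul, ← hu, imP_reP, neg_zero]
  constructor
  · rw [reP_ofReal_smul, map_sub, mul_smul, reP_ofReal_smul, h1, hu, smul_zero, sub_zero]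
  · have e : Complex.I • (s : ℂ) • (u - ((μ : ℂ) * Complex.I) • u)
        = (s : ℂ) • Complex.I • u + ((s * μ : ℝ) : ℂ) • u := by
      rw [smul_comm, smul_sub, smul_smul, smul_sub, smul_smul, smul_smul, sub_eq_add_neg,
        ← neg_smul]
      congr 2
      push_cast
      linear_combination (-(s : ℂ) * μ) * Complex.I_mul_I
    rw [e, map_add, reP_ofReal_smul, reP_ofReal_smul, h1, hu, smul_zero, zero_add]

omit [DecidableEq ι] in
/-- `exists_escape_radius` for complex operators on `ℓ²`. -/
theorem exists_escape_radius {M N L : EllTwo ι →L[ℂ] EllTwo ι}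
    (hM : ∀ x y, inner ℂ (M x) y = inner ℂ x (M y)) (hN : ∀ x y, inner ℂ (N x) y = inner ℂ x (N y))
    (hL : ∀ x y, inner ℂ (L x) y = inner ℂ x (L y)) (hMN : ∀ x, M (N x) = x)
    {m n : ℝ} (hm : 0 < m) (hn : 0 < n) (hMpos : ∀ x, m * ‖x‖ ^ 2 ≤ (inner ℂ x (M x)).re)
    (hNpos : ∀ x, n * ‖x‖ ^ 2 ≤ (inner ℂ x (N x)).re) {K q c : ℝ} (hK : 0 ≤ K) (hq : 0 < q)
    (hc : 0 < c) :
    ∃ b > 0, ∀ u y r₁ r₂ : ℝ → EllTwo ι,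
      (∀ t, 0 ≤ t → HasDerivAt u (M (y t) + r₁ t) t) →
      (∀ t, 0 ≤ t → HasDerivAt y (L (u t) + r₂ t) t) →
      (∀ t, 0 ≤ t → ‖u t‖ ^ 2 + ‖y t‖ ^ 2 ≤ b →
        ‖r₁ t‖ ≤ K * (‖u t‖ ^ 2 + ‖y t‖ ^ 2) ^ (q + 1 / 2) ∧
        ‖r₂ t‖ ≤ K * (‖u t‖ ^ 2 + ‖y t‖ ^ 2) ^ (q + 1 / 2)) →
      u 0 ≠ 0 → (inner ℂ (y 0) (M (y 0))).re ≤ (inner ℂ (u 0) (L (u 0))).re →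
      c * (inner ℂ (u 0) (N (u 0))).re ≤ (inner ℂ (u 0) (y 0)).re →
      ∃ t, 0 ≤ t ∧ b < ‖u t‖ ^ 2 + ‖y t‖ ^ 2 := by
  have key := _root_.exists_escape_radius (X := EllTwo ι) (M := M.restrictScalars ℝ)
    (N := N.restrictScalars ℝ) (L := L.restrictScalars ℝ) (m := m) (n := n) (C := K) (q := q)
    (c := c)
  simp only [real_inner_eq, ContinuousLinearMap.coe_restrictScalars'] at key
  exact key (fun x y => congrArg _ (hM x y)) (fun x y => congrArg _ (hN x y))
    (fun x y => congrArg _ (hL x y)) hMN hm hn hMpos hNpos hK hq hc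

end EllTwo

/-! ### Orbital instability -/

namespace EllTwo

variable {ι : Type*} [DecidableEq ι] {A : EllTwo ι →L[ℂ] EllTwo ι} {C : Finset ι} {ρ : ℝ}
  {a : ι → ℝ} {ψ : EllTwo ι}

/-- Trajectories on the sphere of `ψ` whose modulated perturbation starts along
`u₀ - iμu₀` cannot stay in a fixed small ball. -/
theorem exists_trapping_radius (hA : IsNonnegSymm A) (hψ : IsCompactSoliton A C ρ a ψ)
    (hreal : ∀ f, A (reP f) = reP (A f)) {σ κ : ℝ} (hσ : 0 < σ) (hκd : κ = ρ ^ σ) {m : ℝ}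
    (hm : κ * m < 1) (hcoer : ∀ ξ, inner ℂ ψ ξ = 0 →
      ‖restrict C ξ‖ ^ 2 ≤ m * (inner ℂ ξ (shifted A κ ξ)).re) {u₀ : EllTwo ι}
    (hu₀re : reP u₀ = u₀)
    (hu₀ : (inner ℂ u₀ (shifted A κ u₀)).re < (2 * σ + 1) * κ * ‖restrict C u₀‖ ^ 2) {K : ℝ}
    (hK : 0 ≤ K) :
    ∃ μ : ℝ, ∃ b > 0, ∀ (ζ R : ℝ → EllTwo ι) (s : ℝ), 0 < s →
      (∀ t, HasDerivAt ζ (modVelocity A C σ κ (ζ t) (R t)) t) →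
      (∀ t, inner ℂ ψ (ζ t) = 0) → (∀ t, ‖R t‖ ≤ K * (‖ζ t‖ ^ min (2 * σ) 1 * ‖ζ t‖)) →
      ζ 0 = (s : ℂ) • (u₀ - ((μ : ℂ) * Complex.I) • u₀) → ∃ t, b < ‖ζ t‖ ^ 2 := by
  have hκ : 0 < κ := hκd ▸ Real.rpow_pos_of_pos hψ.pos σ
  obtain ⟨m₀, hm₀, hMpos⟩ := hψ.exists_linMinusPos_coercive hA hκ hm hcoer
  obtain ⟨N, hMN, hNs, n, hn, hNpos⟩ := exists_coercive_inverse (linMinusPos_symm hA κ) hm₀ hMpos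
  obtain ⟨M, hM⟩ : ∃ M, M = linMinusPos A C κ ψ := ⟨_, rfl⟩
  obtain ⟨L, hL⟩ : ∃ L, L = linPlus A C σ κ := ⟨_, rfl⟩
  rw [← hM] at hMpos hMN
  have hu₀0 : u₀ ≠ 0 := by
    rintro rfl
    simp at hu₀
  have hun : 0 < ‖u₀‖ := norm_pos_iff.2 hu₀0
  have hLpos : 0 < (inner ℂ u₀ (L u₀)).re := by
    rw [hL, re_inner_linPlus]
    linarith
  -- With u(0) = s u₀ and y(0) = s μ u₀, a small `μ` gives the energy condition ⟨y, M y⟩ ≤ ⟨u, L u⟩,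
  -- while any `μ > 0` puts the datum in the growing cone. The `+ 1` is a safe denominator.
  obtain ⟨μ, hμ0, hμ⟩ : ∃ μ > 0, μ ^ 2 * (inner ℂ u₀ (M u₀)).re ≤ (inner ℂ u₀ (L u₀)).re := by
    have h0 : 0 ≤ (inner ℂ u₀ (M u₀)).re := le_trans (by positivity) (hMpos u₀)
    refine ⟨√((inner ℂ u₀ (L u₀)).re / ((inner ℂ u₀ (M u₀)).re + 1)), by positivity, ?_⟩
    rw [Real.sq_sqrt (by positivity), div_mul_eq_mul_div, div_le_iff₀ (by positivity)]
    nlinarith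
  have hN0 : 0 < (inner ℂ u₀ (N u₀)).re := lt_of_lt_of_le (by positivity) (hNpos u₀)
  -- The remainder is of order ‖ζ‖^(1 + min(2σ, 1)), which is (‖ζ‖²)^(q + 1/2).
  obtain ⟨q, hq⟩ : ∃ q, q = min (2 * σ) 1 / 2 := ⟨_, rfl⟩
  have hq0 : 0 < q := by rw [hq]; positivity
  obtain ⟨b, hb, hesc⟩ := exists_escape_radius (K := K)
    -- With this value the cone condition at time 0 is an equality, independently of the scale `s`.
    (c := μ * ‖u₀‖ ^ 2 / (inner ℂ u₀ (N u₀)).re) (M := M) (L := L)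
    (hM ▸ linMinusPos_symm hA κ) hNs (hL ▸ linPlus_symm hA σ κ) hMN hm₀ hn hMpos hNpos hK hq0 (by positivity)
  refine ⟨μ, b, hb, fun ζ R s hs hζ hψζ hR hζ0 => ?_⟩
  have hsq : ∀ t, ‖reP (ζ t)‖ ^ 2 + ‖reP (Complex.I • ζ t)‖ ^ 2 = ‖ζ t‖ ^ 2 := by
    intro t
    rw [reP_I_smul, norm_neg, ← norm_sq_eq_reP_imP]
  have hR' : ∀ t, ‖R t‖ ≤ K * (‖ζ t‖ ^ 2) ^ (q + 1 / 2) := by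
    intro t
    refine (hR t).trans_eq ?_
    rw [← Real.rpow_two, ← Real.rpow_mul (norm_nonneg _),
      show 2 * (q + 1 / 2) = min (2 * σ) 1 + 1 by rw [hq]; ring,
      Real.rpow_add_one' (norm_nonneg _) (by positivity)]
  have hψim : ∀ t, inner ℂ ψ (reP (Complex.I • ζ t)) = 0 := by
    intro t
    rw [hψ.inner_reP, inner_smul_right, hψζ]
    simp
  obtain ⟨hre, him⟩ := reP_real_sub_imaginary hu₀re s μ
  rw [← hζ0] at hre him
  have hre' := fun t => reP_modVelocity (C := C) hreal σ κ (hψim t) (R t)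
  have him' := fun t => reP_I_smul_modVelocity (C := C) hreal σ κ (ζ t) (R t)
  rw [← hM] at hre'
  rw [← hL] at him'
  suffices h : ∃ t, 0 ≤ t ∧ b < ‖reP (ζ t)‖ ^ 2 + ‖reP (Complex.I • ζ t)‖ ^ 2 by
    obtain ⟨t, -, ht⟩ := h
    rw [hsq] at ht
    exact ⟨t, ht⟩
  refine hesc (fun t => reP (ζ t)) (fun t => reP (Complex.I • ζ t))
    (fun t => imP (R t)) (fun t => reP (R t))
    (fun t _ => ?_) (fun t _ => ?_)
    (fun t _ _ => by
      simp only [hsq]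
      exact ⟨(norm_imP_le _).trans (hR' t), (norm_reP_le _).trans (hR' t)⟩)
    ?_ ?_ ?_
  · have h := reP.hasFDerivAt.comp_hasDerivAt t (hζ t)
    rw [hre'] at h
    exact h
  · have h := reP.hasFDerivAt.comp_hasDerivAt t ((hζ t).const_smul Complex.I)
    rw [him'] at h
    exact h
  · simp only [hre]
    exact smul_ne_zero (by exact_mod_cast hs.ne') hu₀0
  · simp only [hre, him, map_smul, inner_smul_left, inner_smul_right, Complex.conj_ofReal,
      Complex.re_ofReal_mul]
    nlinarith [mul_le_mul_of_nonneg_left hμ (sq_nonneg s)]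
  · simp only [hre, him, map_smul, inner_smul_left, inner_smul_right, Complex.conj_ofReal,
      Complex.re_ofReal_mul, re_inner_self]
    refine le_of_eq ?_
    field_simp

/-- Data `ψ + s (u₀ - iμu₀)`, rescaled to the mass of `ψ`, tend to `ψ` as s → 0, but the escape
radius does not depend on `s`. A solution staying near the orbit would keep its modulated
perturbation below that radius. -/
theorem exists_unstable_radius (hA : IsNonnegSymm A) (hψ : IsCompactSoliton A C ρ a ψ)
    (hreal : ∀ f, A (reP f) = reP (A f)) {σ : ℝ} (hσ : 0 < σ) {m : ℝ} (hm : ρ ^ σ * m < 1)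
    (hcoer : ∀ ξ, inner ℂ ψ ξ = 0 →
      ‖restrict C ξ‖ ^ 2 ≤ m * (inner ℂ ξ (shifted A (ρ ^ σ) ξ)).re) {u₀ : EllTwo ι}
    (hu₀re : reP u₀ = u₀) (hu₀ψ : inner ℂ ψ u₀ = 0)
    (hu₀ : (inner ℂ u₀ (shifted A (ρ ^ σ) u₀)).re < (2 * σ + 1) * ρ ^ σ * ‖restrict C u₀‖ ^ 2)
    {E : ℝ} {H : EllTwo ι →L[ℂ] EllTwo ι} (hH : H = (E : ℂ) • ContinuousLinearMap.id ℂ _ - A) :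
    ∃ ε > 0, ∀ δ > 0, ∃ Ψ : ℝ → EllTwo ι, (∀ t, HasDerivAt Ψ (dnlsField H (2 * σ) (Ψ t)) t) ∧
      Metric.infDist (Ψ 0) (phaseCircle ψ) < δ ∧
      ∃ t, ε ≤ Metric.infDist (Ψ t) (phaseCircle ψ) := by
  have hp : 0 ≤ 2 * σ := by positivity
  have hψn : 0 < ‖ψ‖ := norm_pos_iff.2 hψ.ne_zero
  obtain ⟨K, hK, r, hr, hrem⟩ := exists_remainder_bound hψ hσ
  have hHs : ∀ f g, inner ℂ (H f) g = inner ℂ f (H g) := by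
    intro f g
    rw [hH]
    simp only [sub_apply, FunLike.coe_smul, Pi.smul_apply, ContinuousLinearMap.coe_id', id_eq,
      inner_sub_left, inner_sub_right, inner_smul_left, inner_smul_right, Complex.conj_ofReal,
      hA.symm]
  set K' : ℝ := (1 + (‖ψ‖ + 1) / ‖ψ‖) * K with hK'
  obtain ⟨μ, b, hb, hesc⟩ := exists_trapping_radius hA hψ hreal hσ rfl hm hcoer hu₀re hu₀
    (by positivity : 0 ≤ K')
  -- Distance below `ε` bounds the modulated perturbation by `4 ε`; the four bounds keep the
  -- modulation nonzero, the perturbation at most 1, the Taylor remainder valid, and the escape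
  -- radius unreached.
  set ε : ℝ := min (min (‖ψ‖ / 2) (1 / 4)) (min (r / 4) (√b / 4)) with hε
  have hε0 : 0 < ε := by positivity
  have hεψ : ε ≤ ‖ψ‖ / 2 := (min_le_left _ _).trans (min_le_left _ _)
  have hε1 : 4 * ε ≤ 1 := by
    have : ε ≤ 1 / 4 := (min_le_left _ _).trans (min_le_right _ _)
    linarith
  have hεr : 4 * ε ≤ r := by
    have : ε ≤ r / 4 := (min_le_right _ _).trans (min_le_left _ _)
    linarith
  have hεb : 4 * ε ≤ √b := by
    have : ε ≤ √b / 4 := (min_le_right _ _).trans (min_le_right _ _)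
    linarith
  refine ⟨ε, hε0, fun δ hδ => ?_⟩
  have hw : inner ℂ ψ (u₀ - ((μ : ℂ) * Complex.I) • u₀) = 0 := by
    rw [inner_sub_right, inner_smul_right, hu₀ψ, mul_zero, sub_zero]
  obtain ⟨s, hs, f₀, hfn, hfd, hfm, hfζ⟩ := exists_initial_datum hψ.ne_zero hw hδ
  obtain ⟨Ψ, hΨ0, hΨ⟩ := exists_global_solution hHs hp f₀
  refine ⟨Ψ, hΨ, by rwa [hΨ0], ?_⟩
  by_contra hcon
  push Not at hcon
  have hnorm : ∀ t, ‖Ψ t‖ = ‖ψ‖ := by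
    intro t
    rw [norm_eq_of_hasDerivAt hHs hp hΨ, hΨ0, hfn]
  have hest := fun t => modulation_estimates hψ.ne_zero hεψ (hcon t)
  have hζ4 := fun t => (hest t).2
  obtain ⟨t, ht⟩ := hesc (fun t => (modulation ψ (Ψ t))⁻¹ • Ψ t - ψ)
    (fun t => modRemainder C ψ σ (ρ ^ σ) (‖modulation ψ (Ψ t)‖ ^ (2 * σ))
      ((modulation ψ (Ψ t))⁻¹ • Ψ t - ψ)) s hs
    (fun t => hasDerivAt_modulated hA hψ hσ hH (hΨ t) (hest t).1 (ρ ^ σ) rfl)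
    (fun t => inner_modulated hψ.ne_zero (hest t).1)
    (fun t => by
      have h1 := hrem _ ((hζ4 t).trans hεr)
      rw [← norm_modulation_rpow hψ.ne_zero σ (hest t).1 (hnorm t)] at h1
      exact norm_modRemainder_le hψ.ne_zero ((hζ4 t).trans hε1) h1)
    (by rw [← hfζ, ← hΨ0])
  have h1 : ‖(modulation ψ (Ψ t))⁻¹ • Ψ t - ψ‖ ^ 2 ≤ √b ^ 2 := by
    have := (hζ4 t).trans hεb
    gcongr
  rw [Real.sq_sqrt hb.le] at h1
  exact absurd ht (not_lt.2 h1)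

end EllTwo

/-! ### Quadratic forms diagonal in an orthonormal family -/

section Compression

variable {V : Type*} [NormedAddCommGroup V] [InnerProductSpace ℂ V]

/-- A quadratic form that is diagonal in an orthonormal family is bounded by its largest
diagonal entry. -/
theorem re_inner_map_self_le_of_diagonal {G : V →L[ℂ] V} {e : ℕ → V} {s : ℕ}
    (he : ∀ m < s, ∀ n < s, inner ℂ (e m) (e n) = if m = n then 1 else 0)
    (hG : ∀ m < s, ∀ n < s, m ≠ n → inner ℂ (e m) (G (e n)) = 0) {b : ℕ → ℂ} {m : ℝ}
    (hm : ∀ n < s, b n ≠ 0 → (inner ℂ (e n) (G (e n))).re ≤ m) {f : V}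
    (hf : f = ∑ n ∈ Finset.range s, b n • e n) :
    (inner ℂ f (G f)).re ≤ m * ‖f‖ ^ 2 := by
  have h1 : inner ℂ f (G f)
      = ∑ n ∈ Finset.range s, ((‖b n‖ ^ 2 : ℝ) : ℂ) * inner ℂ (e n) (G (e n)) := by
    rw [hf, map_sum, sum_inner]
    refine Finset.sum_congr rfl fun k hk => ?_
    rw [inner_sum, Finset.sum_eq_single_of_mem k hk]
    · rw [map_smul, inner_smul_left, inner_smul_right, ← mul_assoc, Complex.conj_mul']
      norm_cast
    · intro n hn hnk
      rw [map_smul, inner_smul_left, inner_smul_right,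
        hG k (Finset.mem_range.1 hk) n (Finset.mem_range.1 hn) hnk.symm, mul_zero, mul_zero]
  have h2 : ‖f‖ ^ 2 = ∑ n ∈ Finset.range s, ‖b n‖ ^ 2 := by
    rw [← re_inner_self, hf, sum_inner, Complex.re_sum]
    refine Finset.sum_congr rfl fun k hk => ?_
    rw [inner_sum, Finset.sum_eq_single_of_mem k hk]
    · rw [inner_smul_left, inner_smul_right, ← mul_assoc, Complex.conj_mul',
        he k (Finset.mem_range.1 hk) k (Finset.mem_range.1 hk), if_pos rfl, mul_one]
      norm_cast
    · intro n hn hnk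
      rw [inner_smul_left, inner_smul_right,
        he k (Finset.mem_range.1 hk) n (Finset.mem_range.1 hn), if_neg hnk.symm, mul_zero, mul_zero]
  rw [h1, h2, Complex.re_sum, Finset.mul_sum]
  refine Finset.sum_le_sum fun n hn => ?_
  rw [Complex.re_ofReal_mul, mul_comm]
  by_cases hb : b n = 0
  · simp [hb]
  · gcongr
    exact hm n (Finset.mem_range.1 hn) hb

end Compression

namespace EllTwo

variable {ι : Type*}

/-! ### Permutations of the sites -/

/-- The action of a permutation of the sites on wave functions. -/
noncomputable def permute (S : Equiv.Perm ι) : EllTwo ι →L[ℂ] EllTwo ι :=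
  LinearMap.mkContinuous
    { toFun := fun f => ⟨fun x => f (S.symm x), by
        have h := (lp.memℓp f).summable (by norm_num : 0 < (2 : ℝ≥0∞).toReal)
        exact memℓp_gen (S.symm.summable_iff.2 h)⟩
      map_add' := fun f g => by
        ext x
        change (f + g) (S.symm x) = f (S.symm x) + g (S.symm x)
        rw [lp.coeFn_add, Pi.add_apply]
      map_smul' := fun c f => by
        ext x
        change (c • f) (S.symm x) = c • f (S.symm x)
        rw [lp.coeFn_smul, Pi.smul_apply] } 1
    fun f => by
      rw [one_mul]
      refine le_of_sq_le_sq (le_of_eq ?_) (norm_nonneg _)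
      exact (hasSum_norm_sq _).unique
        ((S.symm.hasSum_iff (f := fun x => ‖f x‖ ^ 2)).2 (hasSum_norm_sq f))

theorem permute_apply (S : Equiv.Perm ι) (f : EllTwo ι) (x : ι) :
    permute S f x = f (S.symm x) := rfl

theorem inner_permute (S : Equiv.Perm ι) (f g : EllTwo ι) :
    inner ℂ (permute S f) (permute S g) = inner ℂ f g := by
  rw [lp.inner_eq_tsum, lp.inner_eq_tsum]
  exact S.symm.tsum_eq fun x => inner ℂ (f x) (g x)

/-! ### Functions on a finite orbit -/

variable [DecidableEq ι]

/-- The orbit `{x₀, S x₀, …, S^(s-1) x₀}`. -/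
def orbitSet (S : Equiv.Perm ι) (s : ℕ) (x₀ : ι) : Finset ι :=
  (Finset.range s).image fun j => (S ^ j) x₀

/-- The function with values `c j` at `S^j x₀`. -/
noncomputable def orbitSum (S : Equiv.Perm ι) (s : ℕ) (x₀ : ι) (c : ℕ → ℂ) : EllTwo ι :=
  ∑ j ∈ Finset.range s, lp.single 2 ((S ^ j) x₀) (c j)

/-- The coefficients of the discrete Fourier modes. -/
noncomputable def modeCoeff (s n j : ℕ) : ℂ :=
  ((1 / Real.sqrt s : ℝ) : ℂ) *
      Complex.exp (-(2 * Real.pi * Complex.I * (n : ℂ) * (j : ℂ) / (s : ℂ)))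

variable {S : Equiv.Perm ι} {s : ℕ} {x₀ : ι}

theorem permute_single (x : ι) (c : ℂ) :
    permute S (lp.single 2 x c) = lp.single 2 (S x) c := by
  ext y
  rw [permute_apply, lp.single_apply, lp.single_apply, Pi.single_apply, Pi.single_apply]
  simp only [Equiv.symm_apply_eq]

theorem inner_orbitSum (c : ℕ → ℂ) (f : EllTwo ι) :
    inner ℂ (orbitSum S s x₀ c) f
      = ∑ j ∈ Finset.range s, (starRingEnd ℂ) (c j) * f ((S ^ j) x₀) := by
  rw [orbitSum, sum_inner]
  refine Finset.sum_congr rfl fun j _ => ?_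
  rw [lp.inner_single_left, RCLike.inner_apply, mul_comm]

theorem orbitSum_apply (hinj : Set.InjOn (fun j : ℕ => (S ^ j) x₀) (Set.Iio s)) (c : ℕ → ℂ)
    {k : ℕ} (hk : k < s) : orbitSum S s x₀ c ((S ^ k) x₀) = c k := by
  rw [orbitSum, lp.coeFn_sum, Finset.sum_apply, Finset.sum_eq_single_of_mem k
    (Finset.mem_range.2 hk)]
  · simp [lp.single_apply]
  · intro j hj hjk
    rw [lp.single_apply, Pi.single_apply, if_neg]
    intro h
    exact hjk (hinj (Finset.mem_range.1 hj) hk h.symm)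

theorem orbitSum_apply_of_notMem (c : ℕ → ℂ) {x : ι} (hx : x ∉ orbitSet S s x₀) :
    orbitSum S s x₀ c x = 0 := by
  rw [orbitSum, lp.coeFn_sum, Finset.sum_apply]
  refine Finset.sum_eq_zero fun j hj => ?_
  rw [lp.single_apply, Pi.single_apply, if_neg]
  rintro rfl
  exact hx (Finset.mem_image_of_mem _ hj)

theorem restrict_orbitSum (c : ℕ → ℂ) :
    restrict (orbitSet S s x₀) (orbitSum S s x₀ c) = orbitSum S s x₀ c := by
  ext x
  rw [restrict_apply]
  split_ifs with hx
  · rfl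
  · exact (orbitSum_apply_of_notMem _ hx).symm

theorem restrict_orbitSet (hinj : Set.InjOn (fun j : ℕ => (S ^ j) x₀) (Set.Iio s))
    (f : EllTwo ι) :
    restrict (orbitSet S s x₀) f = orbitSum S s x₀ fun j => f ((S ^ j) x₀) := by
  ext x
  rw [restrict_apply]
  split_ifs with h
  · obtain ⟨j, hj, rfl⟩ := Finset.mem_image.1 h
    exact (orbitSum_apply hinj (fun j => f ((S ^ j) x₀)) (Finset.mem_range.1 hj)).symm
  · exact (orbitSum_apply_of_notMem _ h).symm

theorem modeCoeff_eq (s n j : ℕ) :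
    modeCoeff s n j
      = ((1 / Real.sqrt s : ℝ) : ℂ) * (Complex.exp (2 * Real.pi * Complex.I / s))⁻¹ ^ (n * j) := by
  rw [modeCoeff, ← Complex.exp_neg, ← Complex.exp_nat_mul]
  congr 2
  push_cast
  ring

/-- Moving the support one step along the orbit multiplies the coefficients by a root of unity; the
cyclic sum closes because `S ^ s = 1`. -/
theorem permute_mode (hs : 0 < s) (hS : S ^ s = 1) (n : ℕ) :
    permute S (orbitSum S s x₀ (modeCoeff s n))
      = Complex.exp (2 * Real.pi * Complex.I / s) ^ n • orbitSum S s x₀ (modeCoeff s n) := by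
  have hprim := Complex.isPrimitiveRoot_exp s hs.ne'
  obtain ⟨ω, hω⟩ : ∃ ω, ω = Complex.exp (2 * Real.pi * Complex.I / s) := ⟨_, rfl⟩
  have hω0 : ω ≠ 0 := hω ▸ Complex.exp_ne_zero _
  obtain ⟨g, hg⟩ : ∃ g : ℕ → EllTwo ι, ∀ j, g j = lp.single 2 ((S ^ j) x₀) (modeCoeff s n j) :=
    ⟨_, fun _ => rfl⟩
  have h1 : ∀ j, permute S (g j) = ω ^ n • g (j + 1) := by
    intro j
    rw [hg, hg, permute_single, ← lp.single_smul, smul_eq_mul, modeCoeff_eq, modeCoeff_eq, ← hω,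
      pow_succ' S, Equiv.Perm.mul_apply]
    congr 1
    rw [mul_add, mul_one, pow_add, inv_pow ω n]
    field_simp
  have h2 : g s = g 0 := by
    rw [hg, hg, hS, pow_zero, modeCoeff_eq, modeCoeff_eq, mul_zero, pow_zero, mul_comm n, pow_mul,
      inv_pow, hprim.pow_eq_one, inv_one, one_pow]
  have h3 : orbitSum S s x₀ (modeCoeff s n) = ∑ j ∈ Finset.range s, g j := by
    rw [orbitSum]
    exact Finset.sum_congr rfl fun j _ => (hg j).symm
  have h4 : ∑ j ∈ Finset.range s, g (j + 1) = ∑ j ∈ Finset.range s, g j := by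
    have e1 := Finset.sum_range_succ g s
    have e2 := Finset.sum_range_succ' g s
    rw [e1, h2] at e2
    exact (add_right_cancel e2).symm
  rw [← hω, h3, map_sum, Finset.sum_congr rfl fun j _ => h1 j, ← Finset.smul_sum, h4]

/-- Different discrete Fourier modes are orthogonal for every form that commutes with the
permutation. -/
theorem inner_mode_map_mode_eq_zero (hs : 0 < s) (hS : S ^ s = 1) {G : EllTwo ι →L[ℂ] EllTwo ι}
    (hG : ∀ f, G (permute S f) = permute S (G f)) {m n : ℕ} (hm : m < s) (hn : n < s)
    (hmn : m ≠ n) :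
    inner ℂ (orbitSum S s x₀ (modeCoeff s m)) (G (orbitSum S s x₀ (modeCoeff s n))) = 0 := by
  have hprim := Complex.isPrimitiveRoot_exp s hs.ne'
  have h := inner_permute S (orbitSum S s x₀ (modeCoeff s m))
    (G (orbitSum S s x₀ (modeCoeff s n)))
  rw [← hG, permute_mode hs hS, permute_mode hs hS, map_smul, inner_smul_left, inner_smul_right,
    ← mul_assoc] at h
  by_contra h0
  have h1 := mul_right_cancel₀ h0 (h.trans (one_mul _).symm)
  have h2 : Complex.exp (2 * Real.pi * Complex.I / s) ^ m * 
      (starRingEnd ℂ) (Complex.exp (2 * Real.pi * Complex.I / s) ^ m) = 1 := by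
    rw [Complex.mul_conj', norm_pow, hprim.norm'_eq_one hs.ne']
    simp
  apply hmn
  refine hprim.pow_inj hm hn ?_
  rw [← mul_one (_ ^ m), ← h1, ← mul_assoc, h2, one_mul]

theorem inner_mode_self (hinj : Set.InjOn (fun j : ℕ => (S ^ j) x₀) (Set.Iio s)) (hs : 0 < s) (n : ℕ) :
    inner ℂ (orbitSum S s x₀ (modeCoeff s n)) (orbitSum S s x₀ (modeCoeff s n)) = 1 := by
  rw [inner_orbitSum]
  have hn : ∀ j, ‖modeCoeff s n j‖ = 1 / √s := by
    intro j
    rw [modeCoeff_eq, norm_mul, norm_pow, norm_inv,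
      (Complex.isPrimitiveRoot_exp s hs.ne').norm'_eq_one hs.ne', Complex.norm_real,
      Real.norm_of_nonneg (by positivity)]
    simp
  have h : ∀ j ∈ Finset.range s, (starRingEnd ℂ) (modeCoeff s n j) *
      orbitSum S s x₀ (modeCoeff s n) ((S ^ j) x₀) = ((1 / s : ℝ) : ℂ) := by
    intro j hj
    rw [orbitSum_apply hinj _ (Finset.mem_range.1 hj), Complex.conj_mul', hn]
    norm_cast
    rw [div_pow, one_pow, Real.sq_sqrt (Nat.cast_nonneg s)]
  rw [Finset.sum_congr rfl h, Finset.sum_const, Finset.card_range, nsmul_eq_mul]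
  have : (s : ℂ) ≠ 0 := by exact_mod_cast hs.ne'
  push_cast
  field_simp

theorem inner_mode_mode (hinj : Set.InjOn (fun j : ℕ => (S ^ j) x₀) (Set.Iio s)) (hs : 0 < s)
    (hS : S ^ s = 1) {m n : ℕ} (hm : m < s) (hn : n < s) :
    inner ℂ (orbitSum S s x₀ (modeCoeff s m)) (orbitSum S s x₀ (modeCoeff s n))
      = if m = n then 1 else 0 := by
  split_ifs with h
  · rw [h, inner_mode_self hinj hs]
  · exact inner_mode_map_mode_eq_zero hs hS (G := ContinuousLinearMap.id ℂ _) (fun _ => rfl) hm hn h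

/-- Discrete Fourier inversion. -/
theorem orbitSum_eq_sum_modes (hinj : Set.InjOn (fun j : ℕ => (S ^ j) x₀) (Set.Iio s))
    (hs : 0 < s) (c : ℕ → ℂ) :
    orbitSum S s x₀ c = ∑ n ∈ Finset.range s,
      inner ℂ (orbitSum S s x₀ (modeCoeff s n)) (orbitSum S s x₀ c) •
        orbitSum S s x₀ (modeCoeff s n) := by
  have hprim := Complex.isPrimitiveRoot_exp s hs.ne'
  obtain ⟨ω, hω⟩ : ∃ ω, ω = Complex.exp (2 * Real.pi * Complex.I / s) := ⟨_, rfl⟩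
  rw [← hω] at hprim
  have hω0 : ω ≠ 0 := hω ▸ Complex.exp_ne_zero _
  have hs0 : (s : ℂ) ≠ 0 := by exact_mod_cast hs.ne'
  have hconj : (starRingEnd ℂ) ω = ω⁻¹ := by
    rw [Complex.inv_def, Complex.normSq_eq_norm_sq, hprim.norm'_eq_one hs.ne']
    simp
  have hdelta : ∀ j < s, ∀ k < s, ∑ n ∈ Finset.range s,
      (starRingEnd ℂ) (modeCoeff s n j) * modeCoeff s n k = if j = k then 1 else 0 := by
    intro j hj k hk
    have e : ∀ n, (starRingEnd ℂ) (modeCoeff s n j) * modeCoeff s n k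
        = (1 / s : ℂ) * (ω ^ j * ω⁻¹ ^ k) ^ n := by
      intro n
      rw [modeCoeff_eq, modeCoeff_eq, ← hω, map_mul, map_pow, map_inv₀, hconj, inv_inv,
        Complex.conj_ofReal, mul_pow, ← pow_mul, ← pow_mul, mul_comm j, mul_comm k]
      have : ((1 / √s : ℝ) : ℂ) * ((1 / √s : ℝ) : ℂ) = 1 / s := by
        rw [← Complex.ofReal_mul, div_mul_div_comm, one_mul, Real.mul_self_sqrt (Nat.cast_nonneg s)]
        push_cast
        rfl
      rw [← this]
      ring
    rw [Finset.sum_congr rfl fun n _ => e n, ← Finset.mul_sum]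
    split_ifs with h
    · rw [h, inv_pow, mul_inv_cancel₀ (pow_ne_zero _ hω0)]
      simp [hs0]
    · have h1 : ω ^ j * ω⁻¹ ^ k ≠ 1 := by
        intro h2
        apply h
        refine hprim.pow_inj hj hk ?_
        rw [inv_pow] at h2
        exact mul_inv_eq_one₀ (pow_ne_zero _ hω0) |>.1 h2
      have h2 := mul_geom_sum (ω ^ j * ω⁻¹ ^ k) s
      have h3 : (ω ^ j * ω⁻¹ ^ k) ^ s = 1 := by
        rw [mul_pow, ← pow_mul, ← pow_mul, mul_comm j, mul_comm k, pow_mul, pow_mul, inv_pow,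
          hprim.pow_eq_one]
        simp
      rw [h3, sub_self] at h2
      rw [(mul_eq_zero.1 h2).resolve_left (sub_ne_zero.2 h1), mul_zero]
  ext x
  rw [lp.coeFn_sum, Finset.sum_apply]
  simp only [lp.coeFn_smul, Pi.smul_apply, smul_eq_mul]
  by_cases hx : x ∈ orbitSet S s x₀
  · obtain ⟨k, hk, rfl⟩ := Finset.mem_image.1 hx
    rw [Finset.mem_range] at hk
    rw [orbitSum_apply hinj _ hk]
    have e : ∀ n ∈ Finset.range s,
        inner ℂ (orbitSum S s x₀ (modeCoeff s n)) (orbitSum S s x₀ c) *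
          orbitSum S s x₀ (modeCoeff s n) ((S ^ k) x₀)
        = ∑ j ∈ Finset.range s,
          c j * ((starRingEnd ℂ) (modeCoeff s n j) * modeCoeff s n k) := by
      intro n _
      rw [orbitSum_apply hinj _ hk, inner_orbitSum, Finset.sum_mul]
      refine Finset.sum_congr rfl fun j hj => ?_
      rw [orbitSum_apply hinj _ (Finset.mem_range.1 hj)]
      ring
    rw [Finset.sum_congr rfl e, Finset.sum_comm]
    have e2 : ∀ j ∈ Finset.range s, ∑ n ∈ Finset.range s,
        c j * ((starRingEnd ℂ) (modeCoeff s n j) * modeCoeff s n k) = if j = k then c j else 0 := by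
      intro j hj
      rw [← Finset.mul_sum, hdelta j (Finset.mem_range.1 hj) k hk]
      split_ifs <;> simp
    rw [Finset.sum_congr rfl e2, Finset.sum_ite_eq' , if_pos (Finset.mem_range.2 hk)]
  · rw [orbitSum_apply_of_notMem _ hx]
    refine (Finset.sum_eq_zero fun n _ => ?_).symm
    rw [orbitSum_apply_of_notMem _ hx, mul_zero]

/-- The signs are the Fourier mode of frequency s/2, an integer because `s` is even; the factor √s
undoes the normalization. -/
theorem orbitSum_alternating_eq (hs : Even s) (hs0 : 0 < s) :
    orbitSum S s x₀ (fun j => (-1) ^ j)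
      = ((√s : ℝ) : ℂ) • orbitSum S s x₀ (modeCoeff s (s / 2)) := by
  rw [orbitSum, orbitSum, Finset.smul_sum]
  refine Finset.sum_congr rfl fun j _ => ?_
  rw [← lp.single_smul]
  congr 1
  rw [smul_eq_mul, modeCoeff, ← mul_assoc, ← Complex.ofReal_mul,
    mul_one_div_cancel (by positivity), Complex.ofReal_one, one_mul]
  have h2 : ((s / 2 : ℕ) : ℂ) * 2 = s := by exact_mod_cast Nat.div_mul_cancel hs.two_dvd
  have hs0' : (s : ℂ) ≠ 0 := by exact_mod_cast hs0.ne'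
  have e : -(2 * (Real.pi : ℂ) * Complex.I * ((s / 2 : ℕ) : ℂ) * (j : ℂ) / (s : ℂ))
      = (j : ℂ) * (-(Real.pi * Complex.I)) := by
    have h0 : ((s / 2 : ℕ) : ℂ) ≠ 0 := by
      intro h
      rw [h, zero_mul] at h2
      exact hs0' h2.symm
    rw [← h2]
    field_simp
  rw [e, Complex.exp_nat_mul, Complex.exp_neg, Complex.exp_pi_mul_I]
  norm_num

end EllTwo

/-! ### A uniform strict bound over finitely many modes -/

theorem Finset.exists_pos_upper_bound_lt {α : Type*} (T : Finset α) (F : α → ℝ) {c : ℝ} (hc : 0 < c)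
    (h : ∀ n ∈ T, F n < c) : ∃ b, 0 < b ∧ b < c ∧ ∀ n ∈ T, F n ≤ b := by
  classical
  induction T using Finset.induction_on with
  | empty => exact ⟨c / 2, by positivity, by linarith, by simp⟩
  | insert a T _ ih =>
    obtain ⟨b, hb, hbc, hT⟩ := ih fun n hn => h n (Finset.mem_insert_of_mem hn)
    refine ⟨max b (F a), lt_max_of_lt_left hb, max_lt hbc (h a (Finset.mem_insert_self _ _)), ?_⟩
    intro n hn
    rcases Finset.mem_insert.1 hn with rfl | hn
    · exact le_max_right _ _
    · exact (hT n hn).trans (le_max_left _ _)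

/-! ### The stability dichotomy for the alternating state in terms of the resolvent forms -/

namespace EllTwo

variable {ι : Type*} [DecidableEq ι] {S : Equiv.Perm ι} {s : ℕ} {x₀ : ι}
  {A : EllTwo ι →L[ℂ] EllTwo ι}

/-- The alternating function on an orbit. -/
noncomputable def altWave (S : Equiv.Perm ι) (s : ℕ) (x₀ : ι) : EllTwo ι :=
  orbitSum S s x₀ fun j => (-1) ^ j

/-- The discrete Fourier mode on an orbit. -/
noncomputable def modeWave (S : Equiv.Perm ι) (s : ℕ) (x₀ : ι) (n : ℕ) : EllTwo ι :=
  orbitSum S s x₀ (modeCoeff s n)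

/-- The alternating function on a finite orbit spans the null vectors of `A` among the Fourier
modes of the orbit. -/
structure IsAlternatingGroundState (A : EllTwo ι →L[ℂ] EllTwo ι) (S : Equiv.Perm ι) (s : ℕ)
    (x₀ : ι) : Prop where
  nonnegSymm : IsNonnegSymm A
  real : ∀ f, A (reP f) = reP (A f)
  comm : ∀ f, A (permute S f) = permute S (A f)
  pos : 0 < s
  even : Even s
  pow_eq : S ^ s = 1
  inj : Set.InjOn (fun j : ℕ => (S ^ j) x₀) (Set.Iio s)
  map_eq_zero : A (altWave S s x₀) = 0
  map_modeWave_ne_zero : ∀ n < s, n ≠ s / 2 → A (modeWave S s x₀ n) ≠ 0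

namespace IsAlternatingGroundState

variable (h : IsAlternatingGroundState A S s x₀)
include h

theorem norm_modeWave (n : ℕ) : ‖modeWave S s x₀ n‖ = 1 := by
  have h1 := re_inner_self (modeWave S s x₀ n)
  rw [modeWave, inner_mode_self h.inj h.pos] at h1
  rw [modeWave, ← sq_eq_sq₀ (norm_nonneg _) zero_le_one, ← h1]
  simp

theorem resolventAt_permute {κ : ℝ} (hκ : 0 < κ) (f : EllTwo ι) :
    resolventAt A κ (permute S f) = permute S (resolventAt A κ f) := by
  refine h.nonnegSymm.resolventAt_eq_of_shifted_eq hκ ?_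
  rw [shifted_apply, h.comm, ← map_smul, ← map_add, ← shifted_apply,
    h.nonnegSymm.shifted_resolventAt hκ]

theorem altWave_eq : altWave S s x₀ = ((√s : ℝ) : ℂ) • modeWave S s x₀ (s / 2) :=
  orbitSum_alternating_eq h.even h.pos

theorem inner_altWave_modeWave {n : ℕ} (hn : n < s) (hns : n ≠ s / 2) :
    inner ℂ (altWave S s x₀) (modeWave S s x₀ n) = 0 := by
  rw [h.altWave_eq, inner_smul_left, modeWave, modeWave,
    inner_mode_mode h.inj h.pos h.pow_eq (Nat.div_lt_self h.pos one_lt_two) hn, if_neg hns.symm,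
    mul_zero]

/-- The resolvent commutes with the permutation, so its compression to the orbit is diagonal in the
modes. Orthogonality to the alternating function removes the coefficient of mode s/2, the only mode
that `hF` does not control. -/
theorem norm_restrict_sq_le {κ m : ℝ} (hκ : 0 < κ) (hm : 0 < m)
    (hF : ∀ n < s, n ≠ s / 2 → resolventForm A κ (modeWave S s x₀ n) ≤ κ * m) {ξ : EllTwo ι}
    (hξ : inner ℂ (altWave S s x₀) ξ = 0) :
    ‖restrict (orbitSet S s x₀) ξ‖ ^ 2 ≤ m * (inner ℂ ξ (shifted A κ ξ)).re := by
  refine h.nonnegSymm.norm_sq_le_of_compression hκ hm ?_ ?_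
  · rw [re_inner_symm, re_inner_restrict]
  · have hexp := orbitSum_eq_sum_modes h.inj h.pos fun j => ξ ((S ^ j) x₀)
    rw [← restrict_orbitSet h.inj] at hexp
    refine re_inner_map_self_le_of_diagonal (e := modeWave S s x₀)
      (fun m hm n hn => inner_mode_mode h.inj h.pos h.pow_eq hm hn)
      (fun m hm n hn hmn => inner_mode_map_mode_eq_zero h.pos h.pow_eq
        (h.resolventAt_permute hκ) hm hn hmn) (fun n hn hb => ?_) hexp
    have hns : n ≠ s / 2 := by
      rintro rfl
      apply hb
      have h1 : inner ℂ (altWave S s x₀) (restrict (orbitSet S s x₀) ξ) = 0 := by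
        rw [← restrict_symm, altWave, restrict_orbitSum, ← altWave, hξ]
      rw [h.altWave_eq, inner_smul_left, mul_eq_zero, Complex.conj_ofReal] at h1
      refine h1.resolve_left ?_
      have := h.pos
      exact_mod_cast (by positivity : √(s : ℝ) ≠ 0)
    exact le_of_mul_le_mul_left (hF n hn hns) hκ

theorem isCompactSoliton {ρ : ℝ} (hρ : 0 < ρ) :
    IsCompactSoliton A (orbitSet S s x₀) ρ (fun x => √ρ * (altWave S s x₀ x).re)
      (((√ρ : ℝ) : ℂ) • altWave S s x₀) where
  apply_eq x := by
    rw [lp.coeFn_smul, Pi.smul_apply, smul_eq_mul, Complex.ofReal_mul]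
    congr 1
    by_cases hx : x ∈ orbitSet S s x₀
    · obtain ⟨j, hj, rfl⟩ := Finset.mem_image.1 hx
      rw [altWave, orbitSum_apply h.inj _ (Finset.mem_range.1 hj)]
      rcases neg_one_pow_eq_or ℂ j with e | e <;> simp [e]
    · rw [altWave, orbitSum_apply_of_notMem _ hx]
      simp
  sq_eq x hx := by
    obtain ⟨j, hj, rfl⟩ := Finset.mem_image.1 hx
    rw [altWave, orbitSum_apply h.inj _ (Finset.mem_range.1 hj), mul_pow, Real.sq_sqrt hρ.le]
    rcases neg_one_pow_eq_or ℂ j with e | e <;> simp [e]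
  eq_zero x hx := by
    rw [altWave, orbitSum_apply_of_notMem _ hx]
    simp
  map_eq_zero := by rw [map_smul, h.map_eq_zero, smul_zero]
  ne_zero := by
    have h1 : modeWave S s x₀ (s / 2) ≠ 0 := by
      rw [← norm_ne_zero_iff, h.norm_modeWave]
      exact one_ne_zero
    rw [h.altWave_eq]
    have := h.pos
    exact smul_ne_zero (by exact_mod_cast (by positivity : √ρ ≠ 0))
      (smul_ne_zero (by exact_mod_cast (by positivity : √(s : ℝ) ≠ 0)) h1)
  pos := hρ

variable {E : ℝ} {H : EllTwo ι →L[ℂ] EllTwo ι}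
  (hH : H = (E : ℂ) • ContinuousLinearMap.id ℂ _ - A) {ρ σ : ℝ} (hρ : 0 < ρ) (hσ : 0 < σ)
include hH hρ hσ

/-- The finitely many strict inequalities have a common bound `b < 1 / (2σ + 1)`, and `m = b / κ`
then makes the coercivity constant strict. -/
theorem stable (hF : ∀ n < s, n ≠ s / 2 →
      (2 * σ + 1) * resolventForm A (ρ ^ σ) (modeWave S s x₀ n) < 1) {ε : ℝ} (hε : 0 < ε) :
    ∃ δ > 0, ∀ Ψ : ℝ → EllTwo ι, (∀ t, HasDerivAt Ψ (dnlsField H (2 * σ) (Ψ t)) t) →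
      Metric.infDist (Ψ 0) (phaseCircle (((√ρ : ℝ) : ℂ) • altWave S s x₀)) < δ →
      ∀ t, Metric.infDist (Ψ t) (phaseCircle (((√ρ : ℝ) : ℂ) • altWave S s x₀)) < ε := by
  have hκ : 0 < ρ ^ σ := Real.rpow_pos_of_pos hρ σ
  obtain ⟨b, hb, hb1, hFb⟩ := ((Finset.range s).filter (· ≠ s / 2)).exists_pos_upper_bound_lt
    (fun n => resolventForm A (ρ ^ σ) (modeWave S s x₀ n)) (by positivity : 0 < 1 / (2 * σ + 1))
    (fun n hn => by
      rw [Finset.mem_filter, Finset.mem_range] at hn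
      rw [lt_div_iff₀ (by positivity), mul_comm]
      exact hF n hn.1 hn.2)
  refine exists_stability_radius h.nonnegSymm (h.isCompactSoliton hρ) hσ (m := b / ρ ^ σ) ?_ ?_ hH hε
  · rw [mul_assoc, mul_div_cancel₀ _ hκ.ne']
    rw [lt_div_iff₀ (by positivity)] at hb1
    linarith
  · intro ξ hξ
    refine h.norm_restrict_sq_le hκ (by positivity) (fun n hn hns => ?_) ?_
    · rw [mul_div_cancel₀ _ hκ.ne']
      exact hFb n (by simp [hn, hns])
    · rw [inner_smul_left, mul_eq_zero, Complex.conj_ofReal] at hξ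
      exact hξ.resolve_left (by exact_mod_cast (by positivity : √ρ ≠ 0))

/-- The inequalities F_n < 1 supply the positivity of `linMinus`, and the mode exceeding 1/(2σ+1)
supplies a real direction on which `linPlus` is positive. -/
theorem unstable {n : ℕ} (hn : n < s) (hns : n ≠ s / 2)
    (hF : 1 < (2 * σ + 1) * resolventForm A (ρ ^ σ) (modeWave S s x₀ n)) :
    ∃ ε > 0, ∀ δ > 0, ∃ Ψ : ℝ → EllTwo ι, (∀ t, HasDerivAt Ψ (dnlsField H (2 * σ) (Ψ t)) t) ∧
      Metric.infDist (Ψ 0) (phaseCircle (((√ρ : ℝ) : ℂ) • altWave S s x₀)) < δ ∧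
      ∃ t, ε ≤ Metric.infDist (Ψ t) (phaseCircle (((√ρ : ℝ) : ℂ) • altWave S s x₀)) := by
  have hκ : 0 < ρ ^ σ := Real.rpow_pos_of_pos hρ σ
  have hA := h.nonnegSymm
  obtain ⟨b, hb, hb1, hFb⟩ := ((Finset.range s).filter (· ≠ s / 2)).exists_pos_upper_bound_lt
    (fun n => resolventForm A (ρ ^ σ) (modeWave S s x₀ n)) one_pos
    (fun n hn => by
      rw [Finset.mem_filter, Finset.mem_range] at hn
      have := hA.resolventForm_lt hκ (h.map_modeWave_ne_zero n hn.1 hn.2)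
      rwa [h.norm_modeWave, one_pow] at this)
  have hcoer : ∀ ξ, inner ℂ (((√ρ : ℝ) : ℂ) • altWave S s x₀) ξ = 0 →
      ‖restrict (orbitSet S s x₀) ξ‖ ^ 2 ≤ b / ρ ^ σ * (inner ℂ ξ (shifted A (ρ ^ σ) ξ)).re := by
    intro ξ hξ
    refine h.norm_restrict_sq_le hκ (by positivity) (fun n hn hns => ?_) ?_
    · rw [mul_div_cancel₀ _ hκ.ne']
      exact hFb n (by simp [hn, hns])
    · rw [inner_smul_left, mul_eq_zero, Complex.conj_ofReal] at hξ
      exact hξ.resolve_left (by exact_mod_cast (by positivity : √ρ ≠ 0))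
  have hbm : ρ ^ σ * (b / ρ ^ σ) < 1 := by rwa [mul_div_cancel₀ _ hκ.ne']
  have hsol := h.isCompactSoliton hρ
  suffices ∃ u : EllTwo ι, reP u = u ∧ inner ℂ (((√ρ : ℝ) : ℂ) • altWave S s x₀) u = 0 ∧
      0 < (inner ℂ u (linPlus A (orbitSet S s x₀) σ (ρ ^ σ) u)).re by
    obtain ⟨u, hu1, hu2, hu3⟩ := this
    rw [re_inner_linPlus] at hu3
    exact exists_unstable_radius hA hsol h.real hσ hbm hcoer hu1 hu2
      (by linarith) hH
  -- At f = (A + κ)⁻¹e_n, with g = ⟨e_n, f⟩ = F_n/κ, one has ‖χf‖ ≥ g, so the form of L₊ is at least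
  -- g((2σ+1)F_n − 1) > 0.
  obtain ⟨f, hf⟩ : ∃ f, f = resolventAt A (ρ ^ σ) (modeWave S s x₀ n) := ⟨_, rfl⟩
  have hfe : shifted A (ρ ^ σ) f = modeWave S s x₀ n := by rw [hf, hA.shifted_resolventAt hκ]
  have horth : inner ℂ (((√ρ : ℝ) : ℂ) • altWave S s x₀) f = 0 := by
    have h1 : inner ℂ (altWave S s x₀) f = 0 := by
      have h2 := h.inner_altWave_modeWave hn hns
      rw [← hfe, ← hA.shifted_symm, shifted_apply, h.map_eq_zero, zero_add, inner_smul_left,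
        mul_eq_zero, Complex.conj_ofReal] at h2
      exact h2.resolve_left (by exact_mod_cast hκ.ne')
    rw [inner_smul_left, h1, mul_zero]
  have hmode : restrict (orbitSet S s x₀) (modeWave S s x₀ n) = modeWave S s x₀ n :=
    restrict_orbitSum _
  have hpos : 0 < (inner ℂ f (linPlus A (orbitSet S s x₀) σ (ρ ^ σ) f)).re := by
    rw [re_inner_linPlus, hfe, re_inner_symm]
    obtain ⟨g, hg⟩ : ∃ g, g = (inner ℂ (modeWave S s x₀ n) f).re := ⟨_, rfl⟩
    rw [resolventForm, ← hf, ← hg] at hF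
    have h1 : |g| ≤ ‖restrict (orbitSet S s x₀) f‖ := by
      rw [hg]
      refine (Complex.abs_re_le_norm _).trans ?_
      rw [← hmode, restrict_symm]
      refine (norm_inner_le_norm _ _).trans_eq ?_
      rw [h.norm_modeWave, one_mul]
    have h2 : g ^ 2 ≤ ‖restrict (orbitSet S s x₀) f‖ ^ 2 := by
      rw [← sq_abs]
      gcongr
    have hg0 : 0 < g := by
      by_contra hcon
      have : (2 * σ + 1) * (ρ ^ σ * g) ≤ 0 :=
        mul_nonpos_of_nonneg_of_nonpos (by positivity)
          (mul_nonpos_of_nonneg_of_nonpos hκ.le (not_lt.1 hcon))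
      linarith
    rw [← hg]
    have h3 : (2 * σ + 1) * ρ ^ σ * g ^ 2
        ≤ (2 * σ + 1) * ρ ^ σ * ‖restrict (orbitSet S s x₀) f‖ ^ 2 := by gcongr
    nlinarith
  have hlin : ∀ f, linPlus A (orbitSet S s x₀) σ (ρ ^ σ) (reP f)
      = reP (linPlus A (orbitSet S s x₀) σ (ρ ^ σ) f) := by
    intro f
    rw [linPlus_apply, linPlus_apply, shifted_reP h.real, map_sub, reP_ofReal_smul, restrict_reP]
  rw [re_inner_map_self_split hlin (linPlus_symm hA σ _)] at hpos
  -- `f` is complex in general, but the form is the sum of its values at the real and imaginary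
  -- parts, so one of them is a positive direction.
  by_cases hc : 0 < (inner ℂ (reP f) (linPlus A (orbitSet S s x₀) σ (ρ ^ σ) (reP f))).re
  · exact ⟨reP f, reP_reP f, by rw [hsol.inner_reP, horth]; simp, hc⟩
  · refine ⟨imP f, reP_imP f, ?_, by linarith⟩
    rw [imP, hsol.inner_reP, inner_neg_right, inner_smul_right, horth]
    simp

end IsAlternatingGroundState

end EllTwo

/-! ### The lattice Laplacian as an instance of the abstract setting -/

namespace WeightedMultiLattice

open EllTwo

variable {d : ℕ} (L : WeightedMultiLattice d)

theorem negLaplacian_eq_sum (f : L.Wave) (x : L.Sites) :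
    L.negLaplacian f x = (∑ y ∈ L.nbrs x, (L.w x y : ℂ)) * f x
      - ∑ y ∈ L.nbrs x, (L.w x y : ℂ) * f y := by
  rw [negLaplacian_apply, lap_eq_sum, Finset.sum_mul, ← Finset.sum_sub_distrib,
    ← Finset.sum_neg_distrib]
  exact Finset.sum_congr rfl fun y _ => by ring

theorem negLaplacian_single [DecidableEq L.Sites] (x : L.Sites) :
    L.negLaplacian (lp.single 2 x 1)
      = (∑ y ∈ L.nbrs x, (L.w x y : ℂ)) • lp.single 2 x (1 : ℂ)
        - ∑ y ∈ L.nbrs x, (L.w x y : ℂ) • lp.single 2 y (1 : ℂ) := by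
  ext z
  rw [negLaplacian_eq_sum, lp.coeFn_sub, Pi.sub_apply, lp.coeFn_smul, Pi.smul_apply, lp.coeFn_sum,
    Finset.sum_apply]
  simp only [lp.coeFn_smul, Pi.smul_apply, lp.single_apply, Pi.single_apply, smul_eq_mul,
    mul_ite, mul_one, mul_zero, Finset.sum_ite_eq, Finset.sum_ite_eq']
  congr 1
  · split_ifs with h
    · rw [h]
    · rfl
  · by_cases h : L.w x z = 0
    · rw [L.w_symm] at h
      simp [h, L.w_symm x z]
    · rw [if_pos ((L.mem_nbrs z x).2 (L.w_symm x z ▸ h)), if_pos ((L.mem_nbrs x z).2 h), L.w_symm]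

/-- Both sides are continuous linear in `g`, so it suffices to test on delta functions; there only
the symmetry of the weights is used. -/
theorem negLaplacian_symm (f g : L.Wave) :
    inner ℂ (L.negLaplacian f) g = inner ℂ f (L.negLaplacian g) := by
  classical
  have h : innerSL ℂ (L.negLaplacian f) = (innerSL ℂ f).comp L.negLaplacian := by
    refine lp.ext_continuousLinearMap (by norm_num) fun x => ?_
    ext
    change inner ℂ (L.negLaplacian f) (lp.single 2 x (1 : ℂ))
      = inner ℂ f (L.negLaplacian (lp.single 2 x (1 : ℂ)))
    rw [negLaplacian_single, inner_sub_right, inner_smul_right, inner_sum]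
    simp only [inner_smul_right, lp.inner_single_right, RCLike.inner_apply, one_mul]
    rw [negLaplacian_eq_sum]
    simp
  exact DFunLike.congr_fun h g

theorem isSelfAdjoint_negLaplacian : IsSelfAdjoint L.negLaplacian :=
  ContinuousLinearMap.isSelfAdjoint_iff_isSymmetric.2 L.negLaplacian_symm

theorem negLaplacian_reP (f : L.Wave) : L.negLaplacian (reP f) = reP (L.negLaplacian f) := by
  ext x
  simp only [reP_apply, negLaplacian_apply, lap_eq_sum, Complex.neg_re, Complex.re_sum,
    Complex.re_ofReal_mul, Complex.sub_re]
  push_cast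
  rfl

theorem negLaplacian_permute {S : Equiv.Perm L.Sites} (hS : ∀ x y, L.w (S x) (S y) = L.w x y)
    (f : L.Wave) : L.negLaplacian (permute S f) = permute S (L.negLaplacian f) := by
  ext x
  rw [permute_apply, negLaplacian_apply, negLaplacian_apply, lap, lap]
  congr 1
  refine (finsum_eq_of_bijective S S.bijective fun y => ?_).symm
  rw [permute_apply, permute_apply, S.symm_apply_apply]
  have := hS (S.symm x) y
  rw [S.apply_symm_apply] at this
  rw [this]

/-- The operator `E + Δ`, nonnegative when `E` is the top of the spectrum of `-Δ`. -/
noncomputable def gap (E : ℝ) : L.Wave →L[ℂ] L.Wave :=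
  (E : ℂ) • ContinuousLinearMap.id ℂ L.Wave - L.negLaplacian

theorem gap_apply (E : ℝ) (f : L.Wave) : L.gap E f = (E : ℂ) • f - L.negLaplacian f := rfl

variable {L}

theorem gap_isNonnegSymm {E : ℝ} (hE : IsGreatest (spectrum ℝ L.negLaplacian) E) :
    IsNonnegSymm (L.gap E) where
  symm f g := by
    rw [gap_apply, gap_apply, inner_sub_left, inner_sub_right, inner_smul_left, inner_smul_right,
      negLaplacian_symm, Complex.conj_ofReal]
  nonneg f := by
    refine nonneg_of_spectrum_le L.isSelfAdjoint_negLaplacian (fun r hr => ?_) f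
    by_contra hcon
    refine absurd (hE.2 (show r ∈ spectrum ℝ L.negLaplacian from fun hu => hcon ?_)) (not_le.2 hr)
    have e : algebraMap ℝ (L.Wave →L[ℂ] L.Wave) r = (r : ℂ) • 1 := by
      rw [Algebra.algebraMap_eq_smul_one]
      ext f x
      rfl
    rwa [spectrum.mem_resolventSet_iff, e] at hu

theorem mem_flatEigenspace_iff (E : ℝ) (f : L.Wave) : f ∈ L.flatEigenspace E ↔ L.gap E f = 0 := by
  rw [gap_apply, sub_eq_zero, eq_comm]
  change L.negLaplacian f - (E : ℂ) • f = 0 ↔ _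
  rw [sub_eq_zero]

variable {E : ℝ} {S : Equiv.Perm L.Sites} {s : ℕ} {x₀ : L.Sites}

open scoped Classical in
theorem alternating_eq_altWave (S : Equiv.Perm L.Sites) (s : ℕ) (x₀ : L.Sites) :
    L.alternating S s x₀ = altWave S s x₀ := rfl

open scoped Classical in
theorem orbitMode_eq_modeWave (S : Equiv.Perm L.Sites) (s : ℕ) (x₀ : L.Sites) :
    L.orbitMode S s x₀ = modeWave S s x₀ := rfl

open scoped Classical in
-- The essential point is the last field: a mode annihilated by the gap operator would, by
-- minimality, be a multiple of the alternating function, hence of mode s/2, contradicting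
-- orthogonality of distinct modes.
theorem IsMinimalCompactState.isAlternatingGroundState (hS : L.IsMinimalCompactState E S s x₀)
    (hE : IsGreatest (spectrum ℝ L.negLaplacian) E) :
    IsAlternatingGroundState (L.gap E) S s x₀ where
  nonnegSymm := gap_isNonnegSymm hE
  real f := by rw [gap_apply, gap_apply, map_sub, reP_ofReal_smul, negLaplacian_reP]
  comm f := by rw [gap_apply, gap_apply, map_sub, map_smul, negLaplacian_permute L hS.w_invariant]
  pos := hS.s_pos
  even := hS.s_even
  pow_eq := hS.order_eq ▸ pow_orderOf_eq_one S
  inj := hS.orbit_distinct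
  map_eq_zero := by rw [gap_apply, ← alternating_eq_altWave, hS.eigen, sub_self]
  map_modeWave_ne_zero n hn hns hzero := by
    have hpow : S ^ s = 1 := hS.order_eq ▸ pow_orderOf_eq_one S
    have hmem : modeWave S s x₀ n ∈ Submodule.span ℂ {L.alternating S s x₀} := by
      refine hS.minimal _ ?_ fun x hx => ?_
      · rw [gap_apply, sub_eq_zero] at hzero
        exact hzero.symm
      · have hx' : x ∈ orbitSet S s x₀ := by
          by_contra hcon
          exact hx (orbitSum_apply_of_notMem _ hcon)
        obtain ⟨j, hj, rfl⟩ := Finset.mem_image.1 hx'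
        rw [Function.mem_support, alternating_eq_altWave, altWave,
          orbitSum_apply hS.orbit_distinct _ (Finset.mem_range.1 hj)]
        exact pow_ne_zero _ (by norm_num)
    obtain ⟨c, hc⟩ := Submodule.mem_span_singleton.1 hmem
    rw [alternating_eq_altWave, altWave, orbitSum_alternating_eq hS.s_even hS.s_pos] at hc
    have h1 := inner_mode_mode hS.orbit_distinct hS.s_pos hpow hn
      (Nat.div_lt_self hS.s_pos one_lt_two)
    rw [if_neg hns] at h1
    have h2 := inner_mode_mode hS.orbit_distinct hS.s_pos hpow hn hn
    rw [if_pos rfl, ← modeWave] at h2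
    nth_rewrite 2 [← hc] at h2
    rw [inner_smul_right, inner_smul_right, modeWave, h1, mul_zero, mul_zero] at h2
    exact zero_ne_one h2

theorem isDNLSSolution_iff {σ : ℝ} (hσ : 0 < σ) (Ψ : ℝ → L.Wave) :
    L.IsDNLSSolution σ Ψ
      ↔ ∀ t, HasDerivAt Ψ (dnlsField L.negLaplacian (2 * σ) (Ψ t)) t := by
  have hp : 0 ≤ 2 * σ := by positivity
  have key : ∀ f D : L.Wave, (∀ x, Complex.I * D x =
      L.negLaplacian f x + ((‖f x‖ ^ (2 * σ) : ℝ) : ℂ) * f x)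
        ↔ D = dnlsField L.negLaplacian (2 * σ) f := by
    intro f D
    have e : ∀ x, dnlsField L.negLaplacian (2 * σ) f x
        = -(Complex.I * (L.negLaplacian f x + ((‖f x‖ ^ (2 * σ) : ℝ) : ℂ) * f x)) := by
      intro x
      simp only [dnlsField, lp.coeFn_neg, lp.coeFn_smul, lp.coeFn_add, Pi.neg_apply, Pi.smul_apply,
        Pi.add_apply, smul_eq_mul, nl_apply hp, powNL]
    constructor
    · intro h
      ext x
      rw [e, ← h x, ← mul_assoc, Complex.I_mul_I]
      ring
    · rintro rfl x
      rw [e, mul_neg, ← mul_assoc, Complex.I_mul_I]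
      ring
  refine forall_congr' fun t => ⟨?_, fun h => ⟨_, h, (key _ _).2 rfl⟩⟩
  rintro ⟨D, hD, hx⟩
  rwa [← (key _ _).1 hx]

theorem phaseOrbit_eq_phaseCircle (ψ : L.Wave) : L.phaseOrbit ψ = phaseCircle ψ := by
  ext f
  constructor
  · rintro ⟨θ, -, rfl⟩
    refine ⟨Complex.exp (Complex.I * θ), ?_, rfl⟩
    rw [Set.mem_ofPred_eq, mul_comm, Complex.norm_exp_ofReal_mul_I]
  · rintro ⟨z, hz, rfl⟩
    rw [Set.mem_ofPred_eq] at hz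
    have hz' : Complex.exp (Complex.arg z * Complex.I) = z := by
      have := Complex.norm_mul_exp_arg_mul_I z
      rwa [hz, Complex.ofReal_one, one_mul] at this
    refine ⟨toIcoMod Real.two_pi_pos 0 z.arg, ?_, ?_⟩
    · have := toIcoMod_mem_Ico Real.two_pi_pos 0 z.arg
      rwa [zero_add] at this
    · change Complex.exp _ • ψ = z • ψ
      congr 1
      rw [toIcoMod, zsmul_eq_mul]
      conv_rhs => rw [← hz']
      rw [Complex.exp_eq_exp_iff_exists_int]
      refine ⟨-toIcoDiv Real.two_pi_pos 0 z.arg, ?_⟩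
      push_cast
      ring

theorem phaseCircle_smul {z : ℂ} (hz : ‖z‖ = 1) (ψ : L.Wave) :
    phaseCircle (z • ψ) = phaseCircle ψ := by
  have hz0 : z ≠ 0 := by
    rintro rfl
    simp at hz
  ext f
  constructor
  · rintro ⟨w, hw, rfl⟩
    refine ⟨w * z, ?_, mul_smul _ _ _⟩
    rw [Set.mem_ofPred_eq] at hw ⊢
    rw [norm_mul, hw, hz, one_mul]
  · rintro ⟨w, hw, rfl⟩
    refine ⟨w * z⁻¹, ?_, ?_⟩
    · rw [Set.mem_ofPred_eq] at hw ⊢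
      rw [norm_mul, norm_inv, hw, hz, inv_one, one_mul]
    · change (w * z⁻¹) • z • ψ = w • ψ
      rw [smul_smul, inv_mul_cancel_right₀ hz0]

end WeightedMultiLattice

/-! ### Threshold power and critical exponent -/

/-- Strictly increasing profiles that tend to `1` cross a level below `1` at a common threshold. -/
theorem exists_common_threshold {T : Finset ℕ} (hT : T.Nonempty) {F : ℕ → ℝ → ℝ} {p : ℕ → ℝ}
    (hmono : ∀ n ∈ T, ∀ κ κ', 0 < κ → κ < κ' → F n κ < F n κ')
    (hzero : ∀ n ∈ T, ∀ η > 0, ∃ κ₀ > 0, ∀ κ, 0 < κ → κ < κ₀ → F n κ < p n + η) {K : ℝ}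
    (htop : ∀ n ∈ T, ∀ κ, 0 < κ → 1 - F n κ ≤ K / κ) {c : ℝ} (hc : c < 1)
    (hp : ∀ n ∈ T, p n < c) :
    ∃ κ₁ > 0, (∀ κ, 0 < κ → κ < κ₁ → ∀ n ∈ T, F n κ < c) ∧
      ∀ κ, κ₁ < κ → ∃ n ∈ T, c < F n κ := by
  set Z : Set ℝ := {κ | 0 < κ ∧ ∀ n ∈ T, F n κ < c} with hZ
  have hbdd : BddAbove Z := by
    obtain ⟨n, hn⟩ := hT
    refine ⟨K / (1 - c), fun κ hκ => ?_⟩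
    have h1 := htop n hn κ hκ.1
    have h2 := hκ.2 n hn
    rw [le_div_iff₀ (by linarith)]
    rw [le_div_iff₀ hκ.1] at h1
    nlinarith [hκ.1]
  have hne : ∃ κ, κ ∈ Z := by
    have h1 : ∃ κ₀ > 0, ∀ κ, 0 < κ → κ < κ₀ → ∀ n ∈ T, F n κ < c := by
      have : ∀ n ∈ T, ∀ᶠ κ in nhdsWithin (0 : ℝ) (Set.Ioi 0), F n κ < c := by
        intro n hn
        obtain ⟨κ₀, hκ₀, h⟩ := hzero n hn (c - p n) (by linarith [hp n hn])
        filter_upwards [Ioo_mem_nhdsGT hκ₀] with κ hκ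
        have := h κ hκ.1 hκ.2
        linarith
      have h2 := (Filter.eventually_all_finset T).2 this
      obtain ⟨κ₀, hκ₀, h⟩ := (mem_nhdsGT_iff_exists_Ioo_subset).1 h2
      exact ⟨κ₀, hκ₀, fun κ h1 h2 => h ⟨h1, h2⟩⟩
    obtain ⟨κ₀, hκ₀, h⟩ := h1
    exact ⟨κ₀ / 2, by positivity, h _ (by positivity) (by linarith)⟩
  obtain ⟨κ₀, hκ₀⟩ := hne
  have hpos : 0 < sSup Z := hκ₀.1.trans_le (le_csSup hbdd hκ₀)
  refine ⟨sSup Z, hpos, fun κ hκ hlt n hn => ?_, fun κ hlt => ?_⟩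
  · obtain ⟨κ', hκ', hlt'⟩ := exists_lt_of_lt_csSup ⟨κ₀, hκ₀⟩ hlt
    exact (hmono n hn κ κ' hκ hlt').trans (hκ'.2 n hn)
  -- Failure at an intermediate κ' only gives `c ≤ F n κ'`; strict monotonicity up to κ makes it
  -- strict.
  · obtain ⟨κ', h1, h2⟩ := exists_between hlt
    have h3 : κ' ∉ Z := fun h => (le_csSup hbdd h).not_gt h1
    have h4 : ¬ ∀ n ∈ T, F n κ' < c := fun h => h3 ⟨hpos.trans h1, h⟩
    push Not at h4
    obtain ⟨n, hn, hle⟩ := h4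
    exact ⟨n, hn, hle.trans_lt (hmono n hn κ' κ (hpos.trans h1) h2)⟩

/-- A decreasing criterion on exponents defines a critical exponent. -/
theorem exists_critical_exponent {P : ℝ → Prop} (hP : ∃ σ > 0, P σ)
    (hanti : ∀ σ σ', 0 < σ → σ < σ' → P σ' → P σ) :
    ∃ σcr : EReal, 0 < σcr ∧ (∀ σ : ℝ, 0 < σ → (σ : EReal) < σcr → P σ) ∧
      ∀ σ : ℝ, σcr < (σ : EReal) → 0 < σ ∧ ¬ P σ := by
  -- The supremum is taken in the extended reals, so it is `⊤` when the criterion holds for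
  -- arbitrarily large exponents.
  set Z : Set EReal := {x | ∃ σ : ℝ, 0 < σ ∧ P σ ∧ x = σ} with hZ
  have h0 : 0 < sSup Z := by
    obtain ⟨σ, hσ, h⟩ := hP
    exact (EReal.coe_pos.2 hσ).trans_le (le_sSup ⟨σ, hσ, h, rfl⟩)
  refine ⟨sSup Z, h0, fun σ hσ hlt => ?_, fun σ hlt => ?_⟩
  · obtain ⟨_, ⟨σ', -, h', rfl⟩, hlt'⟩ := lt_sSup_iff.1 hlt
    exact hanti σ σ' hσ (EReal.coe_lt_coe_iff.1 hlt') h'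
  · have hσ : 0 < σ := EReal.coe_pos.1 (h0.trans hlt)
    exact ⟨hσ, fun h => (le_sSup (show (σ : EReal) ∈ Z from ⟨σ, hσ, h, rfl⟩)).not_gt hlt⟩

/-! ### Transfer of the dichotomy to the states of given power -/

namespace WeightedMultiLattice

open EllTwo

variable {d : ℕ} {L : WeightedMultiLattice d} {E : ℝ} {S : Equiv.Perm L.Sites} {s : ℕ}
  {x₀ : L.Sites}

theorem IsOrbitallyStable.not_isOrbitallyUnstable {σ : ℝ} {ψ : L.Wave}
    (h : L.IsOrbitallyStable σ ψ) : ¬ L.IsOrbitallyUnstable σ ψ := by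
  rintro ⟨ε, hε, hu⟩
  obtain ⟨δ, hδ, hs⟩ := h ε hε
  obtain ⟨Ψ, hΨ, hlt, t, ht⟩ := hu δ hδ
  exact absurd ((hs _ hlt).2 Ψ hΨ rfl t) (not_lt.2 ht)

theorem power_eq_norm_sq (φ : L.Wave) : L.power φ = ‖φ‖ ^ 2 :=
  (hasSum_norm_sq φ).tsum_eq

theorem negLaplacian_eq_sub_gap (E : ℝ) :
    L.negLaplacian = (E : ℂ) • ContinuousLinearMap.id ℂ _ - L.gap E := by
  rw [gap, sub_sub_cancel]

section

variable (hS : L.IsMinimalCompactState E S s x₀) (hE : IsGreatest (spectrum ℝ L.negLaplacian) E)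
include hS hE

/-- The orbit depends only on the modulus of the amplitude, which the power determines as √(ν/s);
the phase of `a` is immaterial. -/
theorem IsMinimalCompactState.phaseOrbit_eq {ψ : L.Wave} {a : ℂ}
    (ha : ψ = a • L.alternating S s x₀) (hν : 0 < L.power ψ) :
    L.phaseOrbit ψ = phaseCircle (((√(L.power ψ / s) : ℝ) : ℂ) • L.alternating S s x₀) := by
  classical
  have h := hS.isAlternatingGroundState hE
  have hs : 0 < (s : ℝ) := by exact_mod_cast hS.s_pos
  have h1 : L.power ψ = ‖a‖ ^ 2 * s := by
    rw [power_eq_norm_sq, ha, alternating_eq_altWave, h.altWave_eq, norm_smul, norm_smul,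
      h.norm_modeWave, Complex.norm_real, Real.norm_of_nonneg (Real.sqrt_nonneg _), mul_one,
      mul_pow, Real.sq_sqrt hs.le]
  have h2 : √(L.power ψ / s) = ‖a‖ := by
    rw [h1, mul_div_cancel_right₀ _ hs.ne', Real.sqrt_sq (norm_nonneg _)]
  have ha0 : (‖a‖ : ℂ) ≠ 0 := by
    intro h0
    rw [h1, Complex.ofReal_eq_zero.1 h0] at hν
    simp at hν
  have h3 : ψ = (a / ‖a‖) • ((‖a‖ : ℂ) • L.alternating S s x₀) := by
    rw [smul_smul, div_mul_cancel₀ _ ha0, ha]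
  rw [h2, phaseOrbit_eq_phaseCircle]
  conv_lhs => rw [h3]
  refine phaseCircle_smul ?_ _
  rw [norm_div, Complex.norm_real, norm_norm, div_self]
  exact fun h0 => ha0 (by rw [h0, Complex.ofReal_zero])

theorem IsMinimalCompactState.isOrbitallyStable {ψ : L.Wave} {a : ℂ}
    (ha : ψ = a • L.alternating S s x₀) (hν : 0 < L.power ψ) {σ : ℝ} (hσ : 0 < σ)
    (hF : ∀ n < s, n ≠ s / 2 →
      (2 * σ + 1) * resolventForm (L.gap E) ((L.power ψ / s) ^ σ) (L.orbitMode S s x₀ n) < 1) :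
    L.IsOrbitallyStable σ ψ := by
  classical
  have h := hS.isAlternatingGroundState hE
  have hs : 0 < (s : ℝ) := by exact_mod_cast hS.s_pos
  intro ε hε
  obtain ⟨δ, hδ, hst⟩ := h.stable (negLaplacian_eq_sub_gap E) (div_pos hν hs) hσ
    (by rw [← orbitMode_eq_modeWave]; exact hF) hε
  rw [← alternating_eq_altWave, ← hS.phaseOrbit_eq hE ha hν] at hst
  refine ⟨δ, hδ, fun φ₀ hφ₀ => ⟨?_, ?_⟩⟩
  · obtain ⟨Ψ, hΨ0, hΨ⟩ := exists_global_solution L.negLaplacian_symm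
      (by positivity : 0 ≤ 2 * σ) φ₀
    exact ⟨Ψ, (isDNLSSolution_iff hσ Ψ).2 hΨ, hΨ0⟩
  · rintro Ψ hΨ rfl
    exact hst Ψ ((isDNLSSolution_iff hσ Ψ).1 hΨ) hφ₀

theorem IsMinimalCompactState.isOrbitallyUnstable {ψ : L.Wave} {a : ℂ}
    (ha : ψ = a • L.alternating S s x₀) (hν : 0 < L.power ψ) {σ : ℝ} (hσ : 0 < σ) {n : ℕ}
    (hn : n < s) (hns : n ≠ s / 2)
    (hF : 1 < (2 * σ + 1) *
      resolventForm (L.gap E) ((L.power ψ / s) ^ σ) (L.orbitMode S s x₀ n)) :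
    L.IsOrbitallyUnstable σ ψ := by
  classical
  have h := hS.isAlternatingGroundState hE
  have hs : 0 < (s : ℝ) := by exact_mod_cast hS.s_pos
  obtain ⟨ε, hε, hst⟩ := h.unstable (negLaplacian_eq_sub_gap E) (div_pos hν hs) hσ hn hns
    (by rw [← orbitMode_eq_modeWave]; exact hF)
  rw [← alternating_eq_altWave, ← hS.phaseOrbit_eq hE ha hν] at hst
  refine ⟨ε, hε, fun δ hδ => ?_⟩
  obtain ⟨Ψ, hΨ, h'⟩ := hst δ hδ
  exact ⟨Ψ, (isDNLSSolution_iff hσ Ψ).2 hΨ, h'⟩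

end

end WeightedMultiLattice

/-! ### The stability theorem -/

theorem theorem1 {d : ℕ} (L : WeightedMultiLattice d) (E_F : ℝ) (hflat : L.HasFlatBandAtTop E_F)
    (S : Equiv.Perm L.Sites) (s : ℕ) (x₀ : L.Sites)
    (hS : L.IsMinimalCompactState E_F S s x₀)
    (ψ : ℝ → L.Wave)
    (hψ : ∀ ν > 0, (∃ a : ℂ, ψ ν = a • L.alternating S s x₀) ∧ L.power (ψ ν) = ν) :
    (∃ σcr : EReal, 0 < σcr ∧
      (∀ σ : ℝ, 0 < σ → (σ : EReal) < σcr →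
        ∃ Nthr : ℝ, 0 < Nthr ∧
          (∀ ν, 0 < ν → ν < Nthr → L.IsOrbitallyStable σ (ψ ν)) ∧
          (∀ ν, Nthr < ν → L.IsOrbitallyUnstable σ (ψ ν))) ∧
      (∀ σ : ℝ, σcr < (σ : EReal) → ∀ ν, 0 < ν → L.IsOrbitallyUnstable σ (ψ ν))) ∧
    (∀ σ : ℝ, 0 < σ →
      ((∃ ν₀ > 0, ∀ ν, 0 < ν → ν < ν₀ → L.IsOrbitallyStable σ (ψ ν)) ↔
        L.SpectralCriterion E_F S s x₀ σ) ∧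
      (¬ L.SpectralCriterion E_F S s x₀ σ →
        ∀ ν, 0 < ν → L.IsOrbitallyUnstable σ (ψ ν))) := by
  classical
  have hE := hflat.2
  have h := hS.isAlternatingGroundState hE
  have hA := h.nonnegSymm
  have hs : 0 < (s : ℝ) := by exact_mod_cast hS.s_pos
  have hne : ∀ n < s, n ≠ s / 2 → L.gap E_F (L.orbitMode S s x₀ n) ≠ 0 := h.map_modeWave_ne_zero
  have hnorm : ∀ n, ‖L.orbitMode S s x₀ n‖ = 1 := h.norm_modeWave
  -- The strict inequality yields instability for every power as soon as the criterion fails,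
  -- equality included.
  have hproj := fun (σ ν : ℝ) (hν : 0 < ν) (n : ℕ) (hn : n < s) (hns : n ≠ s / 2) =>
    hA.norm_proj_sq_lt_resolventForm (by positivity : 0 < (ν / s) ^ σ)
      (WeightedMultiLattice.mem_flatEigenspace_iff E_F) (hne n hn hns)
  have hunst : ∀ σ : ℝ, 0 < σ → ¬ L.SpectralCriterion E_F S s x₀ σ →
      ∀ ν, 0 < ν → L.IsOrbitallyUnstable σ (ψ ν) := by
    intro σ hσ hcrit ν hν
    obtain ⟨⟨a, ha⟩, hpow⟩ := hψ ν hν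
    rw [WeightedMultiLattice.SpectralCriterion] at hcrit
    push Not at hcrit
    obtain ⟨n, hn, hns, hle⟩ := hcrit
    refine hS.isOrbitallyUnstable hE ha (by rwa [hpow]) hσ hn hns ?_
    have h1 := hle.trans_lt (hproj σ ν hν n hn hns)
    rw [div_lt_iff₀ (by positivity)] at h1
    rw [hpow, mul_comm]
    exact h1
  have hthr : ∀ σ : ℝ, 0 < σ → L.SpectralCriterion E_F S s x₀ σ →
      ∃ Nthr : ℝ, 0 < Nthr ∧
        (∀ ν, 0 < ν → ν < Nthr → L.IsOrbitallyStable σ (ψ ν)) ∧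
        (∀ ν, Nthr < ν → L.IsOrbitallyUnstable σ (ψ ν)) := by
    intro σ hσ hcrit
    have hmem : ∀ n, n ∈ (Finset.range s).filter (· ≠ s / 2) ↔ n < s ∧ n ≠ s / 2 := by
      intro n
      rw [Finset.mem_filter, Finset.mem_range]
    obtain ⟨κ₁, hκ₁, hlow, hhigh⟩ := exists_common_threshold
      (T := (Finset.range s).filter (· ≠ s / 2))
      (F := fun n κ => resolventForm (L.gap E_F) κ (L.orbitMode S s x₀ n))
      (p := fun n => ‖(L.flatEigenspace E_F).starProjection (L.orbitMode S s x₀ n)‖ ^ 2)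
      (K := ‖L.gap E_F‖) (c := 1 / (2 * σ + 1))
      -- Mode 0 is an admissible competitor: `s` is even and positive, so `s / 2 ≠ 0`. Nonemptiness
      -- makes the threshold finite.
      ⟨0, (hmem 0).2 ⟨hS.s_pos, by
        obtain ⟨k, hk⟩ := hS.s_even
        have := hS.s_pos
        omega⟩⟩
      (fun n hn κ κ' hκ hlt =>
        hA.resolventForm_strictMono hκ hlt (hne n ((hmem n).1 hn).1 ((hmem n).1 hn).2))
      (fun n _ η hη => hA.exists_resolventForm_lt (WeightedMultiLattice.mem_flatEigenspace_iff E_F) _ hη)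
      (fun n _ κ hκ => hA.one_sub_resolventForm_le hκ (hnorm n))
      (by rw [div_lt_one (by positivity)]; linarith)
      (fun n hn => hcrit n ((hmem n).1 hn).1 ((hmem n).1 hn).2)
    -- The relation κ = (ν/s)^σ solved for ν at the threshold `κ₁`.
    refine ⟨s * κ₁ ^ (1 / σ), by positivity, fun ν hν hlt => ?_, fun ν hlt => ?_⟩
    · obtain ⟨⟨a, ha⟩, hpow⟩ := hψ ν hν
      refine hS.isOrbitallyStable hE ha (by rwa [hpow]) hσ fun n hn hns => ?_
      have h1 : (ν / s) ^ σ < κ₁ := by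
        have h2 : ν / s < κ₁ ^ (1 / σ) := by rwa [div_lt_iff₀' hs]
        have h3 := Real.rpow_lt_rpow (by positivity) h2 hσ
        rwa [← Real.rpow_mul hκ₁.le, one_div_mul_cancel hσ.ne', Real.rpow_one] at h3
      have h2 := hlow _ (by positivity) h1 n ((hmem n).2 ⟨hn, hns⟩)
      rw [lt_div_iff₀ (by positivity)] at h2
      rw [hpow, mul_comm]
      exact h2
    · have hν : 0 < ν := lt_trans (by positivity) hlt
      obtain ⟨⟨a, ha⟩, hpow⟩ := hψ ν hν
      have h1 : κ₁ < (ν / s) ^ σ := by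
        have h2 : κ₁ ^ (1 / σ) < ν / s := by rwa [lt_div_iff₀' hs]
        have h3 := Real.rpow_lt_rpow (by positivity) h2 hσ
        rwa [← Real.rpow_mul hκ₁.le, one_div_mul_cancel hσ.ne', Real.rpow_one] at h3
      obtain ⟨n, hn, hlt'⟩ := hhigh _ h1
      refine hS.isOrbitallyUnstable hE ha (by rwa [hpow]) hσ ((hmem n).1 hn).1 ((hmem n).1 hn).2 ?_
      rw [div_lt_iff₀ (by positivity)] at hlt'
      rw [hpow, mul_comm]
      exact hlt'
  have hex : ∃ σ > 0, L.SpectralCriterion E_F S s x₀ σ := by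
    have h1 : ∀ n ∈ (Finset.range s).filter (· ≠ s / 2),
        ‖(L.flatEigenspace E_F).starProjection (L.orbitMode S s x₀ n)‖ ^ 2 < 1 := by
      intro n hn
      rw [Finset.mem_filter, Finset.mem_range] at hn
      have h2 := hA.resolventForm_lt one_pos (hne n hn.1 hn.2)
      rw [hnorm, one_pow] at h2
      exact (hA.norm_proj_sq_lt_resolventForm one_pos (WeightedMultiLattice.mem_flatEigenspace_iff E_F)
        (hne n hn.1 hn.2)).trans h2
    obtain ⟨b, hb, hb1, hle⟩ := Finset.exists_pos_upper_bound_lt _ _ one_pos h1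
    -- With this σ, 1/(2σ+1) = 2b/(1+b), which exceeds `b` because `b < 1`. Positivity of `b` covers
    -- the case of vanishing projections.
    refine ⟨(1 - b) / (4 * b), div_pos (by linarith) (by positivity), fun n hn hns => ?_⟩
    have h2 := hle n (by simp [hn, hns])
    refine h2.trans_lt ?_
    have : 2 * ((1 - b) / (4 * b)) + 1 = (1 + b) / (2 * b) := by
      field_simp
      ring
    rw [this, one_div_div, lt_div_iff₀ (by linarith)]
    nlinarith
  have hanti : ∀ σ σ', 0 < σ → σ < σ' → L.SpectralCriterion E_F S s x₀ σ' →
      L.SpectralCriterion E_F S s x₀ σ := by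
    intro σ σ' hσ hlt hcrit n hn hns
    refine (hcrit n hn hns).trans ?_
    gcongr
  obtain ⟨σcr, hpos, hsub, hsuper⟩ := exists_critical_exponent
    (P := L.SpectralCriterion E_F S s x₀) hex hanti
  refine ⟨⟨σcr, hpos, fun σ hσ hlt => hthr σ hσ (hsub σ hσ hlt), fun σ hlt =>
    hunst σ (hsuper σ hlt).1 (hsuper σ hlt).2⟩, fun σ hσ => ⟨⟨?_, fun hcrit => ?_⟩, hunst σ hσ⟩⟩
  · rintro ⟨ν₀, hν₀, hst⟩
    by_contra hcrit
    exact (hst (ν₀ / 2) (by positivity) (by linarith)).not_isOrbitallyUnstable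
      (hunst σ hσ hcrit _ (by positivity))
  · obtain ⟨N, hN, hst, -⟩ := hthr σ hσ hcrit
    exact ⟨N, hN, hst⟩
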